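/- A literal is a variable $v$ or its complement $\overline{v}$; a clause is a finite set of literals containing no two complementary literals, and a clause-set is a finite set of clauses. For a clause-set $F$ let $\mathrm{lit}(F)$ be the set of all literals whose variable occurs in $F$, let $\delta(F)$ (the deficiency) be the number of clauses minus the number of variables occurring in $F$, and let $\|F\| = \sum_{C \in F} |C|$ (the length). A 2-MU is a clause-set $F$, all of whose clauses have length at most $2$, such that $F$ is unsatisfiable while $F \setminus \{C\}$ is satisfiable for every $C \in F$. An isomorphism from $F$ to $F'$ is a bijection $f : \mathrm{lit}(F) \to \mathrm{lit}(F')$ with $f(\overline{x}) = \overline{f(x)}$ for all $x \in \mathrm{lit}(F)$ and $\{f(C) : C \in F\} = F'$. The automorphism group $\mathrm{Aut}(F)$ consists of the isomorphisms from $F$ to $F$, under composition. Let $k \ge 2$. (1) If $F, F'$ are 2-MUs with $\delta(F) = \delta(F') = k$, then there are at most $4k$ isomorphisms from $F$ to $F'$. (2) If $F$ is a 2-MU with $\delta(F) = k$, then $\mathrm{Aut}(F)$ is isomorphic to a subgroup of the dihedral group with $4k$ elements. (3) The group table of $\mathrm{Aut}(F)$ can be constructed in time $O(k \cdot \|F\|)$.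 Precisely: there are a single program of a random access machine (integer registers and arrays; addition, subtraction, comparison and indirect addressing at unit cost; no multiplication) and a constant $c$ such that for every $k \ge 2$ and every 2-MU $F$ with $\delta(F) = k$ and with variables in $\{1, 2, 3, \dots\}$, given as a list of its clauses in the DIMACS form (the integer $v$ for a variable, $-v$ for its complement, and $0$ at the end of each clause), the program halts after at most $c \cdot k \cdot \|F\|$ steps with the following output: the order $N$ of $\mathrm{Aut}(F)$; the elements $g_0, \dots, g_{N-1}$ of $\mathrm{Aut}(F)$, each given as the input sequence with every literal replaced by its image; and the $N \times N$ table whose entry at $(i, j)$ is the index of $g_i \circ g_j$. -/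

import Mathlib

namespace TwoCNF

/-! ### Clause-sets -/

/-- A literal over the variables `V`: `(v, true)` is the variable `v`, `(v, false)` its complement. -/
abbrev Lit (V : Type*) := V × Bool

/-- The complement of a literal. -/
def Lit.compl {V : Type*} (x : Lit V) : Lit V := (x.1, !x.2)

section Basic

variable {V : Type*} [DecidableEq V]

/-- A finite set of finite sets of literals is a clause-set iff all its elements are clauses, that
is, contain no two complementary literals. -/
def IsClauseSet (F : Finset (Finset (Lit V))) : Prop :=
  ∀ C ∈ F, ∀ x ∈ C, x.compl ∉ C

/-- The set of variables occurring in `F`. -/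
def vars (F : Finset (Finset (Lit V))) : Finset V :=
  F.biUnion fun C => C.image Prod.fst

/-- The set of all literals whose variable occurs in `F`. -/
def lits (F : Finset (Finset (Lit V))) : Finset (Lit V) :=
  vars F ×ˢ Finset.univ

/-- The deficiency: number of clauses minus number of variables. -/
def deficiency (F : Finset (Finset (Lit V))) : ℤ :=
  (F.card : ℤ) - ((vars F).card : ℤ)

/-- The length `‖F‖`: the number of literal occurrences. -/
def length (F : Finset (Finset (Lit V))) : ℕ :=
  ∑ C ∈ F, C.card

/-- Some truth assignment makes at least one literal true in every clause. -/
def Satisfiable (F : Finset (Finset (Lit V))) : Prop :=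
  ∃ τ : V → Bool, ∀ C ∈ F, ∃ x ∈ C, τ x.1 = x.2

/-- Minimally unsatisfiable clause-sets all of whose clauses have length at most two. -/
structure IsTwoMU (F : Finset (Finset (Lit V))) : Prop where
  isClauseSet : IsClauseSet F
  card_le_two : ∀ C ∈ F, C.card ≤ 2
  unsat : ¬ Satisfiable F
  minimal : ∀ C ∈ F, Satisfiable (F.erase C)

/-! ### Isomorphisms and automorphisms -/

lemma compl_mem_lits {F : Finset (Finset (Lit V))} {x : Lit V} (hx : x ∈ lits F) :
    x.compl ∈ lits F := by
  simpa [lits, Lit.compl] using hx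

lemma mem_lits {F : Finset (Finset (Lit V))} {C : Finset (Lit V)} (hC : C ∈ F) {x : Lit V}
    (hx : x ∈ C) : x ∈ lits F := by
  simp only [lits, vars, Finset.mem_product, Finset.mem_biUnion, Finset.mem_image,
    Finset.mem_univ, and_true]
  exact ⟨C, hC, x, hx, rfl⟩

/-- Complementation on the literals of `F`. -/
def litCompl (F : Finset (Finset (Lit V))) (x : lits F) : lits F :=
  ⟨x.1.compl, compl_mem_lits x.2⟩

/-- The image `f(C) = {f(x) : x ∈ C}` of a clause under a map between literals. -/
def mapClause {F G : Finset (Finset (Lit V))} (f : lits F → lits G) (C : Finset (Lit V)) :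
    Finset (Lit V) :=
  (Finset.univ.filter fun x : lits F => (x : Lit V) ∈ C).image fun x => (f x : Lit V)

/-- A complement-preserving bijection `lits F → lits G` that maps `F` to `G`. -/
def IsIsomorphism (F G : Finset (Finset (Lit V))) (f : lits F ≃ lits G) : Prop :=
  (∀ x, f (litCompl F x) = litCompl G (f x)) ∧ F.image (mapClause f) = G

lemma mapClause_id {F : Finset (Finset (Lit V))} {C : Finset (Lit V)} (hC : C ∈ F) :
    mapClause (F := F) (G := F) (fun x => x) C = C := by
  ext y
  simp only [mapClause, Finset.mem_image, Finset.mem_filter, Finset.mem_univ, true_and]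
  constructor
  · rintro ⟨x, hx, rfl⟩
    exact hx
  · intro hy
    exact ⟨⟨y, mem_lits hC hy⟩, hy, rfl⟩

lemma mapClause_comp {F G H : Finset (Finset (Lit V))} (g : lits G → lits H)
    (f : lits F → lits G) (C : Finset (Lit V)) :
    mapClause (fun x => g (f x)) C = mapClause g (mapClause f C) := by
  ext y
  simp only [mapClause, Finset.mem_image, Finset.mem_filter, Finset.mem_univ, true_and]
  constructor
  · rintro ⟨x, hx, rfl⟩
    exact ⟨f x, ⟨x, hx, rfl⟩, rfl⟩
  · rintro ⟨z, ⟨x, hx, hz⟩, rfl⟩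
    refine ⟨x, hx, ?_⟩
    rw [Subtype.ext hz]

/-- The automorphism group of `F`, under composition of maps. -/
def autGroup (F : Finset (Finset (Lit V))) : Subgroup (Equiv.Perm (lits F)) where
  carrier := {f | IsIsomorphism F F f}
  one_mem' := by
    refine ⟨fun x => rfl, ?_⟩
    exact (Finset.image_congr (fun C hC => mapClause_id hC)).trans Finset.image_id
  mul_mem' := by
    rintro g f ⟨hg, hgF⟩ ⟨hf, hfF⟩
    refine ⟨fun x => by simp [Equiv.Perm.mul_apply, hf, hg], ?_⟩
    have h : mapClause (F := F) (G := F) (g * f : Equiv.Perm (lits F))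
        = mapClause g ∘ mapClause f := funext fun C => mapClause_comp g f C
    rw [h, ← Finset.image_image, hfF, hgF]
  inv_mem' := by
    rintro f ⟨hf, hfF⟩
    refine ⟨fun x => ?_, ?_⟩
    · rw [Equiv.Perm.inv_eq_iff_eq, hf]
      simp
    · have h : (F.image (mapClause f)).image (mapClause (f⁻¹ : Equiv.Perm (lits F))) = F := by
        rw [Finset.image_image]
        refine (Finset.image_congr (g := id) fun C hC => ?_).trans Finset.image_id
        rw [Function.comp_apply, ← mapClause_comp]
        simpa using mapClause_id hC
      rwa [hfF] at h

end Basic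

/-! ### Random access machines

Programs of a random access machine under the uniform cost criterion, without multiplication, in
structured form. The machine has integer registers `0, 1, 2, …` and integer arrays `0, 1, 2, …`, of
which a program uses finitely many; the cells of an array are indexed by the integers. -/

/-- A configuration of the machine. -/
structure State where
  reg : ℕ → ℤ
  arr : ℕ → ℤ → ℤ

/-- Write `v` into register `r`. -/
def State.setReg (s : State) (r : ℕ) (v : ℤ) : State :=
  { s with reg := Function.update s.reg r v }

/-- Write `v` into the cell `i` of array `a`. -/
def State.setArr (s : State) (a : ℕ) (i v : ℤ) : State :=
  { s with arr := Function.update s.arr a (Function.update (s.arr a) i v) }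

/-- Arithmetic expressions; `load a e` is the content of the cell `e` of array `a`. -/
inductive Expr where
  | const (c : ℤ)
  | reg (r : ℕ)
  | load (a : ℕ) (e : Expr)
  | add (e₁ e₂ : Expr)
  | sub (e₁ e₂ : Expr)

/-- The value of an expression. -/
def Expr.eval (s : State) : Expr → ℤ
  | .const c => c
  | .reg r => s.reg r
  | .load a e => s.arr a (e.eval s)
  | .add e₁ e₂ => e₁.eval s + e₂.eval s
  | .sub e₁ e₂ => e₁.eval s - e₂.eval s

/-- The number of elementary operations needed to evaluate an expression. -/
def Expr.cost : Expr → ℕ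
  | .const _ => 1
  | .reg _ => 1
  | .load _ e => e.cost + 1
  | .add e₁ e₂ => e₁.cost + e₂.cost + 1
  | .sub e₁ e₂ => e₁.cost + e₂.cost + 1

/-- Programs. The branching condition of `ite e₁ e₂` and of `loop e₁ e₂` is `e₁ ≤ e₂`. -/
inductive Prog where
  | skip
  | assign (r : ℕ) (e : Expr)
  | store (a : ℕ) (i e : Expr)
  | seq (p q : Prog)
  | ite (e₁ e₂ : Expr) (p q : Prog)
  | loop (e₁ e₂ : Expr) (p : Prog)

/-- `Exec p s t s'`: the program `p`, started in `s`, halts in `s'` after exactly `t` steps. -/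
inductive Exec : Prog → State → ℕ → State → Prop where
  | skip (s : State) : Exec .skip s 1 s
  | assign (s : State) (r : ℕ) (e : Expr) :
      Exec (.assign r e) s (e.cost + 1) (s.setReg r (e.eval s))
  | store (s : State) (a : ℕ) (i e : Expr) :
      Exec (.store a i e) s (i.cost + e.cost + 1) (s.setArr a (i.eval s) (e.eval s))
  | seq {p q : Prog} {s s' s'' : State} {t t' : ℕ} :
      Exec p s t s' → Exec q s' t' s'' → Exec (.seq p q) s (t + t') s''
  | ite_true {e₁ e₂ : Expr} {p q : Prog} {s s' : State} {t : ℕ} :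
      e₁.eval s ≤ e₂.eval s → Exec p s t s' →
        Exec (.ite e₁ e₂ p q) s (e₁.cost + e₂.cost + 1 + t) s'
  | ite_false {e₁ e₂ : Expr} {p q : Prog} {s s' : State} {t : ℕ} :
      ¬ e₁.eval s ≤ e₂.eval s → Exec q s t s' →
        Exec (.ite e₁ e₂ p q) s (e₁.cost + e₂.cost + 1 + t) s'
  | loop_done {e₁ e₂ : Expr} {p : Prog} {s : State} :
      ¬ e₁.eval s ≤ e₂.eval s → Exec (.loop e₁ e₂ p) s (e₁.cost + e₂.cost + 1) s
  | loop_step {e₁ e₂ : Expr} {p : Prog} {s s' s'' : State} {t t' : ℕ} :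
      e₁.eval s ≤ e₂.eval s → Exec p s t s' → Exec (.loop e₁ e₂ p) s' t' s'' →
        Exec (.loop e₁ e₂ p) s (e₁.cost + e₂.cost + 1 + t + t') s''

/-! ### Input and output -/

/-- The integer `v` for the variable `v ∈ {1, 2, …}` and `-v` for its complement. -/
def litCode (x : Lit ℕ+) : ℤ := if x.2 then (x.1 : ℤ) else -(x.1 : ℤ)

/-- The DIMACS sequence of a list of clauses: the literals of each clause followed by a zero. -/
def dimacs (cs : List (List (Lit ℕ+))) : List ℤ :=
  cs.flatMap fun c => c.map litCode ++ [0]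

/-- `cs` lists the clauses of `F`, each by a list of its literals, without repetitions. -/
def ListsClauses (cs : List (List (Lit ℕ+))) (F : Finset (Finset (Lit ℕ+))) : Prop :=
  (∀ c ∈ cs, c.Nodup) ∧ (cs.map List.toFinset).Nodup ∧ (cs.map List.toFinset).toFinset = F

/-- The initial configuration on input `w`: array `0` holds `w`, register `0` holds the length of
`w`, and everything else is zero. -/
def initState (w : List ℤ) : State where
  reg := fun r => if r = 0 then (w.length : ℤ) else 0
  arr := fun a i => if a = 0 ∧ 0 ≤ i then w.getD i.toNat 0 else 0

/-- A permutation of the literals of `F`, extended by the identity to all literals. -/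
def extend {F : Finset (Finset (Lit ℕ+))} (f : Equiv.Perm (lits F)) (x : Lit ℕ+) : Lit ℕ+ :=
  if h : x ∈ lits F then (f ⟨x, h⟩ : Lit ℕ+) else x

/-- The configuration `s` contains the group table of the automorphism group of `F`, where `F` was
given by `cs`: for some numbering `e` of the automorphisms by `0, …, N - 1`,
* register `0` holds `N`;
* row `i` of array `1` holds the `i`-th automorphism, in the form of the input sequence with each
  literal replaced by its image;
* array `2` holds the `N × N` multiplication table, row by row. -/
def HoldsGroupTable (cs : List (List (Lit ℕ+))) (F : Finset (Finset (Lit ℕ+))) (s : State) :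
    Prop :=
  ∃ (N : ℕ) (e : Fin N ≃ autGroup F),
    s.reg 0 = N ∧
    (∀ i : Fin N, ∀ p < (dimacs cs).length,
      s.arr 1 (((i : ℕ) * (dimacs cs).length + p : ℕ) : ℤ) =
        (dimacs (cs.map (List.map (extend (e i : Equiv.Perm (lits F)))))).getD p 0) ∧
    (∀ i j : Fin N, s.arr 2 (((i : ℕ) * N + (j : ℕ) : ℕ) : ℤ) = ((e.symm (e i * e j) : Fin N) : ℕ))

end TwoCNF

/-! Read each clause {ū, v} as the two arcs u → v and v̄ → ū. The resulting digraph is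
skew-symmetric: reversing and complementing a walk (mirroring it) gives a walk. A 2-CNF without the
empty clause is unsatisfiable iff some literal lies on a closed walk with its complement. A shortest
such walk, possibly with one half mirrored, is a simple cycle `c` (`IsTwoMU.exists_isCycle`), and
minimality forces every clause onto it (`IsCycle.covers`). So the whole 2-MU is this cycle glued to
its mirror image along chords (positions i with c̄ i also on the cycle) and hubs (clauses traversed
in both directions).

Hence every literal occurs once or twice. If k ≥ 2 there are no unit clauses, and counting
occurrences gives exactly 2k branching literals, those occurring twice (`IsCycle.card_branching`).

The crux is that the cycle is unique up to rotation and mirroring (`IsCycle.unique`). At a position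
whose complement is branching two arcs leave. The arc off the cycle runs back to the last branching
literal but one (`IsCycle.back_arm`), so a competing cycle that takes it closes up after meeting
only two branching literals, although there are 2k ≥ 4.

An isomorphism maps cycle to cycle, so it acts on positions as a rotation or a reflection, given by
a code z modulo 2L. The parity of z and the image of one branching literal determine z, which leaves
2 · 2k isomorphisms. For the group, Aut(F) embeds into the dihedral group of the L-cycle; its
rotations act freely on the 2k positions of branching literals, so their number divides 2k, and the
group embeds into the dihedral group with 4k elements.

For the algorithm, the cycle is found by walking. At each of the at most 2k branching points a look
ahead of O(L) steps tells which arc stays on the cycle. Only the at most 4k codes sending a fixed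
branching literal to a branching literal are tested, in linear time each. Products are computed by
adding or subtracting codes, so the at most 16k² entries of the table cost O(k · ‖F‖), because k ≤
|F|. -/

namespace TwoCNF

/-! ### The implication digraph -/

section Digraph

variable {V : Type*}

@[simp] lemma Lit.compl_compl (x : Lit V) : x.compl.compl = x := by simp [Lit.compl]

lemma Lit.compl_ne (x : Lit V) : x.compl ≠ x := by
  intro h
  have := congrArg Prod.snd h
  simp [Lit.compl] at this

lemma Lit.compl_inj {x y : Lit V} : x.compl = y.compl ↔ x = y :=
  ⟨fun h => by simpa using congrArg Lit.compl h, fun h => h ▸ rfl⟩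

lemma Lit.compl_eq_iff {x y : Lit V} : x.compl = y ↔ x = y.compl := by
  rw [← Lit.compl_inj, Lit.compl_compl]

lemma Lit.fst_eq_iff {x y : Lit V} : x.1 = y.1 ↔ x = y ∨ x = y.compl := by
  obtain ⟨v, a⟩ := x
  obtain ⟨w, b⟩ := y
  cases a <;> cases b <;> simp [Lit.compl]

variable [DecidableEq V]

lemma pair_eq_pair {α : Type*} [DecidableEq α] {a b c d : α} :
    ({a, b} : Finset α) = {c, d} ↔ a = c ∧ b = d ∨ a = d ∧ b = c := by
  rw [← Finset.coe_inj]
  push_cast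
  exact Set.pair_eq_pair_iff

/-- The arcs of the implication digraph: `u → v` for the clause `{ū, v}`. -/
def Arc (F : Finset (Finset (Lit V))) (u v : Lit V) : Prop := ({u.compl, v} : Finset (Lit V)) ∈ F

variable {F G : Finset (Finset (Lit V))}

lemma Arc.mirror {u v : Lit V} (h : Arc F u v) : Arc F v.compl u.compl := by
  rw [Arc, Lit.compl_compl, Finset.pair_comm]
  exact h

/-- Reachability in the implication digraph. -/
abbrev Reach (F : Finset (Finset (Lit V))) : Lit V → Lit V → Prop := Relation.ReflTransGen (Arc F)

lemma Reach.mirror {u v : Lit V} (h : Reach F u v) : Reach F v.compl u.compl := by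
  induction h with
  | refl => exact .refl
  | tail _ h ih => exact .trans (.single h.mirror) ih

/-- Truth propagates along arcs, so neither truth value of `x` is possible. -/
lemma not_satisfiable_of_reach {x : Lit V} (h₁ : Reach F x x.compl) (h₂ : Reach F x.compl x) :
    ¬ Satisfiable F := by
  rintro ⟨τ, hτ⟩
  have key : ∀ u v, Reach F u v → τ u.1 = u.2 → τ v.1 = v.2 := by
    intro u v h hu
    induction h with
    | refl => exact hu
    | @tail b c _ h ih =>
      obtain ⟨y, hy, hy'⟩ := hτ _ h
      rcases Finset.mem_insert.1 hy with rfl | hy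
      · simp [Lit.compl, ih] at hy'
      · rwa [Finset.mem_singleton.1 hy] at hy'
  have h1 := key _ _ h₁
  have h2 := key _ _ h₂
  obtain ⟨v, b⟩ := x
  simp only [Lit.compl] at h1 h2
  cases hv : τ v <;> cases b <;> simp_all

/-- An unsatisfiable set of nonempty clauses of length at most two contains a literal that lies on
a closed walk with its complement. -/
lemma exists_reach_of_unsat (hne : ∀ C ∈ F, C.Nonempty) (h2 : ∀ C ∈ F, C.card ≤ 2)
    (hF : ¬ Satisfiable F) : ∃ x, Reach F x x.compl ∧ Reach F x.compl x := by
  by_contra! hno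
  -- The set of true literals is built variable by variable; it stays consistent and closed under
  -- reachability.
  have key : ∀ U : Finset V, ∃ S : Set (Lit V), (∀ x ∈ S, x.compl ∉ S) ∧
      (∀ x ∈ S, ∀ y, Reach F x y → y ∈ S) ∧ ∀ v ∈ U, ∃ b, (v, b) ∈ S := by
    intro U
    induction U using Finset.induction_on with
    | empty => exact ⟨∅, by simp⟩
    | insert v U _ ih =>
      obtain ⟨S, hS1, hS2, hS3⟩ := ih
      by_cases hv : ∃ b, (v, b) ∈ S
      · refine ⟨S, hS1, hS2, fun w hw => ?_⟩
        rcases Finset.mem_insert.1 hw with rfl | hw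
        exacts [hv, hS3 w hw]
      -- One of the two literals of `v` does not reach its complement. Adding all it reaches is
      -- safe: if `x` reached both y and ȳ, mirroring the second walk would lead from y to x̄.
      · obtain ⟨x, hx, hxv⟩ : ∃ x : Lit V, ¬ Reach F x x.compl ∧ x.1 = v := by
          by_cases h : Reach F (v, true) (Lit.compl (v, true))
          · exact ⟨Lit.compl (v, true), by simpa using hno _ h, rfl⟩
          · exact ⟨_, h, rfl⟩
        have hxS : x ∉ S := fun h => hv ⟨x.2, by rw [← hxv]; exact h⟩
        have hxS' : x.compl ∉ S := fun h => hv ⟨!x.2, by rw [← hxv]; exact h⟩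
        refine ⟨S ∪ {y | Reach F x y}, ?_, ?_, ?_⟩
        · rintro y (hy | hy) (hy' | hy')
          · exact hS1 y hy hy'
          · exact hxS' (hS2 y hy _ (by simpa using Reach.mirror hy'))
          · exact hxS' (hS2 _ hy' _ (Reach.mirror hy))
          · exact hx (Relation.ReflTransGen.trans hy (by simpa using Reach.mirror hy'))
        · rintro y (hy | hy) z hz
          · exact .inl (hS2 y hy z hz)
          · exact .inr (Relation.ReflTransGen.trans hy hz)
        · intro w hw
          rcases Finset.mem_insert.1 hw with rfl | hw
          · exact ⟨x.2, .inr (by rw [← hxv]; exact Relation.ReflTransGen.refl)⟩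
          · obtain ⟨b, hb⟩ := hS3 w hw
            exact ⟨b, .inl hb⟩
  obtain ⟨S, hS1, hS2, hS3⟩ := key (vars F)
  classical
  apply hF
  have htrue : ∀ x ∈ S, decide ((x.1, true) ∈ S) = x.2 := by
    rintro ⟨v, b⟩ hx
    cases b
    · have := hS1 _ hx
      simpa [Lit.compl] using this
    · simpa using hx
  refine ⟨fun v => decide ((v, true) ∈ S), fun C hC => ?_⟩
  obtain ⟨a, ha⟩ := hne C hC
  -- A unit clause is read as {a, a}, that is, as the arc ā → a.
  have hCab : ∃ b, C = {a, b} := by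
    have h1 : (C.erase a).card ≤ 1 := by
      rw [Finset.card_erase_of_mem ha]
      have := h2 C hC
      omega
    rcases Finset.eq_empty_or_nonempty (C.erase a) with h | ⟨b, hb⟩
    · exact ⟨a, by rw [← Finset.insert_erase ha, h]; simp⟩
    · refine ⟨b, ?_⟩
      rw [← Finset.insert_erase ha]
      congr 1
      exact Finset.eq_singleton_iff_unique_mem.2
        ⟨hb, fun y hy => Finset.card_le_one.1 h1 _ hy _ hb⟩
  obtain ⟨b, rfl⟩ := hCab
  by_cases haS : a ∈ S
  · exact ⟨a, by simp, htrue a haS⟩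
  · have hv : a.1 ∈ vars F := by
      simp only [vars, Finset.mem_biUnion, Finset.mem_image]
      exact ⟨_, hC, a, ha, rfl⟩
    obtain ⟨t, ht⟩ := hS3 _ hv
    have hac : a.compl ∈ S := by
      obtain ⟨v, s⟩ := a
      have : t = !s := by
        rcases Bool.eq_or_eq_not t s with h | h
        · exact absurd (h ▸ ht) haS
        · exact h
      rw [this] at ht
      exact ht
    have hb : b ∈ S := hS2 _ hac b (.single (by rwa [Arc, Lit.compl_compl]))
    exact ⟨b, by simp, htrue b hb⟩

/-- The form in which minimality is always used: removing a clause destroys every contradictory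
closed walk. -/
lemma IsTwoMU.no_reach_erase (hF : IsTwoMU F) {C : Finset (Lit V)} (hC : C ∈ F) {x : Lit V}
    (h₁ : Reach (F.erase C) x x.compl) : ¬ Reach (F.erase C) x.compl x :=
  fun h₂ => not_satisfiable_of_reach h₁ h₂ (hF.minimal C hC)

/-- The empty clause alone is unsatisfiable, so the only 2-MU containing it is {∅}, of deficiency
one. -/
lemma IsTwoMU.nonempty_of_deficiency (hF : IsTwoMU F) (hk : 2 ≤ deficiency F) {C : Finset (Lit V)}
    (hC : C ∈ F) : C.Nonempty := by
  by_contra h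
  rw [Finset.not_nonempty_iff_eq_empty] at h
  subst h
  have : F = {∅} := by
    refine Finset.eq_singleton_iff_unique_mem.2 ⟨hC, fun D hD => ?_⟩
    by_contra hne
    obtain ⟨τ, hτ⟩ := hF.minimal D hD
    obtain ⟨x, hx, -⟩ := hτ ∅ (Finset.mem_erase.2 ⟨fun h => hne h.symm, hC⟩)
    simp at hx
  rw [deficiency, this] at hk
  simp at hk
  omega

/-! ### Walks of given length -/

/-- There is a walk of length `n` from `u` to `v`. -/
def IsWalk (F : Finset (Finset (Lit V))) (n : ℕ) (u v : Lit V) : Prop :=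
  ∃ w : ℕ → Lit V, w 0 = u ∧ w n = v ∧ ∀ i < n, Arc F (w i) (w (i + 1))

lemma IsWalk.trans {m n : ℕ} {u v x : Lit V} (h₁ : IsWalk F m u v) (h₂ : IsWalk F n v x) :
    IsWalk F (m + n) u x := by
  obtain ⟨w, hw0, hwm, hw⟩ := h₁
  obtain ⟨w', hw0', hwn', hw'⟩ := h₂
  refine ⟨fun i => if i ≤ m then w i else w' (i - m), by simp [hw0], ?_, fun i hi => ?_⟩
  · rcases Nat.eq_zero_or_pos n with rfl | hn
    · simp [hwm, ← hw0', hwn']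
    · have : ¬ m + n ≤ m := by omega
      simp [this, hwn']
  · rcases lt_trichotomy i m with h | rfl | h
    · have h1 : i ≤ m := h.le
      have h2 : i + 1 ≤ m := h
      simpa [h1, h2] using hw i h
    · have h2 : ¬ i + 1 ≤ i := by omega
      simpa [hwm, ← hw0'] using hw' 0 (by omega)
    · have h1 : ¬ i ≤ m := by omega
      have h2 : ¬ i + 1 ≤ m := by omega
      have h3 : i + 1 - m = i - m + 1 := by omega
      simpa only [h1, h2, if_false, h3] using hw' (i - m) (by omega)

lemma IsWalk.mirror {n : ℕ} {u v : Lit V} (h : IsWalk F n u v) : IsWalk F n v.compl u.compl := by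
  obtain ⟨w, hw0, hwn, hw⟩ := h
  refine ⟨fun i => (w (n - i)).compl, by simp [hwn], by simp [hw0], fun i hi => ?_⟩
  have := (hw (n - (i + 1)) (by omega)).mirror
  rwa [show n - (i + 1) + 1 = n - i by omega] at this

lemma Reach.exists_isWalk {u v : Lit V} (h : Reach F u v) : ∃ n, IsWalk F n u v := by
  induction h with
  | refl => exact ⟨0, fun _ => u, rfl, rfl, by simp⟩
  | @tail b c _ h ih =>
    obtain ⟨n, hn⟩ := ih
    exact ⟨n + 1, hn.trans ⟨fun i => if i = 0 then b else c, by simp, by simp, fun i hi => by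
      obtain rfl : i = 0 := by omega
      simpa using h⟩⟩

end Digraph


/-! ### The contradictory cycle -/

section Cycle

variable {V : Type*} [DecidableEq V] {F : Finset (Finset (Lit V))}

/-- A simple cycle `c` of length `L` in the implication digraph, as a periodic sequence, that
contains two complementary literals. -/
structure IsCycle (F : Finset (Finset (Lit V))) (L : ℕ) (c : ℤ → Lit V) : Prop where
  pos : 0 < L
  arc : ∀ i, Arc F (c i) (c (i + 1))
  eq_iff : ∀ i j, c i = c j ↔ (L : ℤ) ∣ i - j
  contra : ∃ i j, c j = (c i).compl

lemma isCycle_of_nat {L : ℕ} (hL : 0 < L) {w : ℕ → Lit V} (hw : ∀ i < L, Arc F (w i) (w (i + 1)))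
    (h0 : w L = w 0) (hinj : ∀ i j, i < j → j < L → w i ≠ w j)
    (hc : ∃ i j, i < L ∧ j < L ∧ w j = (w i).compl) :
    IsCycle F L fun i : ℤ => w (i % L).toNat := by
  have hL' : (0 : ℤ) < L := by exact_mod_cast hL
  have hlt : ∀ i : ℤ, (i % L).toNat < L := fun i => by
    have := Int.emod_lt_of_pos i hL'
    omega
  have hnn : ∀ i : ℤ, 0 ≤ i % L := fun i => Int.emod_nonneg i hL'.ne'
  refine ⟨hL, fun i => ?_, fun i j => ?_, ?_⟩
  · have := hw _ (hlt i)
    by_cases h : (i % L).toNat + 1 = L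
    · have h1 : (i + 1) % L = 0 := by
        rw [Int.add_emod]
        have := hnn i
        have h2 : i % L = L - 1 := by omega
        rcases Nat.lt_or_ge 1 L with h3 | h3
        · rw [h2, Int.emod_eq_of_lt (a := 1) (by omega) (by omega)]
          simp
        · obtain rfl : L = 1 := by omega
          simp
      rw [h, h0] at this
      simpa [h1] using this
    · have h1 : (i + 1) % L = i % L + 1 := by
        have := hnn i
        have := hlt i
        rw [Int.add_emod, Int.emod_eq_of_lt (a := 1) (by omega) (by omega),
          Int.emod_eq_of_lt (by omega) (by omega)]
      have h2 : ((i + 1) % L).toNat = (i % L).toNat + 1 := by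
        have := hnn i
        omega
      simp only [h2]
      exact this
  · rw [← Int.emod_emod_of_dvd i (dvd_refl (L : ℤ)), ← Int.emod_eq_emod_iff_emod_sub_eq_zero.trans
      Int.dvd_iff_emod_eq_zero.symm, Int.emod_emod_of_dvd i (dvd_refl (L : ℤ))]
    constructor
    · intro h
      have := hnn i
      have := hnn j
      rcases lt_trichotomy (i % L).toNat (j % L).toNat with h1 | h1 | h1
      · exact absurd h (hinj _ _ h1 (hlt j))
      · omega
      · exact absurd h.symm (hinj _ _ h1 (hlt i))
    · intro h
      simp only [h]
  · obtain ⟨i, j, hi, hj, h⟩ := hc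
    refine ⟨i, j, ?_⟩
    have h1 : ((i : ℤ) % L).toNat = i := by
      rw [Int.emod_eq_of_lt (by omega) (by omega)]; simp
    have h2 : ((j : ℤ) % L).toNat = j := by
      rw [Int.emod_eq_of_lt (by omega) (by omega)]; simp
    simp only [h1, h2, h]

/-- A closed walk as a sequence, with the complement of its first literal at position `p`. -/
def IsClosedWalk (F : Finset (Finset (Lit V))) (p L : ℕ) (w : ℕ → Lit V) : Prop :=
  p < L ∧ (∀ i < L, Arc F (w i) (w (i + 1))) ∧ w L = w 0 ∧ w p = (w 0).compl

lemma IsClosedWalk.seg {p L : ℕ} {w : ℕ → Lit V} (h : IsClosedWalk F p L w) {a b : ℕ} (hab : a ≤ b)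
    (hb : b ≤ L) : IsWalk F (b - a) (w a) (w b) :=
  ⟨fun i => w (a + i), rfl, congrArg w (Nat.add_sub_cancel' hab), fun i hi => h.2.1 _ (by omega)⟩

/-- A repetition inside one of the two halves could be cut out, leaving a shorter contradictory
walk. Only meetings between the two halves need the hypothesis `hcross`. -/
lemma IsClosedWalk.injective {p L : ℕ} {w : ℕ → Lit V} (h : IsClosedWalk F p L w)
    (hmin : ∀ x a b, IsWalk F a x x.compl → IsWalk F b x.compl x → L ≤ a + b)
    (hcross : ∀ i j, 0 < i → i < p → p < j → j < L → w i ≠ w j) :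
    ∀ i j, i < j → j < L → w i ≠ w j := by
  intro i j hij hj e
  have hp := h.1
  have e0 := h.2.2.1
  have ep := h.2.2.2
  have s1 : IsWalk F (p - 0) (w 0) (w 0).compl := ep ▸ h.seg (Nat.zero_le p) hp.le
  have s2 : IsWalk F (L - p) (w 0).compl (w 0) := by
    have := h.seg hp.le le_rfl
    rwa [ep, e0] at this
  rcases le_or_gt j p with hjp | hjp
  · have := (h.seg (Nat.zero_le i) (by omega)).trans (e ▸ h.seg hjp hp.le)
    rw [ep] at this
    have := hmin _ _ _ this s2
    omega
  · rcases lt_or_ge i p with hip | hip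
    · rcases Nat.eq_zero_or_pos i with rfl | hi
      · have := h.seg hjp.le hj.le
        rw [ep, ← e] at this
        have := hmin _ _ _ s1 this
        omega
      · exact hcross i j hi hip hjp hj e
    · have := (h.seg hip (by omega)).trans (e ▸ h.seg hj.le le_rfl)
      rw [ep, e0] at this
      have := hmin _ _ _ s1 this
      omega

/-- A shortest contradictory closed walk does not meet its first part both in its second part and
in the mirror image of its second part. -/
lemma IsClosedWalk.not_cross {p L : ℕ} {w : ℕ → Lit V} (h : IsClosedWalk F p L w)
    (hmin : ∀ x a b, IsWalk F a x x.compl → IsWalk F b x.compl x → L ≤ a + b)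
    {i j i' j' : ℕ} (hi : 0 < i) (hip : i < p) (hj : p < j) (hjL : j < L)
    (hi' : 0 < i') (hip' : i' < p) (hj' : p < j') (hjL' : j' < L)
    (e : w j = w i) (e' : w j' = (w i').compl) : False := by
  have e0 := h.2.2.1
  have ep := h.2.2.2
  have hp := h.1
  -- Write y = w 0, z = w i = w j and z' = w i', so that w j' = z̄'. For each order of the indices,
  -- segments and mirrored segments form a contradictory closed walk of length below L.
  rcases le_total i i' with hii | hii <;> rcases le_total j j' with hjj | hjj
  · -- `z → z̄' → z̄ → ȳ → z`
    have s1 := (h.seg hjj hjL'.le).trans (e' ▸ (h.seg hii (by omega)).mirror)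
    have s2 := ((h.seg (Nat.zero_le i) (by omega)).mirror).trans (ep ▸ h.seg hj.le hjL.le)
    rw [e] at s1 s2
    have := hmin _ _ _ s1 s2
    omega
  · -- `z' → ȳ → z̄' → z → z'`
    have s1 := (h.seg hip'.le hp.le).trans (h.seg hj'.le hjL'.le)
    have s2 := (h.seg hjj hjL.le).trans (e.symm ▸ h.seg hii (by omega))
    rw [e'] at s1 s2
    have := hmin _ _ _ s1 s2
    omega
  · -- `z' → z → z̄' → y → z'`
    have s1 := (h.seg hii (by omega)).trans (e ▸ h.seg hjj hjL'.le)
    have s2 := (h.seg hjL'.le le_rfl).trans (e0.symm ▸ h.seg (Nat.zero_le i') (by omega))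
    rw [e'] at s1 s2
    have := hmin _ _ _ s1 s2
    omega
  · -- `z → y → z̄ → z' → z`
    have s0 := (h.seg hip.le hp.le).mirror
    rw [ep, Lit.compl_compl] at s0
    have s1 := (h.seg hjL.le le_rfl).trans (e0.symm ▸ s0)
    have s3 := (h.seg hjj hjL.le).mirror
    rw [e', Lit.compl_compl] at s3
    have s2 := s3.trans (h.seg hii (by omega))
    rw [e] at s1 s2
    have := hmin _ _ _ s1 s2
    omega

/-- The mirror image of a walk from x̄ to x leads again from x̄ to x, so the second half may be
mirrored without changing the length. -/
lemma IsClosedWalk.mirrorTail {p L : ℕ} {w : ℕ → Lit V} (h : IsClosedWalk F p L w) :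
    IsClosedWalk F p L fun i => if i ≤ p then w i else (w (L + p - i)).compl := by
  obtain ⟨hp, hw, h0, hc⟩ := h
  refine ⟨hp, fun i hi => ?_, ?_, by simp [hc]⟩
  · rcases lt_trichotomy i p with h | rfl | h
    · simpa [h.le, Nat.succ_le_of_lt h] using hw i hi
    · have h1 : ¬ i + 1 ≤ i := by omega
      have h2 : L + i - (i + 1) = L - 1 := by omega
      have := (hw (L - 1) (by omega)).mirror
      rw [show L - 1 + 1 = L by omega, h0] at this
      simpa [h1, h2, hc] using this
    · have h1 : ¬ i ≤ p := by omega
      have h2 : ¬ i + 1 ≤ p := by omega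
      have := (hw (L + p - (i + 1)) (by omega)).mirror
      rw [show L + p - (i + 1) + 1 = L + p - i by omega] at this
      simpa only [h1, h2, if_false] using this
  · have h1 : ¬ L ≤ p := by omega
    have h2 : L + p - L = p := by omega
    simp [h1, h2, hc]

lemma IsTwoMU.exists_isCycle (hF : IsTwoMU F) (hk : 2 ≤ deficiency F) :
    ∃ L c, IsCycle F L c := by
  classical
  obtain ⟨x, hx1, hx2⟩ := exists_reach_of_unsat (fun C => hF.nonempty_of_deficiency hk)
    hF.card_le_two hF.unsat
  obtain ⟨n1, h1⟩ := Reach.exists_isWalk hx1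
  obtain ⟨n2, h2⟩ := Reach.exists_isWalk hx2
  have hex : ∃ n, ∃ x a b, a + b = n ∧ IsWalk F a x x.compl ∧ IsWalk F b x.compl x :=
    ⟨_, x, n1, n2, rfl, h1, h2⟩
  obtain ⟨y, p, q, hpq, hP, hQ⟩ := Nat.find_spec hex
  generalize hLdef : Nat.find hex = L at hpq
  have hmin : ∀ x a b, IsWalk F a x x.compl → IsWalk F b x.compl x → L ≤ a + b :=
    fun x a b ha hb => hLdef ▸ Nat.find_min' hex ⟨x, a, b, rfl, ha, hb⟩
  have hp0 : 0 < p := by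
    rcases Nat.eq_zero_or_pos p with rfl | h
    · obtain ⟨w, hw0, hw1, -⟩ := hP
      exact absurd (hw1.symm.trans hw0) (Lit.compl_ne y)
    · exact h
  have hq0 : 0 < q := by
    rcases Nat.eq_zero_or_pos q with rfl | h
    · obtain ⟨w, hw0, hw1, -⟩ := hQ
      exact absurd (hw0.symm.trans hw1) (Lit.compl_ne y)
    · exact h
  obtain ⟨w, hw0, hwL, hw, hwp⟩ : ∃ w : ℕ → Lit V, w 0 = y ∧ w L = y ∧
      (∀ i < L, Arc F (w i) (w (i + 1))) ∧ w p = y.compl := by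
    obtain ⟨u, hu0, hup, hu⟩ := hP
    obtain ⟨u', hu0', huq', hu'⟩ := hQ
    refine ⟨fun i => if i ≤ p then u i else u' (i - p), by simp [hu0], ?_, ?_, by simp [hup]⟩
    · have h1 : ¬ L ≤ p := by omega
      have h2 : L - p = q := by omega
      simp [h1, h2, huq']
    · intro i hi
      rcases lt_trichotomy i p with h | rfl | h
      · simpa [h.le, Nat.succ_le_of_lt h] using hu i h
      · have h1 : ¬ i + 1 ≤ i := by omega
        simpa [h1, hup, ← hu0'] using hu' 0 hq0
      · have h1 : ¬ i ≤ p := by omega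
        have h2 : ¬ i + 1 ≤ p := by omega
        have h3 : i + 1 - p = i - p + 1 := by omega
        simpa only [h1, h2, if_false, h3] using hu' (i - p) (by omega)
  have hW : IsClosedWalk F p L w := ⟨by omega, hw, by rw [hwL, hw0], by rw [hwp, hw0]⟩
  have fin : ∀ w, IsClosedWalk F p L w →
      (∀ i j, 0 < i → i < p → p < j → j < L → w i ≠ w j) → ∃ L c, IsCycle F L c :=
    fun w hW hcross => ⟨L, _, isCycle_of_nat (by omega) hW.2.1 hW.2.2.1 (hW.injective hmin hcross)
      ⟨0, p, by omega, by omega, hW.2.2.2⟩⟩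
  -- If the halves meet, mirroring the second half helps: by `not_cross` the first half cannot also
  -- meet the mirrored one.
  by_cases hc : ∀ i j, 0 < i → i < p → p < j → j < L → w i ≠ w j
  · exact fin w hW hc
  · push Not at hc
    obtain ⟨i, j, hi, hip, hj, hjL, e⟩ := hc
    refine fin _ hW.mirrorTail fun i' j' hi' hip' hj' hjL' e' => ?_
    have h1 : ¬ j' ≤ p := by omega
    simp only [hip'.le, if_true, h1, if_false] at e'
    exact hW.not_cross hmin hi hip hj hjL hi' hip' (j' := L + p - j') (by omega) (by omega)
      e.symm (Lit.compl_eq_iff.1 e'.symm)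

end Cycle


/-! ### Chords and branching literals -/

section Chord

variable {V : Type*} {F : Finset (Finset (Lit V))} {L : ℕ} {c : ℤ → Lit V}

/-- The literal `x` occurs in two different clauses. -/
def Branching (F : Finset (Finset (Lit V))) (x : Lit V) : Prop :=
  ∃ C ∈ F, ∃ D ∈ F, C ≠ D ∧ x ∈ C ∧ x ∈ D

/-- The complement of the literal at position `i` also lies on the cycle. -/
def Chord (c : ℤ → Lit V) (i : ℤ) : Prop := ∃ m, c m = (c i).compl

/-- The cycle passes through the clause of its arc at position `t` in both directions. -/
def Hub (c : ℤ → Lit V) (t : ℤ) : Prop := ∃ s, c s = (c (t + 1)).compl ∧ c (s + 1) = (c t).compl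

lemma Hub.chord {t : ℤ} (h : Hub c t) : Chord c t := let ⟨s, _, h⟩ := h; ⟨s + 1, h⟩

lemma Hub.chord_succ {t : ℤ} (h : Hub c t) : Chord c (t + 1) := let ⟨s, h, _⟩ := h; ⟨s, h⟩

variable [DecidableEq V]

/-- The arcs leaving u come from the clauses containing ū; dually, the arcs entering v come from the
clauses containing v. -/
lemma Arc.eq_of_not_branching {u v v' : Lit V} (hu : ¬ Branching F u.compl) (h : Arc F u v)
    (h' : Arc F u v') : v = v' := by
  by_contra hne
  refine hu ⟨_, h, _, h', fun e => hne ?_, by simp, by simp⟩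
  rcases pair_eq_pair.1 e with ⟨-, e⟩ | ⟨e, e'⟩
  exacts [e, e'.trans e]

lemma Arc.eq_of_not_branching' {u u' v : Lit V} (hv : ¬ Branching F v) (h : Arc F u v)
    (h' : Arc F u' v) : u = u' :=
  Lit.compl_inj.1 (Arc.eq_of_not_branching (by rwa [Lit.compl_compl]) h.mirror h'.mirror)

namespace IsCycle

lemma L_pos (hc : IsCycle F L c) : (0 : ℤ) < L := by exact_mod_cast hc.pos

lemma add_mul (hc : IsCycle F L c) (i n : ℤ) : c (i + n * L) = c i :=
  (hc.eq_iff _ _).2 ⟨n, by ring⟩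

lemma add_L (hc : IsCycle F L c) (i : ℤ) : c (i + L) = c i := by simpa using hc.add_mul i 1

lemma shift_eq (hc : IsCycle F L c) {i j : ℤ} (h : c i = c j) (x : ℤ) : c (i + x) = c (j + x) := by
  rw [hc.eq_iff] at h ⊢
  simpa using h

lemma eq_of_lt (hc : IsCycle F L c) {i j : ℤ} (h : c i = c j) (h₁ : i < j + L) (h₂ : j < i + L) :
    i = j := by
  rw [hc.eq_iff] at h
  have := Int.eq_zero_of_abs_lt_dvd h (abs_lt.2 ⟨by omega, by omega⟩)
  omega

lemma exists_window (hc : IsCycle F L c) (i a : ℤ) : ∃ j, a ≤ j ∧ j < a + L ∧ c j = c i := by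
  refine ⟨a + (i - a) % L, ?_, ?_, ?_⟩
  · have := Int.emod_nonneg (i - a) hc.L_pos.ne'
    omega
  · have := Int.emod_lt_of_pos (i - a) hc.L_pos
    omega
  · rw [hc.eq_iff]
    refine ⟨-((i - a) / L), ?_⟩
    have := Int.emod_add_mul_ediv (i - a) L
    linarith

lemma shift (hc : IsCycle F L c) (s : ℤ) : IsCycle F L fun i => c (i + s) := by
  refine ⟨hc.pos, fun i => ?_, fun i j => ?_, ?_⟩
  · have := hc.arc (i + s)
    rwa [show i + s + 1 = i + 1 + s by ring] at this
  · rw [hc.eq_iff]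
    simp
  · obtain ⟨i, j, h⟩ := hc.contra
    exact ⟨i - s, j - s, by simpa using h⟩

lemma mirror (hc : IsCycle F L c) (s : ℤ) : IsCycle F L fun i => (c (s - i)).compl := by
  refine ⟨hc.pos, fun i => ?_, fun i j => ?_, ?_⟩
  · have := (hc.arc (s - (i + 1))).mirror
    rwa [show s - (i + 1) + 1 = s - i by ring] at this
  · rw [Lit.compl_inj, hc.eq_iff, ← dvd_neg]
    ring_nf
  · obtain ⟨i, j, h⟩ := hc.contra
    exact ⟨s - i, s - j, by simp [h]⟩

/-- If `c m = c̄ i` then the arc of the cycle at `m - 1` and the mirror image of the one at `i` are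
both arcs into `c m`. -/
lemma hub_iff (hc : IsCycle F L c) {i m : ℤ} (hm : c m = (c i).compl) :
    Hub c i ↔ c (m - 1) = (c (i + 1)).compl := by
  constructor
  · rintro ⟨s, h1, h2⟩
    have := hc.shift_eq (h2.trans hm.symm) (-1)
    rw [← h1, sub_eq_add_neg, ← this, add_neg_cancel_right]
  · intro h
    exact ⟨m - 1, h, by simpa using hm⟩

/-- The arc into position m and the mirrored arc out of position i end at the same literal; being a
hub means for either side that the two arcs coincide. -/
lemma hub_pred_iff (hc : IsCycle F L c) {i m : ℤ} (hm : c m = (c i).compl) :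
    Hub c (m - 1) ↔ Hub c i := by
  rw [hc.hub_iff hm]
  constructor
  · rintro ⟨s, h1, h2⟩
    rw [sub_add_cancel, hm, Lit.compl_compl] at h1
    rw [← hc.shift_eq h1 1, h2, Lit.compl_compl]
  · intro h
    refine ⟨i, by simp [hm], by rw [h, Lit.compl_compl]⟩

/-- Along a run of hub arcs, chords are parallel. -/
lemma hub_run (hc : IsCycle F L c) {i m : ℤ} (hm : c m = (c i).compl) (d : ℕ)
    (h : ∀ t, i - d ≤ t → t < i → Hub c t) : c (m + d) = (c (i - d)).compl := by
  induction d with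
  | zero => simpa using hm
  | succ d ih =>
    have h1 := ih fun t h1 h2 => h t (by push_cast; omega) h2
    have h2 := h (i - d - 1) (by push_cast; omega) (by omega)
    obtain ⟨s, h3, h4⟩ := h2
    rw [sub_add_cancel, ← h1] at h3
    have := hc.shift_eq h3 1
    push_cast
    rw [show m + (d + 1) = m + d + 1 by ring, ← this, h4]
    congr 2
    ring

lemma reach_erase (hc : IsCycle F L c) {C : Finset (Lit V)} {a b : ℤ} (hab : a ≤ b)
    (h : ∀ t, a ≤ t → t < b → ({(c t).compl, c (t + 1)} : Finset (Lit V)) ≠ C) :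
    Reach (F.erase C) (c a) (c b) := by
  obtain ⟨n, rfl⟩ := Int.le.dest hab
  clear hab
  induction n with
  | zero => simpa using Relation.ReflTransGen.refl
  | succ n ih =>
    refine (ih fun t h1 h2 => h t h1 (by push_cast; omega)).tail ?_
    push_cast
    rw [← add_assoc]
    exact Finset.mem_erase.2 ⟨h _ (by omega) (by push_cast; omega), hc.arc _⟩

/-- A clause off the cycle could be deleted and the contradictory cycle would survive. -/
lemma covers (hc : IsCycle F L c) (hF : IsTwoMU F) {C : Finset (Lit V)} (hC : C ∈ F) :
    ∃ t, C = {(c t).compl, c (t + 1)} := by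
  by_contra! hno
  obtain ⟨i, j, hij⟩ := hc.contra
  obtain ⟨j, h1, -, h2⟩ := hc.exists_window j i
  obtain ⟨i', h3, -, h4⟩ := hc.exists_window i j
  rw [← h2] at hij
  refine hF.no_reach_erase hC (x := c i) ?_ ?_
  · rw [← hij]
    exact hc.reach_erase h1 fun t _ _ => (hno t).symm
  · rw [← hij, ← h4]
    exact hc.reach_erase h3 fun t _ _ => (hno t).symm

/-- Two chords that do not cross are connected by hub arcs. -/
lemma nested (hc : IsCycle F L c) (hF : IsTwoMU F) {j j' m' m : ℤ} (h₁ : j ≤ j') (h₂ : j' ≤ m')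
    (h₃ : m ≤ j + L) (hm' : c m' = (c j').compl) (hm : c m = (c j).compl) {t : ℤ}
    (ht : m' ≤ t) (ht' : t < m) : Hub c t := by
  by_contra hno
  -- If the arc at `t` is not a hub, its clause is used by the cycle only at `t` modulo L.
  have key : ∀ s, j ≤ s → s < j + L → s < m' ∨ m ≤ s →
      ({(c s).compl, c (s + 1)} : Finset (Lit V)) ≠ {(c t).compl, c (t + 1)} := by
    intro s hs1 hs2 hs3 e
    rcases pair_eq_pair.1 e with ⟨e, -⟩ | ⟨e, e'⟩
    · have := hc.eq_of_lt (Lit.compl_inj.1 e) (by omega) (by omega)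
      omega
    · exact hno ⟨s, Lit.compl_eq_iff.1 e, e'⟩
  have r1 : Reach (F.erase {(c t).compl, c (t + 1)}) (c j') (c m') :=
    hc.reach_erase h₂ fun s h1 h2 => key s (by omega) (by omega) (by omega)
  have r2 : Reach (F.erase {(c t).compl, c (t + 1)}) (c j) (c j') :=
    hc.reach_erase h₁ fun s h1 h2 => key s (by omega) (by omega) (by omega)
  have r3 : Reach (F.erase {(c t).compl, c (t + 1)}) (c m) (c j) := by
    rw [← hc.add_L j]
    exact hc.reach_erase h₃ fun s h1 h2 => key s (by omega) (by omega) (by omega)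
  rw [hm'] at r1
  rw [hm] at r3
  -- The closed walk c j' → c m' = c̄ j' → c̄ j = c m → c j → c j' uses only arcs outside [m', m)
  -- and their mirror images, so it survives the removal of the clause at `t`.
  exact hF.no_reach_erase (hc.arc t) r1 ((r2.mirror.trans r3).trans r2)

lemma arc_iff (hc : IsCycle F L c) (hF : IsTwoMU F) {u v : Lit V} :
    Arc F u v ↔ ∃ t, u = c t ∧ v = c (t + 1) ∨ u = (c (t + 1)).compl ∧ v = (c t).compl := by
  constructor
  · intro h
    obtain ⟨t, ht⟩ := hc.covers hF h
    refine ⟨t, ?_⟩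
    rcases pair_eq_pair.1 ht with ⟨e, e'⟩ | ⟨e, e'⟩
    · exact .inl ⟨Lit.compl_inj.1 e, e'⟩
    · exact .inr ⟨Lit.compl_eq_iff.1 e, e'⟩
  · rintro ⟨t, ⟨rfl, rfl⟩ | ⟨rfl, rfl⟩⟩
    · exact hc.arc t
    · exact (hc.arc t).mirror

/-- The successors of a literal of the cycle. -/
lemma arc_right (hc : IsCycle F L c) (hF : IsTwoMU F) {i : ℤ} {v : Lit V} (h : Arc F (c i) v) :
    v = c (i + 1) ∨ ∃ m, c m = (c i).compl ∧ v = (c (m - 1)).compl := by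
  obtain ⟨t, ⟨h1, h2⟩ | ⟨h1, h2⟩⟩ := (hc.arc_iff hF).1 h
  · exact .inl (h2.trans (hc.shift_eq h1 1).symm)
  · exact .inr ⟨t + 1, by rw [h1, Lit.compl_compl], by rw [h2, add_sub_cancel_right]⟩

/-- The clauses that contain a given literal of the cycle. -/
lemma clause_eq (hc : IsCycle F L c) (hF : IsTwoMU F) {i : ℤ} {C : Finset (Lit V)} (hC : C ∈ F)
    (hi : c i ∈ C) : C = {(c (i - 1)).compl, c i} ∨
      ∃ m, c m = (c i).compl ∧ C = {c i, c (m + 1)} := by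
  obtain ⟨t, rfl⟩ := hc.covers hF hC
  rcases Finset.mem_insert.1 hi with h | h
  · exact .inr ⟨t, by rw [h, Lit.compl_compl], by rw [h]⟩
  · rw [Finset.mem_singleton] at h
    have := hc.shift_eq h (-1)
    rw [add_neg_cancel_right, ← sub_eq_add_neg] at this
    exact .inl (by rw [h, this])

/-- The clauses containing c i are that of the arc into position i and, if c m = c̄ i, that of the
arc out of m. They coincide exactly when the former arc is a hub. -/
lemma branching_iff (hc : IsCycle F L c) (hF : IsTwoMU F) {i : ℤ} :
    Branching F (c i) ↔ Chord c i ∧ ¬ Hub c (i - 1) := by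
  constructor
  · rintro ⟨C, hC, D, hD, hne, hiC, hiD⟩
    have key : ∀ m, c m = (c i).compl → Hub c (i - 1) →
        ({c i, c (m + 1)} : Finset (Lit V)) = {(c (i - 1)).compl, c i} := by
      rintro m hm ⟨s, h1, h2⟩
      rw [sub_add_cancel, ← hm] at h1
      rw [← h2, hc.shift_eq h1, Finset.pair_comm]
    rcases hc.clause_eq hF hC hiC with h1 | ⟨m, hm, h1⟩ <;>
      rcases hc.clause_eq hF hD hiD with h2 | ⟨m', hm', h2⟩
    · exact absurd (h1.trans h2.symm) hne
    · exact ⟨⟨m', hm'⟩, fun h => hne (by rw [h1, h2, key m' hm' h])⟩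
    · exact ⟨⟨m, hm⟩, fun h => hne (by rw [h1, h2, key m hm h])⟩
    · exact absurd (by rw [h1, h2, hc.shift_eq (hm.trans hm'.symm)]) hne
  · rintro ⟨⟨m, hm⟩, hh⟩
    have h1 := hc.arc (i - 1)
    have h2 := hc.arc m
    rw [Arc, sub_add_cancel] at h1
    rw [Arc, hm, Lit.compl_compl] at h2
    refine ⟨_, h1, _, h2, fun e => hh ?_, by simp, by simp⟩
    rcases pair_eq_pair.1 e with ⟨e1, e2⟩ | ⟨e1, e2⟩
    · exact ⟨m, by rwa [sub_add_cancel], e2.symm.trans e1.symm⟩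
    · exact ⟨m, by rwa [sub_add_cancel], e1.symm⟩

/-- The previous criterion read at the position of c̄ i. Such an i is a branching point: two arcs
leave it. -/
lemma branching_compl_iff (hc : IsCycle F L c) (hF : IsTwoMU F) {i : ℤ} :
    Branching F (c i).compl ↔ Chord c i ∧ ¬ Hub c i := by
  constructor
  · intro h
    obtain ⟨m, hm⟩ : Chord c i := by
      obtain ⟨C, hC, D, hD, hne, hiC, hiD⟩ := h
      by_contra hno
      have key : ∀ C ∈ F, (c i).compl ∈ C → C = {(c i).compl, c (i + 1)} := by
        intro C hC hi
        obtain ⟨t, rfl⟩ := hc.covers hF hC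
        rcases Finset.mem_insert.1 hi with h | h
        · rw [Lit.compl_inj] at h
          rw [h, hc.shift_eq h]
        · exact absurd ⟨_, (Finset.mem_singleton.1 h).symm⟩ hno
      exact hne ((key C hC hiC).trans (key D hD hiD).symm)
    rw [← hm, hc.branching_iff hF, hc.hub_pred_iff hm] at h
    exact ⟨⟨m, hm⟩, h.2⟩
  · rintro ⟨⟨m, hm⟩, h⟩
    rw [← hm, hc.branching_iff hF, hc.hub_pred_iff hm]
    exact ⟨⟨i, by rw [hm, Lit.compl_compl]⟩, h⟩

/-- Branching literals lie on the cycle. -/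
lemma exists_of_branching (hc : IsCycle F L c) (hF : IsTwoMU F) {x : Lit V} (hx : Branching F x) :
    ∃ i, c i = x := by
  obtain ⟨C, hC, -, -, -, hxC, -⟩ := id hx
  obtain ⟨t, rfl⟩ := hc.covers hF hC
  rcases Finset.mem_insert.1 hxC with h | h
  · rw [h] at hx
    obtain ⟨m, hm⟩ := ((hc.branching_compl_iff hF).1 hx).1
    exact ⟨m, by rw [hm, h]⟩
  · exact ⟨t + 1, (Finset.mem_singleton.1 h).symm⟩

end IsCycle

end Chord


/-! ### Degrees -/

section Degree

variable {V : Type*} [DecidableEq V] {F : Finset (Finset (Lit V))} {L : ℕ} {c : ℤ → Lit V}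

/-- The number of clauses that contain a literal. -/
def litDegree (F : Finset (Finset (Lit V))) (x : Lit V) : ℕ := (F.filter (x ∈ ·)).card

lemma branching_iff_one_lt {x : Lit V} : Branching F x ↔ 1 < litDegree F x := by
  rw [litDegree, Finset.one_lt_card]
  simp only [Finset.mem_filter, Branching]
  constructor
  · rintro ⟨C, hC, D, hD, hne, h1, h2⟩
    exact ⟨C, ⟨hC, h1⟩, D, ⟨hD, h2⟩, hne⟩
  · rintro ⟨C, ⟨hC, h1⟩, D, ⟨hD, h2⟩, hne⟩
    exact ⟨C, hC, D, hD, hne, h1, h2⟩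

lemma mem_lits_of_arc {u v : Lit V} (h : Arc F u v) : u ∈ lits F := by
  have := compl_mem_lits (mem_lits h (x := u.compl) (by simp))
  rwa [Lit.compl_compl] at this

lemma exists_of_mem_lits {x : Lit V} (hx : x ∈ lits F) : ∃ C ∈ F, ∃ y ∈ C, y.1 = x.1 := by
  simpa [lits, vars] using hx

lemma sum_litDegree : ∑ x ∈ lits F, litDegree F x = length F := by
  simp only [litDegree, length]
  have := Finset.sum_card_bipartiteAbove_eq_sum_card_bipartiteBelow (s := lits F) (t := F)
    (fun (x : Lit V) C => x ∈ C)
  refine this.trans (Finset.sum_congr rfl fun C hC => ?_)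
  congr 1
  ext x
  simp only [Finset.mem_bipartiteBelow, and_iff_right_iff_imp]
  exact fun hx => mem_lits hC hx

lemma card_lits : (lits F).card = 2 * (vars F).card := by
  simp [lits, mul_comm]

namespace IsCycle

lemma mem_lits_iff (hc : IsCycle F L c) (hF : IsTwoMU F) {x : Lit V} :
    x ∈ lits F ↔ ∃ i, x = c i ∨ x = (c i).compl := by
  constructor
  · intro hx
    obtain ⟨C, hC, y, hy, hyx⟩ := exists_of_mem_lits hx
    obtain ⟨t, rfl⟩ := hc.covers hF hC
    rcases Finset.mem_insert.1 hy with rfl | hy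
    · exact ⟨t, Lit.fst_eq_iff.1 hyx.symm⟩
    · rw [Finset.mem_singleton] at hy
      subst hy
      exact ⟨t + 1, Lit.fst_eq_iff.1 hyx.symm⟩
  · rintro ⟨i, rfl | rfl⟩
    · exact mem_lits_of_arc (hc.arc i)
    · exact compl_mem_lits (mem_lits_of_arc (hc.arc i))

lemma litDegree_pos (hc : IsCycle F L c) (hF : IsTwoMU F) {x : Lit V} (hx : x ∈ lits F) :
    0 < litDegree F x := by
  refine Finset.card_pos.2 ?_
  obtain ⟨i, rfl | rfl⟩ := (hc.mem_lits_iff hF).1 hx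
  · have := hc.arc (i - 1)
    rw [Arc, sub_add_cancel] at this
    exact ⟨_, Finset.mem_filter.2 ⟨this, by simp⟩⟩
  · exact ⟨_, Finset.mem_filter.2 ⟨hc.arc i, by simp⟩⟩

lemma litDegree_le_two (hc : IsCycle F L c) (hF : IsTwoMU F) (x : Lit V) : litDegree F x ≤ 2 := by
  by_cases hb : Branching F x
  · obtain ⟨i, rfl⟩ := hc.exists_of_branching hF hb
    obtain ⟨m, hm⟩ := ((hc.branching_iff hF).1 hb).1
    refine (Finset.card_le_card (t := {{(c (i - 1)).compl, c i}, {c i, c (m + 1)}})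
      fun C hC => ?_).trans Finset.card_le_two
    rw [Finset.mem_filter] at hC
    rcases hc.clause_eq hF hC.1 hC.2 with h | ⟨m', hm', h⟩
    · simp [h]
    · simp [h, hc.shift_eq (hm'.trans hm.symm) 1]
  · rw [branching_iff_one_lt] at hb
    omega

/-- In a 2-MU of deficiency at least two there are no unit clauses. -/
lemma card_eq_two (hc : IsCycle F L c) (hF : IsTwoMU F) (hk : 2 ≤ deficiency F)
    {C : Finset (Lit V)} (hC : C ∈ F) : C.card = 2 := by
  by_contra hne
  have h1 : C.card = 1 := by
    have := hF.card_le_two C hC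
    have := Finset.card_pos.2 (hF.nonempty_of_deficiency hk hC)
    omega
  obtain ⟨t, rfl⟩ := hc.covers hF hC
  have ht : c (t + 1) = (c t).compl := by
    by_contra h
    rw [Finset.card_pair (Ne.symm h)] at h1
    omega
  classical
  have hL := hc.pos
  have hex0 : ∃ i : ℕ, i < L - 1 ∧ c (t + 1 + (L - 1 : ℕ)) = (c (t + 1 + i)).compl := by
    refine ⟨0, ?_, ?_⟩
    · by_contra h
      obtain rfl : L = 1 := by omega
      have := hc.add_L t
      push_cast at this
      exact Lit.compl_ne _ (ht.symm.trans this)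
    · rw [show t + 1 + ((L - 1 : ℕ) : ℤ) = t + L by omega, hc.add_L]
      simp [ht]
  -- Starting behind the unit clause, `j` is the first place where a variable of the cycle recurs,
  -- necessarily complemented.
  have hex : ∃ j : ℕ, ∃ i : ℕ, i < j ∧ c (t + 1 + j) = (c (t + 1 + i)).compl := ⟨_, hex0⟩
  have hjL := Nat.find_min' hex hex0
  obtain ⟨i, hij, hi⟩ := Nat.find_spec hex
  have hmin := fun j h => Nat.find_min hex (m := j) h
  generalize Nat.find hex = j at *
  -- The arcs at t, …, t + j already contradict: c t → c̄ t = c (t+1) → c (t+1+i) → c̄ (t+1+i), and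
  -- the mirror image of the second segment leads back to c t. By minimality there are no other
  -- clauses.
  have hcov : F ⊆ (Finset.range (j + 1)).image
      fun s : ℕ => {(c (t + s)).compl, c (t + s + 1)} := by
    intro C hC
    by_contra hno
    have hno' : ∀ s : ℤ, t ≤ s → s < t + 1 + j →
        ({(c s).compl, c (s + 1)} : Finset (Lit V)) ≠ C := by
      rintro s h1 h2 rfl
      refine hno (Finset.mem_image.2 ⟨(s - t).toNat, Finset.mem_range.2 (by omega), ?_⟩)
      rw [show t + ((s - t).toNat : ℤ) = s by omega]
    have r1 : Reach (F.erase C) (c t) (c (t + 1)) :=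
      hc.reach_erase (by omega) fun s h1 h2 => hno' s h1 (by omega)
    have r2 : Reach (F.erase C) (c (t + 1)) (c (t + 1 + i)) :=
      hc.reach_erase (by omega) fun s h1 h2 => hno' s (by omega) (by omega)
    have r3 : Reach (F.erase C) (c (t + 1 + i)) (c (t + 1 + j)) :=
      hc.reach_erase (by omega) fun s h1 h2 => hno' s (by omega) (by omega)
    have r4 := (r2.trans r3).trans (hi ▸ r2.mirror)
    rw [ht, Lit.compl_compl] at r4
    exact hF.no_reach_erase hC (ht ▸ r1) r4
  have hF' : F.card ≤ j + 1 := by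
    refine (Finset.card_le_card hcov).trans (Finset.card_image_le.trans ?_)
    simp
  -- By minimality of `j` the literals at t + 1, …, t + j have distinct variables, so the deficiency
  -- is at most one.
  have hv : j ≤ (vars F).card := by
    rw [← Finset.card_range j]
    refine Finset.card_le_card_of_injOn (fun s : ℕ => (c (t + 1 + s)).1) (fun s _ => ?_) ?_
    · have := mem_lits_of_arc (hc.arc (t + 1 + s))
      simpa [lits] using this
    · have key : ∀ a b : ℕ, a < b → b < j → (c (t + 1 + a)).1 ≠ (c (t + 1 + b)).1 := by
        intro a b hab hb e
        rcases Lit.fst_eq_iff.1 e with e | e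
        · have := hc.eq_of_lt e (by omega) (by omega)
          omega
        · exact hmin b hb ⟨a, hab, Lit.compl_eq_iff.1 e.symm⟩
      intro a ha b hb e
      simp only [Finset.coe_range, Set.mem_Iio] at ha hb
      rcases lt_trichotomy a b with h | h | h
      · exact absurd e (key a b h hb)
      · exact h
      · exact absurd e.symm (key b a h ha)
  rw [deficiency] at hk
  omega

lemma length_eq (hc : IsCycle F L c) (hF : IsTwoMU F) (hk : 2 ≤ deficiency F) :
    length F = 2 * F.card := by
  rw [length, Finset.sum_congr rfl fun C hC => hc.card_eq_two hF hk hC]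
  simp [mul_comm]

open Classical in
/-- The number of literals of degree two is twice the deficiency. -/
lemma card_branching (hc : IsCycle F L c) (hF : IsTwoMU F) {k : ℕ} (hk : 2 ≤ k)
    (hd : deficiency F = k) : ((lits F).filter (Branching F)).card = 2 * k := by
  -- All degrees are 1 or 2, so 2|F| is twice the number of variables plus the number of branching
  -- literals.
  have h1 : ∑ x ∈ lits F, litDegree F x = ∑ x ∈ lits F, (1 + if Branching F x then 1 else 0) := by
    refine Finset.sum_congr rfl fun x hx => ?_
    have h1 := hc.litDegree_pos hF hx
    have h2 := hc.litDegree_le_two hF x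
    have h3 := branching_iff_one_lt (F := F) (x := x)
    split_ifs with h <;> simp only [h, true_iff, false_iff] at h3 <;> omega
  rw [sum_litDegree, hc.length_eq hF (by omega), Finset.sum_add_distrib, Finset.sum_boole,
    Finset.sum_const, smul_eq_mul, mul_one, card_lits] at h1
  rw [deficiency] at hd
  simp only [Nat.cast_id] at h1
  have h2 : ((lits F).filter (Branching F)).card = 2 * F.card - 2 * (vars F).card := by
    rw [h1, Nat.add_sub_cancel_left]
  omega

end IsCycle

end Degree


/-! ### Uniqueness of the contradictory cycle -/

section Unique

variable {V : Type*} [DecidableEq V] {F : Finset (Finset (Lit V))} {L : ℕ} {c : ℤ → Lit V}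

omit [DecidableEq V] in
lemma Chord.congr {i j : ℤ} (h : Chord c i) (e : c i = c j) : Chord c j :=
  let ⟨m, hm⟩ := h; ⟨m, by rw [hm, e]⟩

namespace IsCycle

lemma hub_congr (hc : IsCycle F L c) {i j : ℤ} (h : Hub c i) (e : c i = c j) : Hub c j :=
  let ⟨s, h1, h2⟩ := h; ⟨s, by rw [h1, hc.shift_eq e], by rw [h2, e]⟩

/-- Not all branching literals are at two positions. -/
lemma exists_third (hc : IsCycle F L c) (hF : IsTwoMU F) (hk : 2 ≤ deficiency F) (a b : ℤ) :
    ∃ t, a ≤ t ∧ t < a + L ∧ Branching F (c t) ∧ t ≠ a ∧ t ≠ b := by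
  classical
  by_contra! hno
  obtain ⟨k, hk'⟩ := Int.eq_ofNat_of_zero_le (show 0 ≤ deficiency F by omega)
  -- There are 2k ≥ 4 branching literals, too many for two positions.
  have h1 := hc.card_branching hF (k := k) (by omega) hk'
  have h2 : (lits F).filter (Branching F) ⊆ {c a, c b} := by
    intro x hx
    obtain ⟨i, rfl⟩ := hc.exists_of_branching hF (Finset.mem_filter.1 hx).2
    obtain ⟨t, ht1, ht2, ht3⟩ := hc.exists_window i a
    have hb : Branching F (c t) := ht3 ▸ (Finset.mem_filter.1 hx).2
    by_cases h : t = a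
    · simp [← ht3, h]
    · simp [← ht3, hno t ht1 ht2 hb h]
  have := (Finset.card_le_card h2).trans Finset.card_le_two
  have h3 : ((lits F).filter (Branching F)).card = 2 * k := by
    rw [← h1]
  omega

lemma exists_branching_le (hc : IsCycle F L c) (hF : IsTwoMU F) (hk : 2 ≤ deficiency F) (i : ℤ) :
    ∃ b ≤ i, Branching F (c b) ∧ ∀ t, b < t → t ≤ i → ¬ Branching F (c t) := by
  classical
  have hex : ∃ d : ℕ, Branching F (c (i - d)) := by
    obtain ⟨t, -, -, hb, -⟩ := hc.exists_third hF hk 0 0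
    obtain ⟨s, h1, h2, h3⟩ := hc.exists_window t (i + 1 - L)
    exact ⟨(i - s).toNat, by rwa [show i - ((i - s).toNat : ℤ) = s by omega, h3]⟩
  refine ⟨i - Nat.find hex, by omega, Nat.find_spec hex, fun t h1 h2 h3 => ?_⟩
  refine Nat.find_min hex (m := (i - t).toNat) (by omega) ?_
  rwa [show i - ((i - t).toNat : ℤ) = t by omega]

lemma exists_branching_lt (hc : IsCycle F L c) (hF : IsTwoMU F) (hk : 2 ≤ deficiency F) (i : ℤ) :
    ∃ b, i < b ∧ b ≤ i + L ∧ Branching F (c b) ∧ ∀ t, i < t → t < b → ¬ Branching F (c t) := by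
  classical
  have hex : ∃ d : ℕ, i + 1 + d ≤ i + L ∧ Branching F (c (i + 1 + d)) := by
    obtain ⟨t, -, -, hb, -⟩ := hc.exists_third hF hk 0 0
    obtain ⟨s, h1, h2, h3⟩ := hc.exists_window t (i + 1)
    refine ⟨(s - i - 1).toNat, by omega, ?_⟩
    rwa [show i + 1 + ((s - i - 1).toNat : ℤ) = s by omega, h3]
  have hs := Nat.find_spec hex
  refine ⟨i + 1 + Nat.find hex, by omega, hs.1, hs.2, fun t h1 h2 h3 => ?_⟩
  refine Nat.find_min hex (m := (t - i - 1).toNat) (by omega) ⟨by omega, ?_⟩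
  rwa [show i + 1 + ((t - i - 1).toNat : ℤ) = t by omega]

/-- Going backwards along hubs stops, since the arc into a branching literal is not a hub; it stops
at a branching literal by `branching_iff`. -/
lemma exists_run_left (hc : IsCycle F L c) (hF : IsTwoMU F) (hk : 2 ≤ deficiency F) {i : ℤ}
    (hi : Chord c i) : ∃ b ≤ i, Branching F (c b) ∧ ∀ t, b ≤ t → t < i → Hub c t := by
  classical
  have hex : ∃ d : ℕ, ¬ Hub c (i - d - 1) := by
    obtain ⟨b, hb, h, -⟩ := hc.exists_branching_le hF hk i
    refine ⟨(i - b).toNat, ?_⟩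
    rw [show i - ((i - b).toNat : ℤ) = b by omega]
    exact ((hc.branching_iff hF).1 h).2
  have hrun : ∀ t, i - Nat.find hex ≤ t → t < i → Hub c t := by
    intro t h1 h2
    have := Nat.find_min hex (m := (i - t - 1).toNat) (by omega)
    rwa [show i - ((i - t - 1).toNat : ℤ) - 1 = t by omega, not_not] at this
  refine ⟨i - Nat.find hex, by omega, (hc.branching_iff hF).2 ⟨?_, Nat.find_spec hex⟩, hrun⟩
  rcases Nat.eq_zero_or_pos (Nat.find hex) with h | h
  · simpa [h] using hi
  · exact (hrun _ le_rfl (by omega)).chord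

/-- The forward counterpart. Thus the chords are grouped into runs of hub arcs, each entered at a
branching literal and left at a branching point. -/
lemma exists_run_right (hc : IsCycle F L c) (hF : IsTwoMU F) (hk : 2 ≤ deficiency F) {i : ℤ}
    (hi : Chord c i) :
    ∃ e, i ≤ e ∧ Branching F (c e).compl ∧ ∀ t, i ≤ t → t < e → Hub c t := by
  classical
  have hex : ∃ d : ℕ, ¬ Hub c (i + d) := by
    obtain ⟨b, h1, -, h, -⟩ := hc.exists_branching_lt hF hk i
    refine ⟨(b - 1 - i).toNat, ?_⟩
    rw [show i + ((b - 1 - i).toNat : ℤ) = b - 1 by omega]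
    exact ((hc.branching_iff hF).1 h).2
  have hrun : ∀ t, i ≤ t → t < i + Nat.find hex → Hub c t := by
    intro t h1 h2
    have := Nat.find_min hex (m := (t - i).toNat) (by omega)
    rwa [show i + ((t - i).toNat : ℤ) = t by omega, not_not] at this
  refine ⟨i + Nat.find hex, by omega, (hc.branching_compl_iff hF).2 ⟨?_, Nat.find_spec hex⟩, hrun⟩
  rcases Nat.eq_zero_or_pos (Nat.find hex) with h | h
  · simpa [h] using hi
  · have := (hrun (i + Nat.find hex - 1) (by omega) (by omega)).chord_succ
    rwa [sub_add_cancel] at this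

/-- Between a branching point and a later chord the cycle passes through a branching literal. -/
lemma exists_branching_between (hc : IsCycle F L c) (hF : IsTwoMU F) (hk : 2 ≤ deficiency F)
    {i j : ℤ} (hi : Branching F (c i).compl) (hij : i < j) (hj : Chord c j) :
    ∃ b, i < b ∧ b ≤ j ∧ Branching F (c b) := by
  obtain ⟨b, h1, h2, h3⟩ := hc.exists_run_left hF hk hj
  refine ⟨b, ?_, h1, h2⟩
  by_contra h
  exact ((hc.branching_compl_iff hF).1 hi).2 (h3 i (by omega) hij)

/-- At a branching point, the arc off the cycle leads back to the preceding branching literal but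
one, through literals that are not on the cycle. -/
lemma back_arm (hc : IsCycle F L c) (hF : IsTwoMU F) (hk : 2 ≤ deficiency F) {a b i m : ℤ}
    (hab : a < b) (hbi : b ≤ i) (ha : Branching F (c a)) (hb : Branching F (c b))
    (hab' : ∀ t, a < t → t < b → ¬ Branching F (c t))
    (hbi' : ∀ t, b < t → t ≤ i → ¬ Branching F (c t))
    (hi : Branching F (c i).compl) (hm : c m = (c i).compl) :
    ∃ r < m, c r = (c a).compl ∧ ∀ x, r < x → x < m → ¬ Chord c x := by
  -- Only m modulo L matters, so the chord from i may be taken to end within one turn.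
  wlog hmi : i ≤ m ∧ m < i + L generalizing m
  · obtain ⟨m', h1, h2, h3⟩ := hc.exists_window m i
    obtain ⟨r, hr1, hr2, hr3⟩ := this (h3.trans hm) ⟨h1, h2⟩
    have hs : ∀ x, c (x + (m' - m)) = c x := fun x => by
      rw [hc.eq_iff] at h3 ⊢
      simpa using h3
    refine ⟨r - (m' - m), by omega, ?_, fun x h4 h5 h6 => ?_⟩
    · rw [← hr2, ← hs, sub_add_cancel]
    · exact hr3 (x + (m' - m)) (by omega) (by omega) (h6.congr (hs x).symm)
  have hmi' : m ≠ i := fun h => Lit.compl_ne (c i) (by rw [← hm, h])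
  have hLp := hc.L_pos
  have hHi := ((hc.branching_compl_iff hF).1 hi).2
  have hHb := ((hc.branching_iff hF).1 hb).2
  have hHa := ((hc.branching_iff hF).1 ha).2
  have hHm : ¬ Hub c (m - 1) := fun h => hHi ((hc.hub_pred_iff hm).1 h)
  have hHL : ∀ x, Hub c (x + L) → Hub c x := fun x h => hc.hub_congr h (hc.add_L x)
  -- a third branching literal
  obtain ⟨t, hat, hta, htb, hta', htb'⟩ := hc.exists_third hF hk a b
  have hit : i < t := by
    by_contra h
    rcases lt_trichotomy t b with h1 | h1 | h1
    · exact hab' t (by omega) h1 htb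
    · exact htb' h1
    · exact hbi' t h1 (by omega) htb
  -- the end `a'` of the hub of `a`
  obtain ⟨a', haa', ha', hrun⟩ := hc.exists_run_right hF hk ((hc.branching_iff hF).1 ha).1
  have hHa' := ((hc.branching_compl_iff hF).1 ha').2
  have ha'b : a' < b := by
    by_contra h
    exact hHb (hrun _ (by omega) (by omega))
  have hgap : ∀ x, a' < x → x < b → ¬ Chord c x := by
    intro x h1 h2 h3
    obtain ⟨y, h4, h5, h6⟩ := hc.exists_branching_between hF hk ha' h1 h3
    exact hab' y (by omega) (by omega) h6
  have hbrun : ∀ x, b ≤ x → x < i → Hub c x := by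
    obtain ⟨b', h1, h2, h3⟩ := hc.exists_run_left hF hk ((hc.branching_compl_iff hF).1 hi).1
    have : b' ≤ b := by
      by_contra h
      exact hbi' b' (by omega) h1 h2
    exact fun x h4 h5 => h3 x (by omega) h5
  have hmir : ∀ e : ℤ, 0 ≤ e → e ≤ i - b → c (m + e) = (c (i - e)).compl := by
    intro e h1 h2
    obtain ⟨e, rfl⟩ := Int.eq_ofNat_of_zero_le h1
    exact hc.hub_run hm e fun x h3 h4 => hbrun x (by omega) h4
  have hmirH : ∀ e : ℤ, 0 ≤ e → e < i - b → Hub c (m + e) := by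
    intro e h1 h2
    have h3 := hmir (e + 1) (by omega) (by omega)
    have h4 := (hc.hub_pred_iff h3).2 (hbrun _ (by omega) (by omega))
    rwa [show m + (e + 1) - 1 = m + e by ring] at h4
  have hmL : ∀ e : ℤ, 0 ≤ e → e ≤ i - b → m + e ≤ i + L := by
    intro e h1 h2
    by_contra h
    have := hmirH (i + L - m) (by omega) (by omega)
    rw [show m + (i + L - m) = i + L by ring] at this
    exact hHi (hHL _ this)
  -- chords that start between `i` and `m` end between `m` and `a' + L`
  have hcross : ∀ x, i < x → x < m → Chord c x → ∃ y, m < y ∧ y ≤ a' + L ∧ c y = (c x).compl := by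
    rintro x hx1 hx2 ⟨y, hy⟩
    obtain ⟨y', hy1, hy2, hy3⟩ := hc.exists_window y i
    rw [← hy3] at hy
    clear hy3 y
    have hyx : c x = (c y').compl := by rw [hy, Lit.compl_compl]
    -- A second chord lying inside [i, m] would be nested in the chord i – m, and `nested` would
    -- turn the arc before m into a hub.
    have hym : m < y' := by
      rcases lt_trichotomy y' m with h | h | h
      · exfalso
        rcases le_total x y' with h' | h'
        · exact hHm (hc.nested hF hx1.le h' (by omega) hy hm (t := m - 1) (by omega) (by omega))
        · exact hHm (hc.nested hF hy1 h' (by omega) hyx hm (t := m - 1) (by omega) (by omega))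
      · exfalso
        rw [h, hm, Lit.compl_compl] at hyx
        have := hc.eq_of_lt hyx (by omega) (by omega)
        omega
      · exact h
    refine ⟨y', hym, ?_, hy⟩
    by_contra h
    rcases lt_or_ge y' (b + L) with h' | h'
    · refine hgap (y' - L) (by omega) (by omega) ?_
      have : c (y' - L + L) = c (y' - L) := hc.add_L _
      rw [sub_add_cancel] at this
      exact Chord.congr ⟨x, hyx⟩ this
    · have h1 := hmir (i + L - y') (by omega) (by omega)
      rw [show i - (i + L - y') = y' - L by ring] at h1
      have : c (y' - L + L) = c (y' - L) := hc.add_L _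
      rw [sub_add_cancel] at this
      rw [← this, ← hyx] at h1
      have h2 := hmL (i + L - y') (by omega) (by omega)
      have := hc.eq_of_lt h1 (by omega) (by omega)
      omega
  -- the mirror image of the hub of `a`
  obtain ⟨q, hq1, hq2, hq⟩ : ∃ q, a' < q ∧ q < a' + L ∧ c q = (c a').compl := by
    obtain ⟨q, hq⟩ := ((hc.branching_compl_iff hF).1 ha').1
    obtain ⟨q', h1, h2, h3⟩ := hc.exists_window q a'
    refine ⟨q', lt_of_le_of_ne h1 ?_, h2, h3.trans hq⟩
    rintro rfl
    exact Lit.compl_ne _ ((h3.trans hq).symm)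
  have hqrun : ∀ e : ℤ, 0 ≤ e → e ≤ a' - a → c (q + e) = (c (a' - e)).compl := by
    intro e h1 h2
    obtain ⟨e, rfl⟩ := Int.eq_ofNat_of_zero_le h1
    exact hc.hub_run hq e fun x h3 h4 => hrun x (by omega) h4
  have hqH : ∀ e : ℤ, 0 ≤ e → e < a' - a → Hub c (q + e) := by
    intro e h1 h2
    have h3 := hqrun (e + 1) (by omega) (by omega)
    have h4 := (hc.hub_pred_iff h3).2 (hrun _ (by omega) (by omega))
    rwa [show q + (e + 1) - 1 = q + e by ring] at h4
  have haL : c (a + L) = c a := hc.add_L a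
  have ha'L : c (a' + L) = c a' := hc.add_L a'
  rcases le_or_gt q i with hqi | hqi
  · -- the hubs of `a` and `b` would be mirror images of each other
    exfalso
    have hqb : b ≤ q := by
      by_contra h
      exact hgap q hq1 (by omega) ⟨a', by rw [hq, Lit.compl_compl]⟩
    have h1 := hmir (i - q) (by omega) (by omega)
    rw [show i - (i - q) = q by ring, hq, Lit.compl_compl, ← ha'L] at h1
    have h2 := hmL (i - q) (by omega) (by omega)
    have h3 := hc.eq_of_lt h1 (by omega) (by omega)
    have htm : t < m := by
      by_contra h
      have h4 := hmirH (a + L - 1 - m) (by omega) (by omega)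
      rw [show m + (a + L - 1 - m) = a - 1 + L by ring] at h4
      exact hHa (hHL _ h4)
    obtain ⟨y, hy1, hy2, hy3⟩ := hcross t hit htm ((hc.branching_iff hF).1 htb).1
    have h4 := hmir (y - m) (by omega) (by omega)
    rw [show m + (y - m) = y by ring, hy3, Lit.compl_inj] at h4
    have := hc.eq_of_lt h4 (by omega) (by omega)
    omega
  -- If m < q, the chord from q to a' + L would be nested in the chord from m to i + L, and the arc
  -- leaving a' would be a hub.
  · have hqm : q < m := by
      by_contra h
      rcases eq_or_lt_of_le (not_lt.1 h) with h1 | h1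
      · rw [← h1, hm, Lit.compl_inj] at hq
        have := hc.eq_of_lt hq (by omega) (by omega)
        omega
      · have h2 : c (a' + L) = (c q).compl := by rw [ha'L, hq, Lit.compl_compl]
        have h3 : c (i + L) = (c m).compl := by rw [hc.add_L, hm, Lit.compl_compl]
        exact hHa' (hHL _ (hc.nested hF h1.le (by omega) (by omega) h2 h3 le_rfl (by omega)))
    have hrm : q + (a' - a) < m := by
      by_contra h
      have := hqH (m - 1 - q) (by omega) (by omega)
      rw [show q + (m - 1 - q) = m - 1 by ring] at this
      exact hHm this
    have hr := hqrun (a' - a) (by omega) le_rfl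
    rw [show a' - (a' - a) = a by ring] at hr
    refine ⟨_, hrm, hr, fun x hx1 hx2 hx3 => ?_⟩
    -- A chord at x behind the mirrored run of a ends in (m, a' + L]. Ending before a + L, it is
    -- nested in the chord of a, so the arc into a is a hub; ending later, it ends in the run of a,
    -- whose mirror image lies before x.
    obtain ⟨y, hy1, hy2, hy3⟩ := hcross x (by omega) hx2 hx3
    rcases lt_or_ge y (a + L) with h | h
    · have h2 : c (a + L) = (c (q + (a' - a))).compl := by rw [haL, hr, Lit.compl_compl]
      have := hc.nested hF hx1.le (by omega) (by omega) hy3 h2 (t := a - 1 + L) (by omega)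
        (by omega)
      exact hHa (hHL _ this)
    · have h1 := hqrun (a' + L - y) (by omega) (by omega)
      rw [show a' - (a' + L - y) = y - L by ring, ← hc.add_L (y - L), sub_add_cancel, hy3,
        Lit.compl_compl] at h1
      have := hc.eq_of_lt h1 (by omega) (by omega)
      omega

end IsCycle

end Unique


/-! ### Comparing two contradictory cycles. -/

section Unique

variable {V : Type*} [DecidableEq V] {F : Finset (Finset (Lit V))} {L L' : ℕ} {c e : ℤ → Lit V}

namespace IsCycle

/-- Two contradictory cycles that agree from a branching literal beyond the next branching point
agree forever. -/
lemma agree (hc : IsCycle F L c) (he : IsCycle F L' e) (hF : IsTwoMU F) (hk : 2 ≤ deficiency F)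
    {p o : ℤ} (hpo : p ≤ o) (hp : Branching F (c p)) (ho : Branching F (c o).compl)
    (hpe : ∀ i, p ≤ i → i ≤ o + 1 → e i = c i) (n : ℕ) :
    ∀ i, p ≤ i → i ≤ o + 1 + n → e i = c i := by
  induction n with
  | zero => simpa using hpe
  | succ n ih =>
    intro i hi1 hi2
    push_cast at hi2
    rcases lt_or_ge i (o + 1 + n + 1) with h | h
    · exact ih i hi1 (by omega)
    obtain rfl : i = o + 1 + n + 1 := by omega
    generalize hN : o + 1 + (n : ℤ) = N at *
    have hNe := ih N (by omega) le_rfl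
    have harc : Arc F (c N) (e (N + 1)) := hNe ▸ he.arc N
    by_cases hb : Branching F (c N).compl
    · rcases hc.arc_right hF harc with h1 | ⟨m, hm, h1⟩
      · exact h1
      exfalso
      -- From here on `e` is assumed to leave `c` at N. The two latest branching literals a < b lie
      -- in the stretch where both cycles agree.
      obtain ⟨b, hbN, hbb, hb'⟩ := hc.exists_branching_le hF hk N
      obtain ⟨a, hab, haa, ha'⟩ := hc.exists_branching_le hF hk (b - 1)
      have hob : o < b := by
        obtain ⟨b', h2, h3, h4⟩ := hc.exists_branching_between hF hk ho (by omega : o < N)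
          ((hc.branching_compl_iff hF).1 hb).1
        by_contra h
        exact hb' b' (by omega) h3 h4
      have hpa : p ≤ a := by
        by_contra h
        exact ha' p (by omega) (by omega) hp
      obtain ⟨r, hrm, hr, hnc⟩ := hc.back_arm hF hk (by omega) hbN haa hbb
        (fun t h1 h2 => ha' t h1 (by omega)) hb' hb hm
      -- Along the back arm the literals have no chords, so only one arc leaves each of them and `e`
      -- is forced back to c a.
      have hwalk : ∀ y : ℕ, 1 ≤ y → (y : ℤ) ≤ m - r → e (N + y) = (c (m - y)).compl := by
        intro y hy1
        induction y, hy1 using Nat.le_induction with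
        | base => exact fun _ => by simpa using h1
        | succ y hy1 ih =>
          intro hy2
          push_cast at hy2 ⊢
          have h2 := ih (by omega)
          have h3 := he.arc (N + y)
          have h4 := (hc.arc (m - y - 1)).mirror
          rw [sub_add_cancel, ← h2] at h4
          rw [← add_assoc, ← sub_sub]
          refine Arc.eq_of_not_branching ?_ h3 h4
          rw [h2, Lit.compl_compl, hc.branching_iff hF]
          exact fun h => hnc _ (by omega) (by omega) h.1
      have hend := hwalk (m - r).toNat (by omega) (by omega)
      rw [show ((m - r).toNat : ℤ) = m - r by omega, sub_sub_cancel, hr, Lit.compl_compl,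
        ← ih a hpa (by omega), he.eq_iff] at hend
      have hL' := Int.le_of_dvd (by omega) hend
      -- Thus `e` has closed up, and on the whole turn it has met only the branching literals at a
      -- and b.
      obtain ⟨t, ht1, ht2, ht3, ht4, ht5⟩ := he.exists_third hF hk a b
      rcases le_or_gt t N with h | h
      · rw [ih t (by omega) h] at ht3
        rcases lt_trichotomy t b with h' | h' | h'
        · exact ha' t (by omega) (by omega) ht3
        · exact ht5 h'
        · exact hb' t h' h ht3
      · have h2 := hwalk (t - N).toNat (by omega) (by omega)
        rw [show ((t - N).toNat : ℤ) = t - N by omega, add_sub_cancel] at h2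
        rw [h2, hc.branching_compl_iff hF] at ht3
        exact hnc _ (by omega) (by omega) ht3.1
    · exact Arc.eq_of_not_branching hb harc (hc.arc N)

/-- The contradictory cycle is unique up to rotation and mirroring. -/
theorem unique (hc : IsCycle F L c) (he : IsCycle F L' e) (hF : IsTwoMU F)
    (hk : 2 ≤ deficiency F) :
    (∃ s, ∀ i, e i = c (i + s)) ∨ ∃ s, ∀ i, e i = (c (s - i)).compl := by
  obtain ⟨p, -, -, hp, -⟩ := he.exists_third hF hk 0 0
  obtain ⟨o, hpo, ho, hrun⟩ := he.exists_run_right hF hk ((he.branching_iff hF).1 hp).1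
  have key : ∀ c', IsCycle F L c' → e o = c' o → e (o + 1) = c' (o + 1) → ∀ i, e i = c' i := by
    intro c' hc' h1 h2
    -- Inside the run from p to o only one arc enters each literal after the first, so agreement at
    -- o extends back to p. This supplies the initial stretch that `agree` needs.
    have hback : ∀ d : ℕ, p ≤ o - d → e (o - d) = c' (o - d) := by
      intro d
      induction d with
      | zero => simpa using fun _ => h1
      | succ d ih =>
        intro hd
        push_cast at hd ⊢
        have h3 := ih (by omega)
        have h4 := he.arc (o - d - 1)
        have h5 := hc'.arc (o - d - 1)
        rw [sub_add_cancel] at h4 h5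
        rw [← sub_sub]
        refine Arc.eq_of_not_branching' ?_ h4 (h3 ▸ h5)
        rw [he.branching_iff hF]
        exact fun h => h.2 (hrun _ (by omega) (by omega))
    have hpe : ∀ i, p ≤ i → i ≤ o + 1 → e i = c' i := by
      intro i hi1 hi2
      rcases lt_or_ge o i with h | h
      · obtain rfl : i = o + 1 := by omega
        exact h2
      · have := hback (o - i).toNat (by omega)
        rwa [show o - ((o - i).toNat : ℤ) = i by omega] at this
    have hag := hc'.agree he hF hk hpo (hpe p le_rfl (by omega) ▸ hp) (h1 ▸ ho) hpe
    intro i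
    -- L · L' is a common period, which moves any position beyond p.
    obtain ⟨n, hn⟩ : ∃ n : ℕ, p ≤ i + n * (L * L') := by
      refine ⟨(p - i).toNat, ?_⟩
      have h3 := hc'.L_pos
      have h4 := he.L_pos
      have h5 : (1 : ℤ) ≤ L * L' := by nlinarith
      have h6 : p - i ≤ ((p - i).toNat : ℤ) := by omega
      nlinarith
    have h3 := hag (i + n * (L * L') - o - 1).toNat (i + n * (L * L')) hn (by omega)
    have h4 := he.add_mul i (n * L)
    have h5 := hc'.add_mul i (n * L')
    rw [← h4, ← h5, mul_assoc, h3, mul_assoc, mul_comm (L' : ℤ)]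
  obtain ⟨j, hj⟩ := hc.exists_of_branching hF ho
  -- Since c j is the complement of e o, this mirror image of `c` agrees with `e` at o. Of the arcs
  -- leaving e o, one continues this mirror image; any other belongs to a rotation of `c`.
  have hm := hc.mirror (j + o)
  have hmo : (c (j + o - o)).compl = e o := by rw [add_sub_cancel_right, hj, Lit.compl_compl]
  have harc : Arc F ((c (j + o - o)).compl) (e (o + 1)) := hmo ▸ he.arc o
  rcases hm.arc_right hF harc with h | ⟨m, h1, h2⟩
  · exact .inr ⟨j + o, key _ hm hmo.symm h⟩
  · simp only [Lit.compl_compl, add_sub_cancel_right] at h1 h2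
    refine .inl ⟨j + o - m - o, key _ (hc.shift _) ?_ ?_⟩
    · rw [← hmo, add_sub_cancel_right, ← h1, Lit.compl_compl]
      congr 1
      ring
    · rw [h2]
      congr 1
      ring

end IsCycle

end Unique

/-! ### Codes of isomorphisms -/

section Code

variable {V : Type*} [DecidableEq V] {F G : Finset (Finset (Lit V))} {L L' : ℕ} {c e : ℤ → Lit V}

omit [DecidableEq V] in
/-- The sequence `c`, interleaved with the sequence of complements. -/
def interleave (c : ℤ → Lit V) (w : ℤ) : Lit V :=
  if w % 2 = 0 then c (w / 2) else (c (w / 2)).compl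

/-- The action of a code: codes are read modulo `2 L` and form a dihedral group. -/
def act (z w : ℤ) : ℤ := if z % 2 = 0 then z + w else z - w

lemma act_act (z z' w : ℤ) : act z (act z' w) = act (act z z') w := by
  unfold act
  split_ifs <;> omega

omit [DecidableEq V] in
lemma interleave_two_mul (i : ℤ) : interleave c (2 * i) = c i := by
  rw [interleave, if_pos (by omega), show 2 * i / 2 = i by omega]

omit [DecidableEq V] in
lemma interleave_two_mul_add_one (i : ℤ) : interleave c (2 * i + 1) = (c i).compl := by
  rw [interleave, if_neg (by omega), show (2 * i + 1) / 2 = i by omega]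

namespace IsCycle

lemma interleave_eq_iff (hc : IsCycle F L c) {x y : ℤ} (h : x % 2 = y % 2) :
    interleave c x = interleave c y ↔ (2 * L : ℤ) ∣ x - y := by
  have key : (L : ℤ) ∣ x / 2 - y / 2 ↔ (2 * L : ℤ) ∣ x - y := by
    rw [show x - y = 2 * (x / 2 - y / 2) by omega, Int.mul_dvd_mul_iff_left (by norm_num)]
  unfold interleave
  rw [h]
  split_ifs
  · rw [hc.eq_iff, key]
  · rw [Lit.compl_inj, hc.eq_iff, key]

lemma interleave_congr (hc : IsCycle F L c) {x y : ℤ} (h : (2 * L : ℤ) ∣ x - y) :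
    interleave c x = interleave c y := by
  refine (hc.interleave_eq_iff ?_).2 h
  obtain ⟨d, hd⟩ := h
  have : x - y = 2 * (L * d) := by rw [hd]; ring
  omega

lemma mem_lits_iff_interleave (hc : IsCycle F L c) (hF : IsTwoMU F) {x : Lit V} :
    x ∈ lits F ↔ ∃ w, interleave c w = x := by
  rw [hc.mem_lits_iff hF]
  constructor
  · rintro ⟨i, rfl | rfl⟩
    exacts [⟨_, interleave_two_mul i⟩, ⟨_, interleave_two_mul_add_one i⟩]
  · rintro ⟨w, rfl⟩
    unfold interleave
    split_ifs
    exacts [⟨_, .inl rfl⟩, ⟨_, .inr rfl⟩]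

/-- Uniqueness of the cycle in terms of codes: rotation by s has code 2s, and i ↦ c̄ (s − i) has
code 2s + 1. -/
lemma exists_code (hc : IsCycle F L c) (he : IsCycle F L' e) (hF : IsTwoMU F)
    (hk : 2 ≤ deficiency F) : ∃ z, ∀ w, interleave e w = interleave c (act z w) := by
  have hw : ∀ w : ℤ, ∃ i, w = 2 * i ∨ w = 2 * i + 1 := fun w => ⟨w / 2, by omega⟩
  rcases hc.unique he hF hk with ⟨s, hs⟩ | ⟨s, hs⟩
  · refine ⟨2 * s, fun w => ?_⟩
    rw [act, if_pos (by omega)]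
    obtain ⟨i, rfl | rfl⟩ := hw w
    · rw [interleave_two_mul, hs, ← mul_add, interleave_two_mul, add_comm]
    · rw [interleave_two_mul_add_one, hs, ← add_assoc, ← mul_add, interleave_two_mul_add_one,
        add_comm]
  · refine ⟨2 * s + 1, fun w => ?_⟩
    rw [act, if_neg (by omega)]
    obtain ⟨i, rfl | rfl⟩ := hw w
    · rw [interleave_two_mul, hs, show 2 * s + 1 - 2 * i = 2 * (s - i) + 1 by ring,
        interleave_two_mul_add_one]
    · rw [interleave_two_mul_add_one, hs, show 2 * s + 1 - (2 * i + 1) = 2 * (s - i) by ring,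
        interleave_two_mul, Lit.compl_compl]

/-- Codes of equal parity are compared at position 0. Codes of different parity would give c (s + i)
= c̄ (s' − i) for all i, so every arc would be a hub, but the arc into a branching literal is not.
-/
lemma code_unique (hc : IsCycle F L c) (hF : IsTwoMU F) (hk : 2 ≤ deficiency F) {z z' : ℤ}
    (h : ∀ w, interleave c (act z w) = interleave c (act z' w)) : (2 * L : ℤ) ∣ z - z' := by
  wlog hz : z % 2 = z' % 2 ∨ z % 2 = 0 generalizing z z'
  · rw [← dvd_neg, neg_sub]
    exact this (fun w => (h w).symm) (by omega)
  by_cases hp : z % 2 = z' % 2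
  · rw [← hc.interleave_eq_iff hp]
    simpa [act] using h 0
  · exfalso
    obtain ⟨t, -, -, ht, -⟩ := hc.exists_third hF hk 0 0
    have key : ∀ i, c (z / 2 + i) = (c (z' / 2 - i)).compl := by
      intro i
      have := h (2 * i)
      rw [act, act, if_pos (by omega), if_neg (by omega),
        show z + 2 * i = 2 * (z / 2 + i) by omega,
        show z' - 2 * i = 2 * (z' / 2 - i) + 1 by omega, interleave_two_mul,
        interleave_two_mul_add_one] at this
      exact this
    refine ((hc.branching_iff hF).1 ht).2 ⟨z / 2 + z' / 2 - t, ?_, ?_⟩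
    · have := key (z' / 2 - t)
      rw [← add_sub_assoc] at this
      rw [this]
      congr 2
      ring
    · have := key (z' / 2 - t + 1)
      rw [show z / 2 + (z' / 2 - t + 1) = z / 2 + z' / 2 - t + 1 by ring] at this
      rw [this]
      congr 2
      ring

end IsCycle

/-- A map between the literals of two clause-sets as a map between all literals. -/
def litMap (f : lits F → lits G) (x : Lit V) : Lit V := if h : x ∈ lits F then f ⟨x, h⟩ else x

lemma litMap_of_mem (f : lits F → lits G) {x : Lit V} (h : x ∈ lits F) :
    litMap f x = f ⟨x, h⟩ := dif_pos h

lemma mapClause_eq_image (f : lits F → lits G) {C : Finset (Lit V)} (hC : C ∈ F) :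
    mapClause f C = C.image (litMap f) := by
  ext y
  simp only [mapClause, Finset.mem_image, Finset.mem_filter, Finset.mem_univ, true_and]
  constructor
  · rintro ⟨x, hx, rfl⟩
    exact ⟨x, hx, litMap_of_mem f x.2⟩
  · rintro ⟨x, hx, rfl⟩
    exact ⟨⟨x, mem_lits hC hx⟩, hx, (litMap_of_mem f _).symm⟩

lemma litMap_compl {f : lits F → lits G} (hf : ∀ x, f (litCompl F x) = litCompl G (f x))
    {x : Lit V} (hx : x ∈ lits F) : litMap f x.compl = (litMap f x).compl := by
  rw [litMap_of_mem f hx, litMap_of_mem f (compl_mem_lits hx)]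
  exact congrArg Subtype.val (hf ⟨x, hx⟩)

lemma IsIsomorphism.image_mem {f : lits F ≃ lits G} (hf : IsIsomorphism F G f)
    {C : Finset (Lit V)} (hC : C ∈ F) : C.image (litMap f) ∈ G := by
  rw [← mapClause_eq_image f hC]
  exact (Finset.ext_iff.1 hf.2 _).1 (Finset.mem_image_of_mem _ hC)

lemma IsIsomorphism.arc {f : lits F ≃ lits G} (hf : IsIsomorphism F G f) {u v : Lit V}
    (h : Arc F u v) : Arc G (litMap f u) (litMap f v) := by
  have h1 := hf.image_mem h
  rw [Finset.image_insert, Finset.image_singleton,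
    litMap_compl hf.1 (mem_lits_of_arc h)] at h1
  exact h1

lemma IsIsomorphism.isCycle {f : lits F ≃ lits G} (hf : IsIsomorphism F G f)
    (hc : IsCycle F L c) : IsCycle G L fun i => litMap f (c i) := by
  have hm := fun i => mem_lits_of_arc (hc.arc i)
  refine ⟨hc.pos, fun i => hf.arc (hc.arc i), fun i j => ?_, ?_⟩
  · rw [litMap_of_mem f (hm i), litMap_of_mem f (hm j), ← hc.eq_iff]
    simp
  · obtain ⟨i, j, h⟩ := hc.contra
    exact ⟨i, j, by rw [h, litMap_compl hf.1 (hm i)]⟩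

/-- The image of the cycle of F is a contradictory cycle of G, hence a rotation or mirror image of
the given one. -/
lemma IsIsomorphism.exists_code {f : lits F ≃ lits G} (hf : IsIsomorphism F G f)
    (hc : IsCycle F L c) (he : IsCycle G L' e) (hG : IsTwoMU G) (hk : 2 ≤ deficiency G) :
    ∃ z, ∀ w, litMap f (interleave c w) = interleave e (act z w) := by
  obtain ⟨z, hz⟩ := he.exists_code (hf.isCycle hc) hG hk
  refine ⟨z, fun w => ?_⟩
  rw [← hz]
  unfold interleave
  split_ifs
  · rfl
  · exact litMap_compl hf.1 (mem_lits_of_arc (hc.arc _))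

/-- An isomorphism is determined by its code. -/
lemma IsCycle.eq_of_code (hc : IsCycle F L c) (hF : IsTwoMU F) {f g : lits F ≃ lits G}
    (h : ∀ w, litMap f (interleave c w) = litMap g (interleave c w)) : f = g := by
  ext ⟨x, hx⟩ : 2
  obtain ⟨w, rfl⟩ := (hc.mem_lits_iff_interleave hF).1 hx
  have := h w
  rwa [litMap_of_mem f hx, litMap_of_mem g hx] at this

lemma IsIsomorphism.branching {f : lits F ≃ lits G} (hf : IsIsomorphism F G f) {x : Lit V}
    (hx : Branching F x) : Branching G (litMap f x) := by
  obtain ⟨C, hC, D, hD, hne, hxC, hxD⟩ := hx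
  refine ⟨_, hf.image_mem hC, _, hf.image_mem hD, fun h => hne ?_, Finset.mem_image_of_mem _ hxC,
    Finset.mem_image_of_mem _ hxD⟩
  have hsub : ∀ C ∈ F, ∀ D ∈ F, C.image (litMap f) = D.image (litMap f) → C ⊆ D := by
    intro C hC D hD h y hy
    obtain ⟨y', hy', e⟩ := Finset.mem_image.1 (h ▸ Finset.mem_image_of_mem (litMap f) hy)
    rw [litMap_of_mem f (mem_lits hD hy'), litMap_of_mem f (mem_lits hC hy)] at e
    have : y' = y := by simpa using e
    exact this ▸ hy'
  exact (hsub C hC D hD h).antisymm (hsub D hD C hC h.symm)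

/-- There are at most `4 k` isomorphisms between 2-MUs of deficiency `k`. -/
theorem ncard_isomorphisms_le {k : ℕ} (hk : 2 ≤ k) (hF : IsTwoMU F) (hd : deficiency F = k)
    (hG : IsTwoMU G) (hd' : deficiency G = k) :
    {f : lits F ≃ lits G | IsIsomorphism F G f}.ncard ≤ 4 * k := by
  classical
  obtain ⟨L, c, hc⟩ := hF.exists_isCycle (by omega)
  obtain ⟨L', e, he⟩ := hG.exists_isCycle (by omega)
  have hcode : ∀ f : lits F ≃ lits G, ∃ z, IsIsomorphism F G f →
      ∀ w, litMap f (interleave c w) = interleave e (act z w) := by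
    intro f
    by_cases hf : IsIsomorphism F G f
    · obtain ⟨z, hz⟩ := hf.exists_code hc he hG (by omega)
      exact ⟨z, fun _ => hz⟩
    · exact ⟨0, fun h => absurd h hf⟩
  choose z hz using hcode
  obtain ⟨b, -, -, hb, -⟩ := hc.exists_third hF (by omega) 0 0
  rw [Set.ncard_eq_toFinset_card _ (Set.toFinite _)]
  have hcard : ((Finset.univ : Finset Bool) ×ˢ (lits G).filter (Branching G)).card = 4 * k := by
    rw [Finset.card_product, he.card_branching hG hk hd', Finset.card_univ, Fintype.card_bool]
    ring
  rw [← hcard]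
  -- An isomorphism is recovered from the parity of its code and the image of one branching literal:
  -- 2 · 2k possibilities.
  refine Finset.card_le_card_of_injOn (fun f => (decide (z f % 2 = 0), litMap f (c b))) ?_ ?_
  · intro f hf
    simp only [Set.Finite.coe_toFinset, Set.mem_ofPred_eq] at hf
    simp only [Finset.coe_product, Set.mem_prod, Finset.coe_univ, Set.mem_univ, true_and,
      Finset.mem_coe, Finset.mem_filter]
    refine ⟨?_, hf.branching hb⟩
    rw [litMap_of_mem _ (mem_lits_of_arc (hc.arc b))]
    exact Subtype.prop _
  · intro f hf g hg h
    simp only [Set.Finite.coe_toFinset, Set.mem_ofPred_eq] at hf hg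
    simp only [Prod.mk.injEq, decide_eq_decide] at h
    obtain ⟨hp, h⟩ := h
    have hp' : z f % 2 = z g % 2 := by omega
    rw [← interleave_two_mul (c := c) b, hz f hf, hz g hg,
      he.interleave_eq_iff (by unfold act; split_ifs <;> omega)] at h
    refine hc.eq_of_code hF fun w => ?_
    rw [hz f hf, hz g hg]
    refine he.interleave_congr ?_
    -- For codes of equal parity this difference does not depend on the position.
    have : act (z f) w - act (z g) w = act (z f) (2 * b) - act (z g) (2 * b) := by
      unfold act
      split_ifs <;> omega
    rwa [this]

end Code


/-! ### Embedding into the dihedral group -/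

section Dihedral

open DihedralGroup

/-- The rotations in a subgroup of a dihedral group. -/
def rotations {n : ℕ} (H : Subgroup (DihedralGroup n)) : AddSubgroup (ZMod n) where
  carrier := {x | r x ∈ H}
  zero_mem' := H.one_mem
  add_mem' := fun {a b} ha hb => by simpa using H.mul_mem ha hb
  neg_mem' := fun {a} ha => by simpa using H.inv_mem ha

/-- A subgroup of a cyclic group is cyclic; its generator is sent to the element d = N / |R| of ZMod
N. -/
lemma exists_zmod_hom {n N : ℕ} [NeZero n] (R : AddSubgroup (ZMod n)) (hN : N ≠ 0)
    (h : Nat.card R ∣ N) : ∃ θ : R →+ ZMod N, Function.Injective θ := by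
  obtain ⟨d, hd⟩ := h
  have hd0 : d ≠ 0 := by
    rintro rfl
    exact hN (by simpa using hd)
  have hf : (zmultiplesHom (ZMod N) ((d : ℕ) : ZMod N)) ((Nat.card R : ℕ) : ℤ) = 0 := by
    rw [zmultiplesHom_apply, natCast_zsmul, nsmul_eq_mul, ← Nat.cast_mul, ← hd]
    simp
  let lift := ZMod.lift (Nat.card R) ⟨zmultiplesHom (ZMod N) ((d : ℕ) : ZMod N), hf⟩
  have hl : Function.Injective lift := by
    refine (ZMod.lift_injective (f := ⟨_, hf⟩)).2 fun m hm => ?_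
    rw [ZMod.intCast_zmod_eq_zero_iff_dvd]
    simp only [zmultiplesHom_apply, zsmul_eq_mul] at hm
    rw [← Int.cast_natCast (R := ZMod N) d, ← Int.cast_mul, ZMod.intCast_zmod_eq_zero_iff_dvd, hd]
      at hm
    push_cast at hm
    exact Int.dvd_of_mul_dvd_mul_right (by exact_mod_cast hd0) hm
  let φ := (zmodAddCyclicAddEquiv (G := R) inferInstance).symm
  exact ⟨lift.comp φ.toAddMonoidHom, hl.comp φ.injective⟩

/-- Only the order of the rotation part matters: fixing one reflection t₀ of H, if there is one,
every reflection differs from it by a rotation, and the embedding of the rotations extends. -/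
lemma exists_dihedral_hom {n N : ℕ} [NeZero n] (H : Subgroup (DihedralGroup n)) (hN : N ≠ 0)
    (h : Nat.card (rotations H) ∣ N) : ∃ φ : H →* DihedralGroup N, Function.Injective φ := by
  classical
  obtain ⟨θ, hθ⟩ := exists_zmod_hom (rotations H) hN h
  obtain ⟨t₀, ht₀⟩ : ∃ t₀, ∀ t, sr t ∈ H → t - t₀ ∈ rotations H := by
    by_cases h : ∃ t, sr t ∈ H
    · obtain ⟨t₀, h₀⟩ := h
      refine ⟨t₀, fun t ht => ?_⟩
      have := H.mul_mem h₀ ht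
      rwa [sr_mul_sr] at this
    · exact ⟨0, fun t ht => absurd ⟨t, ht⟩ h⟩
  let ψ : H → DihedralGroup N := fun x => match x with
    | ⟨r i, hi⟩ => r (θ ⟨i, hi⟩)
    | ⟨sr i, hi⟩ => sr (θ ⟨i - t₀, ht₀ i hi⟩)
  have hmul : ∀ x y, ψ (x * y) = ψ x * ψ y := by
    rintro ⟨i | i, hi⟩ ⟨j | j, hj⟩
    · exact (congrArg r (θ.map_add ⟨i, hi⟩ ⟨j, hj⟩)).trans (r_mul_r _ _).symm
    · refine (congrArg sr ?_).trans (r_mul_sr _ _).symm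
      rw [← map_sub]
      congr 1
      exact Subtype.ext (by simp [sub_right_comm])
    · refine (congrArg sr ?_).trans (sr_mul_r _ _).symm
      rw [← map_add]
      congr 1
      exact Subtype.ext (by simp; ring)
    · refine (congrArg r ?_).trans (sr_mul_sr _ _).symm
      rw [← map_sub]
      congr 1
      exact Subtype.ext (by simp)
  refine ⟨MonoidHom.mk' ψ hmul, ?_⟩
  rintro ⟨i | i, hi⟩ ⟨j | j, hj⟩ e
  · have e' : r (θ ⟨i, hi⟩) = r (θ ⟨j, hj⟩) := e
    rw [r.injEq] at e'
    have := congrArg Subtype.val (hθ e')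
    simpa using this
  · exact absurd (show r (θ ⟨i, hi⟩) = sr _ from e) (by simp)
  · exact absurd (show sr _ = r (θ ⟨j, hj⟩) from e) (by simp)
  · have e' : sr (θ ⟨i - t₀, _⟩) = sr (θ ⟨j - t₀, _⟩) := e
    rw [sr.injEq] at e'
    have := congrArg Subtype.val (hθ e')
    simpa using this

/-- The element of the dihedral group with the given code. -/
def ofCode (n : ℕ) (z : ℤ) : DihedralGroup n :=
  if z % 2 = 0 then r ((z / 2 : ℤ) : ZMod n) else sr (-((z / 2 : ℤ) : ZMod n))

lemma ofCode_act (n : ℕ) (z z' : ℤ) : ofCode n (act z z') = ofCode n z * ofCode n z' := by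
  unfold ofCode act
  split_ifs with h1 h2 h3 h3 h3 h3 h3 <;> try omega
  · rw [r_mul_r, show (z + z') / 2 = z / 2 + z' / 2 by omega]
    push_cast
    rfl
  · rw [r_mul_sr, show (z + z') / 2 = z / 2 + z' / 2 by omega]
    push_cast
    congr 1
    ring
  · rw [sr_mul_sr, show (z - z') / 2 = z / 2 - z' / 2 by omega]
    push_cast
    congr 1
    ring
  · rw [sr_mul_r, show (z - z') / 2 = z / 2 - z' / 2 by omega]
    push_cast
    congr 1
    ring

lemma ofCode_eq_iff {n : ℕ} {z z' : ℤ} : ofCode n z = ofCode n z' ↔ (2 * n : ℤ) ∣ z - z' := by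
  have key : z % 2 = z' % 2 → ((2 * n : ℤ) ∣ z - z' ↔ ((z / 2 : ℤ) : ZMod n) = (z' / 2 : ℤ)) := by
    intro h
    rw [show z - z' = 2 * (z / 2 - z' / 2) by omega, Int.mul_dvd_mul_iff_left (by norm_num),
      ZMod.intCast_eq_intCast_iff, Int.modEq_comm, Int.modEq_iff_dvd]
  have hpar : (2 * n : ℤ) ∣ z - z' → z % 2 = z' % 2 := by
    rintro ⟨d, hd⟩
    have : z - z' = 2 * (n * d) := by rw [hd]; ring
    omega
  unfold ofCode
  split_ifs with h1 h2 h2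
  · rw [r.injEq, key (by omega)]
  · exact ⟨fun h => by simp at h, fun h => by have := hpar h; omega⟩
  · exact ⟨fun h => by simp at h, fun h => by have := hpar h; omega⟩
  · rw [sr.injEq, neg_inj, key (by omega)]

variable {V : Type*} [DecidableEq V] {F : Finset (Finset (Lit V))} {L : ℕ} {c : ℤ → Lit V}

lemma IsCycle.exists_aut_code (hc : IsCycle F L c) (hF : IsTwoMU F) (hk : 2 ≤ deficiency F)
    (g : autGroup F) :
    ∃ z, ∀ w, litMap (g : Equiv.Perm (lits F)) (interleave c w) = interleave c (act z w) :=
  IsIsomorphism.exists_code g.2 hc hc hF hk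

lemma litMap_mul (f g : Equiv.Perm (lits F)) {x : Lit V} (hx : x ∈ lits F) :
    litMap (f * g : Equiv.Perm (lits F)) x = litMap f (litMap g x) := by
  rw [litMap_of_mem _ hx, litMap_of_mem g hx, litMap_of_mem f (Subtype.prop _)]
  rfl

/-- The code of a product. -/
lemma IsCycle.code_mul (hc : IsCycle F L c) (hF : IsTwoMU F) {f g : Equiv.Perm (lits F)} {z z' : ℤ}
    (hf : ∀ w, litMap f (interleave c w) = interleave c (act z w))
    (hg : ∀ w, litMap g (interleave c w) = interleave c (act z' w)) (w : ℤ) :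
    litMap (f * g : Equiv.Perm (lits F)) (interleave c w) = interleave c (act (act z z') w) := by
  rw [litMap_mul f g ((hc.mem_lits_iff_interleave hF).2 ⟨w, rfl⟩), hg, hf, act_act]

/-- The automorphism group of a 2-MU of deficiency `k` embeds into the dihedral group with `4 k`
elements. -/
theorem exists_autGroup_hom {k : ℕ} (hk : 2 ≤ k) (hF : IsTwoMU F) (hd : deficiency F = k) :
    ∃ φ : autGroup F →* DihedralGroup (2 * k), Function.Injective φ := by
  classical
  have hk' : 2 ≤ deficiency F := by omega
  obtain ⟨L, c, hc⟩ := hF.exists_isCycle hk'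
  have : NeZero L := ⟨hc.pos.ne'⟩
  choose z hz using hc.exists_aut_code hF hk'
  have hmul : ∀ f g, ofCode L (z (f * g)) = ofCode L (z f) * ofCode L (z g) := by
    intro f g
    rw [← ofCode_act, ofCode_eq_iff]
    refine hc.code_unique hF hk' fun w => ?_
    rw [← hz, ← hc.code_mul hF (hz f) (hz g)]
    rfl
  let ψ : autGroup F →* DihedralGroup L := MonoidHom.mk' (fun f => ofCode L (z f)) hmul
  have hψ : Function.Injective ψ := by
    intro f g h
    have h' : ofCode L (z f) = ofCode L (z g) := h
    rw [ofCode_eq_iff] at h'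
    refine Subtype.ext (hc.eq_of_code hF fun w => ?_)
    rw [hz, hz]
    refine hc.interleave_congr ?_
    have hp : z f % 2 = z g % 2 := by
      obtain ⟨d, hd⟩ := h'
      have : z f - z g = 2 * (L * d) := by rw [hd]; ring
      omega
    have : act (z f) w - act (z g) w = z f - z g := by
      unfold act
      split_ifs <;> omega
    rwa [this]
  have hcast : ∀ i j : ℤ, ((i : ZMod L) = j) ↔ c i = c j := by
    intro i j
    rw [ZMod.intCast_eq_intCast_iff, Int.modEq_comm, Int.modEq_iff_dvd, hc.eq_iff]
  -- The positions of branching literals, 2k in number because the cycle is simple.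
  let P : Set (ZMod L) := {x | ∃ i : ℤ, (i : ZMod L) = x ∧ Branching F (c i)}
  have hPcard : Nat.card P = 2 * k := by
    have hinj : Function.Injective fun x : ZMod L => c (x.val : ℤ) := by
      intro x y h
      have := (hcast _ _).2 h
      simpa using this
    have himg : (fun x : ZMod L => c (x.val : ℤ)) '' P = ((lits F).filter (Branching F) : Finset _) := by
      ext x
      simp only [Set.mem_image, Finset.mem_coe, Finset.mem_filter]
      constructor
      · rintro ⟨_, ⟨i, rfl, hi⟩, rfl⟩
        have : c i = c ((i : ZMod L).val : ℤ) := (hcast _ _).1 (by simp)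
        rw [← this]
        exact ⟨mem_lits_of_arc (hc.arc i), hi⟩
      · rintro ⟨-, hx⟩
        obtain ⟨i, rfl⟩ := hc.exists_of_branching hF hx
        exact ⟨i, ⟨i, rfl, hx⟩, (hcast _ _).1 (by simp)⟩
    rw [← hc.card_branching hF hk hd, ← Set.ncard_coe_finset, ← himg,
      Set.ncard_image_of_injective _ hinj, Set.ncard_def, Nat.card, Set.encard]
    rfl
  have hdvd : Nat.card (rotations ψ.range) ∣ Nat.card P := by
    -- Automorphisms preserve branching, so P is invariant under translation by the rotations that
    -- occur.
    have hinv : ∀ x ∈ P, ∀ s ∈ rotations ψ.range, x + s ∈ P := by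
      rintro x ⟨i, rfl, hi⟩ s ⟨f, hf⟩
      have hf' : ofCode L (z f) = r s := hf
      unfold ofCode at hf'
      split_ifs at hf' with hp
      rw [r.injEq] at hf'
      refine ⟨i + z f / 2, by push_cast; rw [hf'], ?_⟩
      have h1 := hz f (2 * i)
      rw [act, if_pos hp, show z f + 2 * i = 2 * (i + z f / 2) by omega, interleave_two_mul,
        interleave_two_mul] at h1
      rw [← h1]
      exact IsIsomorphism.branching f.2 hi
    -- Hence P is a union of cosets of the rotation subgroup, whose order therefore divides 2k.
    have hpre : P = QuotientAddGroup.mk ⁻¹'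
        ((QuotientAddGroup.mk : ZMod L → ZMod L ⧸ rotations ψ.range) '' P) := by
      refine (Set.subset_preimage_image _ _).antisymm ?_
      rintro x ⟨y, hy, hxy⟩
      rw [QuotientAddGroup.eq] at hxy
      simpa using hinv y hy _ hxy
    rw [hpre, Nat.card_congr (QuotientAddGroup.preimageMkEquivAddSubgroupProdSet _ _), Nat.card_prod]
    exact dvd_mul_right _ _
  rw [hPcard] at hdvd
  obtain ⟨φ, hφ⟩ := exists_dihedral_hom ψ.range (by omega : 2 * k ≠ 0) hdvd
  exact ⟨φ.comp ψ.rangeRestrict, hφ.comp ((MonoidHom.rangeRestrict_injective_iff).2 hψ)⟩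

end Dihedral


/-! ### Reasoning about programs -/

section Wp

attribute [simp] Expr.eval Expr.cost

@[simp] lemma State.reg_setReg (s : State) (r r' : ℕ) (v : ℤ) :
    (s.setReg r v).reg r' = if r' = r then v else s.reg r' := by
  simp [State.setReg, Function.update_apply]

@[simp] lemma State.arr_setReg (s : State) (r : ℕ) (v : ℤ) : (s.setReg r v).arr = s.arr := rfl

@[simp] lemma State.reg_setArr (s : State) (a : ℕ) (i v : ℤ) : (s.setArr a i v).reg = s.reg := rfl

@[simp] lemma State.arr_setArr (s : State) (a a' : ℕ) (i v : ℤ) :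
    (s.setArr a i v).arr a' = if a' = a then Function.update (s.arr a) i v else s.arr a' := by
  simp [State.setArr, Function.update_apply]

/-- The program `p`, started in `s`, halts with a number of steps and a final state that
satisfy `Q`. -/
def wp (p : Prog) (s : State) (Q : ℕ → State → Prop) : Prop := ∃ t s', Exec p s t s' ∧ Q t s'

lemma wp.mono {p : Prog} {s : State} {Q Q' : ℕ → State → Prop} (h : wp p s Q)
    (hQ : ∀ t s', Q t s' → Q' t s') : wp p s Q' :=
  let ⟨t, s', he, hq⟩ := h
  ⟨t, s', he, hQ t s' hq⟩

@[simp] lemma wp_skip {s : State} {Q : ℕ → State → Prop} : wp .skip s Q ↔ Q 1 s := by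
  constructor
  · rintro ⟨t, s', h, hq⟩
    cases h
    exact hq
  · exact fun h => ⟨_, _, .skip s, h⟩

@[simp] lemma wp_assign {s : State} {r : ℕ} {e : Expr} {Q : ℕ → State → Prop} :
    wp (.assign r e) s Q ↔ Q (e.cost + 1) (s.setReg r (e.eval s)) := by
  constructor
  · rintro ⟨t, s', h, hq⟩
    cases h
    exact hq
  · exact fun h => ⟨_, _, .assign s r e, h⟩

@[simp] lemma wp_store {s : State} {a : ℕ} {i e : Expr} {Q : ℕ → State → Prop} :
    wp (.store a i e) s Q ↔ Q (i.cost + e.cost + 1) (s.setArr a (i.eval s) (e.eval s)) := by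
  constructor
  · rintro ⟨t, s', h, hq⟩
    cases h
    exact hq
  · exact fun h => ⟨_, _, .store s a i e, h⟩

@[simp] lemma wp_seq {s : State} {p q : Prog} {Q : ℕ → State → Prop} :
    wp (.seq p q) s Q ↔ wp p s fun t s' => wp q s' fun t' s'' => Q (t + t') s'' := by
  constructor
  · rintro ⟨t, s', h, hq⟩
    cases h with
    | seq h1 h2 => exact ⟨_, _, h1, _, _, h2, hq⟩
  · rintro ⟨t, s', h1, t', s'', h2, hq⟩
    exact ⟨_, _, .seq h1 h2, hq⟩

@[simp] lemma wp_ite {s : State} {e₁ e₂ : Expr} {p q : Prog} {Q : ℕ → State → Prop} :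
    wp (.ite e₁ e₂ p q) s Q ↔
      (e₁.eval s ≤ e₂.eval s → wp p s fun t s' => Q (e₁.cost + e₂.cost + 1 + t) s') ∧
      (¬ e₁.eval s ≤ e₂.eval s → wp q s fun t s' => Q (e₁.cost + e₂.cost + 1 + t) s') := by
  constructor
  · rintro ⟨t, s', h, hq⟩
    cases h with
    | ite_true hle h => exact ⟨fun _ => ⟨_, _, h, hq⟩, fun h' => absurd hle h'⟩
    | ite_false hle h => exact ⟨fun h' => absurd h' hle, fun _ => ⟨_, _, h, hq⟩⟩
  · rintro ⟨h1, h2⟩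
    by_cases hle : e₁.eval s ≤ e₂.eval s
    · obtain ⟨t, s', h, hq⟩ := h1 hle
      exact ⟨_, _, .ite_true hle h, hq⟩
    · obtain ⟨t, s', h, hq⟩ := h2 hle
      exact ⟨_, _, .ite_false hle h, hq⟩

/-- A loop that runs `n` times, with an invariant and a bound for the cost of each round. -/
lemma wp_loop (n : ℕ) (I : ℕ → State → Prop) (T : ℕ → ℕ) {s : State} {e₁ e₂ : Expr} {p : Prog}
    {Q : ℕ → State → Prop} (h0 : I 0 s)
    (hstep : ∀ i s, i < n → I i s → e₁.eval s ≤ e₂.eval s ∧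
      wp p s fun t s' => t ≤ T i ∧ I (i + 1) s')
    (hend : ∀ s, I n s → ¬ e₁.eval s ≤ e₂.eval s)
    (hQ : ∀ t s', I n s' →
      t ≤ ∑ i ∈ Finset.range n, (T i + (e₁.cost + e₂.cost + 1)) + (e₁.cost + e₂.cost + 1) →
      Q t s') :
    wp (.loop e₁ e₂ p) s Q := by
  have key : ∀ m i, i + m = n → ∀ s, I i s → ∃ t s', Exec (.loop e₁ e₂ p) s t s' ∧ I n s' ∧
      t ≤ ∑ j ∈ Finset.range m, (T (i + j) + (e₁.cost + e₂.cost + 1)) +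
        (e₁.cost + e₂.cost + 1) := by
    intro m
    induction m with
    | zero =>
      rintro i rfl s hs
      exact ⟨_, s, .loop_done (hend s hs), hs, by simp⟩
    | succ m ih =>
      intro i him s hs
      obtain ⟨hle, t, s', he, ht, hs'⟩ := hstep i s (by omega) hs
      obtain ⟨t', s'', he', hs'', ht'⟩ := ih (i + 1) (by omega) s' hs'
      refine ⟨_, s'', .loop_step hle he he', hs'', ?_⟩
      rw [Finset.sum_range_succ']
      simp only [add_zero, add_assoc, add_comm 1] at ht' ⊢
      omega
  obtain ⟨t, s', he, hs', ht⟩ := key n 0 (by omega) s h0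
  simp only [zero_add] at ht
  exact ⟨t, s', he, hQ t s' hs' ht⟩

/-- A loop whose rounds have a common cost bound. -/
lemma wp_loop_const (n : ℕ) (I : ℕ → State → Prop) (T : ℕ) {s : State} {e₁ e₂ : Expr} {p : Prog}
    {Q : ℕ → State → Prop} (h0 : I 0 s)
    (hstep : ∀ i s, i < n → I i s → e₁.eval s ≤ e₂.eval s ∧
      wp p s fun t s' => t ≤ T ∧ I (i + 1) s')
    (hend : ∀ s, I n s → ¬ e₁.eval s ≤ e₂.eval s)
    (hQ : ∀ t s', I n s' →
      t ≤ n * (T + (e₁.cost + e₂.cost + 1)) + (e₁.cost + e₂.cost + 1) → Q t s') :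
    wp (.loop e₁ e₂ p) s Q :=
  wp_loop n I (fun _ => T) h0 hstep hend fun t s' h ht => hQ t s' h (by simpa using ht)

/-- The programs of a list, one after the other. -/
def Prog.block : List Prog → Prog
  | [] => .skip
  | [p] => p
  | p :: q :: ps => .seq p (Prog.block (q :: ps))

attribute [simp] Prog.block

end Wp

/-! ### Codes of literals -/

section LitCode

lemma litCode_ne_zero (x : Lit ℕ+) : litCode x ≠ 0 := by
  have := x.1.pos
  unfold litCode
  split_ifs <;> omega

@[simp] lemma litCode_compl (x : Lit ℕ+) : litCode x.compl = -litCode x := by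
  obtain ⟨v, b⟩ := x
  cases b <;> simp [litCode, Lit.compl]

@[simp] lemma litCode_inj {x y : Lit ℕ+} : litCode x = litCode y ↔ x = y := by
  refine ⟨fun h => ?_, fun h => h ▸ rfl⟩
  obtain ⟨v, a⟩ := x
  obtain ⟨w, b⟩ := y
  have hv := v.pos
  have hw := w.pos
  cases a <;> cases b <;> simp [litCode] at h ⊢ <;> exact h

end LitCode

/-! ### Reading the input -/

section Input

variable {F : Finset (Finset (Lit ℕ+))} {cs : List (List (Lit ℕ+))}

/-- The input array. -/
def inputArr (w : List ℤ) (i : ℤ) : ℤ := if 0 ≤ i then w.getD i.toNat 0 else 0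

lemma inputArr_natCast (w : List ℤ) (p : ℕ) : inputArr w p = w.getD p 0 := by
  simp [inputArr]

lemma initState_arr_zero (w : List ℤ) : (initState w).arr 0 = inputArr w := by
  ext i
  simp [initState, inputArr]

lemma initState_arr (w : List ℤ) {a : ℕ} (ha : a ≠ 0) (i : ℤ) : (initState w).arr a i = 0 := by
  simp [initState, ha]

lemma length_dimacs (h : ∀ c ∈ cs, c.length = 2) : (dimacs cs).length = 3 * cs.length := by
  induction cs with
  | nil => rfl
  | cons c cs ih =>
    have h1 := h c (by simp)
    have h2 := ih fun c hc => h c (by simp [hc])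
    simp only [dimacs, List.flatMap_cons, List.length_append, List.length_map, h1,
      List.length_cons, List.length_nil] at h2 ⊢
    omega

lemma getD_dimacs (h : ∀ c ∈ cs, c.length = 2) (t : ℕ) (ht : t < cs.length) :
    ∃ a b, cs[t] = [a, b] ∧ (dimacs cs).getD (3 * t) 0 = litCode a ∧
      (dimacs cs).getD (3 * t + 1) 0 = litCode b := by
  induction cs generalizing t with
  | nil => simp at ht
  | cons c cs ih =>
    obtain ⟨a, b, rfl⟩ := List.length_eq_two.1 (h c (by simp))
    cases t with
    | zero => exact ⟨a, b, by simp [dimacs]⟩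
    | succ t =>
      obtain ⟨x, y, h1, h2, h3⟩ := ih (fun c hc => h c (by simp [hc])) t (by simpa using ht)
      refine ⟨x, y, by simpa using h1, ?_, ?_⟩
      · rw [← h2, show 3 * (t + 1) = 3 * t + 3 by ring]
        simp [dimacs]
      · rw [← h3, show 3 * (t + 1) + 1 = 3 * t + 1 + 3 by ring]
        simp [dimacs]

/-- The specification maps literals while the machine maps integers; the separators 0 must be fixed.
-/
lemma dimacs_map (g : Lit ℕ+ → Lit ℕ+) (h : ℤ → ℤ) (h0 : h 0 = 0)
    (hg : ∀ c ∈ cs, ∀ x ∈ c, h (litCode x) = litCode (g x)) :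
    dimacs (cs.map (List.map g)) = (dimacs cs).map h := by
  induction cs with
  | nil => rfl
  | cons c cs ih =>
    have h1 := ih fun c hc => hg c (by simp [hc])
    simp only [dimacs, List.map_cons, List.flatMap_cons, List.map_append, List.map_map, h0,
      List.map_nil] at h1 ⊢
    rw [h1]
    congr 2
    exact List.map_congr_left fun x hx => (hg c (by simp) x hx).symm

lemma mem_dimacs {v : ℤ} : v ∈ dimacs cs → v = 0 ∨ ∃ c ∈ cs, ∃ x ∈ c, v = litCode x := by
  simp only [dimacs, List.mem_flatMap, List.mem_append, List.mem_map, List.mem_singleton]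
  rintro ⟨c, hc, ⟨x, hx, rfl⟩ | rfl⟩
  exacts [.inr ⟨c, hc, x, hx, rfl⟩, .inl rfl]

namespace ListsClauses

lemma length_eq_card (h : ListsClauses cs F) : cs.length = F.card := by
  rw [← h.2.2, List.toFinset_card_of_nodup h.2.1, List.length_map]

lemma toFinset_mem (h : ListsClauses cs F) {c : List (Lit ℕ+)} (hc : c ∈ cs) : c.toFinset ∈ F := by
  rw [← h.2.2, List.mem_toFinset]
  exact List.mem_map_of_mem hc

lemma length_eq_two (h : ListsClauses cs F) (h2 : ∀ C ∈ F, C.card = 2) :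
    ∀ c ∈ cs, c.length = 2 := by
  intro c hc
  rw [← h2 _ (h.toFinset_mem hc), List.toFinset_card_of_nodup (h.1 c hc)]

lemma exists_mem (h : ListsClauses cs F) {C : Finset (Lit ℕ+)} (hC : C ∈ F) :
    ∃ c ∈ cs, c.toFinset = C := by
  rw [← h.2.2, List.mem_toFinset, List.mem_map] at hC
  exact hC

end ListsClauses

/-- The contents of the degree array `d` and the neighbour array `n` for the clause-set `G`. -/
structure IsAdjacency (G : Finset (Finset (Lit ℕ+))) (d n : ℤ → ℤ) : Prop where
  zero : d 0 = 0
  deg : ∀ x, d (litCode x) = litDegree G x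
  nb : ∀ x, ∀ i < litDegree G x, ∃ y, n (litCode x + litCode x + i) = litCode y ∧
    ({x, y} : Finset (Lit ℕ+)) ∈ G
  nb_ne : ∀ x, ∀ j < litDegree G x, ∀ i < j,
    n (litCode x + litCode x + i) ≠ n (litCode x + litCode x + j)

lemma litDegree_insert {G : Finset (Finset (Lit ℕ+))} {C : Finset (Lit ℕ+)} (hC : C ∉ G)
    (x : Lit ℕ+) : litDegree (insert C G) x = litDegree G x + if x ∈ C then 1 else 0 := by
  unfold litDegree
  rw [Finset.filter_insert]
  split_ifs
  · rw [Finset.card_insert_of_notMem (by simp [hC])]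
  · rfl

lemma litDegree_mono {G H : Finset (Finset (Lit ℕ+))} (h : G ⊆ H) (x : Lit ℕ+) :
    litDegree G x ≤ litDegree H x :=
  Finset.card_le_card (Finset.filter_subset_filter _ h)

/-- The effect of one round of `adjacencyProg`. Degrees are at most 2, so the cells 2v and 2v + 1
suffice for the literal with code v, and cells of different literals never collide. -/
lemma IsAdjacency.insert_clause {G : Finset (Finset (Lit ℕ+))} {d n : ℤ → ℤ} (h : IsAdjacency G d n)
    {a b : Lit ℕ+} (hab : a ≠ b) (hG : ({a, b} : Finset (Lit ℕ+)) ∉ G)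
    (h2 : ∀ x, litDegree (insert {a, b} G) x ≤ 2) {d' n' : ℤ → ℤ}
    (hd : ∀ v, d' v = if v = litCode a ∨ v = litCode b then d v + 1 else d v)
    (hn : ∀ v, n' v = if v = litCode a + litCode a + d (litCode a) then litCode b else
      if v = litCode b + litCode b + d (litCode b) then litCode a else n v) :
    IsAdjacency (insert {a, b} G) d' n' := by
  have hdeg := litDegree_insert hG
  have ha := h2 a
  have hb := h2 b
  have hda := h.deg a
  have hdb := h.deg b
  have hab' : litCode a ≠ litCode b := fun e => hab (litCode_inj.1 e)
  rw [hdeg] at ha hb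
  simp only [Finset.mem_insert, Finset.mem_singleton, true_or, or_true, if_true] at ha hb
  -- the old cells are unchanged
  have hold : ∀ x, ∀ i < litDegree G x,
      n' (litCode x + litCode x + i) = n (litCode x + litCode x + i) := by
    intro x i hi
    have hx := (litDegree_mono (Finset.subset_insert {a, b} G) x).trans (h2 x)
    rw [hn, if_neg, if_neg]
    · intro e
      have e1 : litCode x = litCode b := by omega
      have := litCode_inj.1 e1
      subst this
      omega
    · intro e
      have e1 : litCode x = litCode a := by omega
      have := litCode_inj.1 e1
      subst this
      omega
  have hna : n' (litCode a + litCode a + litDegree G a) = litCode b := by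
    rw [hn, if_pos (by rw [hda])]
  have hnb : n' (litCode b + litCode b + litDegree G b) = litCode a := by
    rw [hn, if_neg (by omega), if_pos (by rw [hdb])]
  have hdeg' : ∀ x, ∀ i < litDegree (insert {a, b} G) x, i < litDegree G x ∨
      i = litDegree G x ∧ (x = a ∨ x = b) := by
    intro x i hi
    rw [hdeg] at hi
    simp only [Finset.mem_insert, Finset.mem_singleton] at hi
    split_ifs at hi with hx
    · rcases Nat.lt_succ_iff_lt_or_eq.1 hi with h | h
      exacts [.inl h, .inr ⟨h, hx⟩]
    · exact .inl hi
  refine ⟨?_, fun x => ?_, fun x i hi => ?_, fun x j hj i hij => ?_⟩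
  · rw [hd, if_neg, h.zero]
    rintro (e | e)
    exacts [litCode_ne_zero a e.symm, litCode_ne_zero b e.symm]
  · rw [hd, hdeg, h.deg]
    simp only [litCode_inj, Finset.mem_insert, Finset.mem_singleton]
    split_ifs <;> simp
  · rcases hdeg' x i hi with h1 | ⟨rfl, rfl | rfl⟩
    · obtain ⟨y, hy, hy'⟩ := h.nb x i h1
      exact ⟨y, by rw [hold x i h1, hy], Finset.mem_insert_of_mem hy'⟩
    · exact ⟨b, hna, Finset.mem_insert_self _ _⟩
    · exact ⟨a, hnb, by rw [Finset.pair_comm]; exact Finset.mem_insert_self _ _⟩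
  · rcases hdeg' x j hj with h1 | ⟨rfl, rfl | rfl⟩
    · rw [hold x i (hij.trans h1), hold x j h1]
      exact h.nb_ne x j h1 i hij
    · obtain ⟨y, hy, hy'⟩ := h.nb x i hij
      rw [hold x i hij, hna, hy, Ne, litCode_inj]
      rintro rfl
      exact hG hy'
    · obtain ⟨y, hy, hy'⟩ := h.nb x i hij
      rw [hold x i hij, hnb, hy, Ne, litCode_inj]
      rintro rfl
      exact hG (by rwa [Finset.pair_comm])

/-- Computes the degrees and the neighbours of all literals. -/
def adjacencyProg : Prog := .block [
  .assign 1 (.const 0),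
  .loop (.add (.reg 1) (.const 1)) (.reg 0) (.block [
    .assign 2 (.load 0 (.reg 1)),
    .assign 3 (.load 0 (.add (.reg 1) (.const 1))),
    .store 4 (.add (.add (.reg 2) (.reg 2)) (.load 3 (.reg 2))) (.reg 3),
    .store 4 (.add (.add (.reg 3) (.reg 3)) (.load 3 (.reg 3))) (.reg 2),
    .store 3 (.reg 2) (.add (.load 3 (.reg 2)) (.const 1)),
    .store 3 (.reg 3) (.add (.load 3 (.reg 3)) (.const 1)),
    .assign 1 (.add (.reg 1) (.const 3))])]

lemma wp_adjacencyProg (h : ListsClauses cs F) (h2 : ∀ C ∈ F, C.card = 2)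
    (hdeg : ∀ x, litDegree F x ≤ 2) :
    wp adjacencyProg (initState (dimacs cs)) fun t s => t ≤ 50 * F.card + 10 ∧
      s.reg 0 = (dimacs cs).length ∧ s.arr 0 = inputArr (dimacs cs) ∧
      IsAdjacency F (s.arr 3) (s.arr 4) ∧ ∀ a, 5 ≤ a → s.arr a = fun _ => 0 := by
  have hlen := h.length_eq_two h2
  have hn := length_dimacs hlen
  have hcard := h.length_eq_card
  -- The loop invariant concerns the clause-set formed by the first t clauses.
  let G : ℕ → Finset (Finset (Lit ℕ+)) := fun t => ((cs.take t).map List.toFinset).toFinset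
  have hGF : ∀ t, G t ⊆ F := by
    intro t C hC
    simp only [G, List.mem_toFinset, List.mem_map] at hC
    obtain ⟨c, hc, rfl⟩ := hC
    exact h.toFinset_mem (List.mem_of_mem_take hc)
  have hGs : ∀ t (ht : t < cs.length), G (t + 1) = insert cs[t].toFinset (G t) := by
    intro t ht
    ext C
    simp only [G]
    rw [List.take_add_one, List.getElem?_eq_getElem ht, Option.toList_some, List.map_append,
      List.toFinset_append]
    simp [or_comm]
  have hGn : ∀ t (ht : t < cs.length), cs[t].toFinset ∉ G t := by
    intro t ht hmem
    simp only [G, List.mem_toFinset, List.mem_map, List.mem_take_iff_getElem] at hmem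
    obtain ⟨c, ⟨i, hi, rfl⟩, hc⟩ := hmem
    have := (List.nodup_iff_injective_get.1 h.2.1)
      (a₁ := ⟨i, by simp; omega⟩) (a₂ := ⟨t, by simpa using ht⟩) (by simpa using hc)
    simp at this
    omega
  simp only [adjacencyProg, Prog.block, wp_seq, wp_assign]
  refine wp_loop_const F.card (fun t s => s.reg 0 = (dimacs cs).length ∧ s.reg 1 = 3 * t ∧
    s.arr 0 = inputArr (dimacs cs) ∧ IsAdjacency (G t) (s.arr 3) (s.arr 4) ∧
    ∀ a, 5 ≤ a → s.arr a = fun _ => 0) 45 ?_ ?_ ?_ ?_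
  · refine ⟨by simp [initState], by simp, by simp [initState_arr_zero], ?_, fun a ha => ?_⟩
    · constructor <;> simp [initState_arr, G, litDegree]
    · ext i
      simp [initState_arr _ (show a ≠ 0 by omega)]
  · rintro t s ht ⟨h0, h1, harr, hadj, hz⟩
    have ht' : t < cs.length := by omega
    obtain ⟨a, b, hcab, ha, hb⟩ := getD_dimacs hlen t ht'
    have ha' : s.arr 0 (s.reg 1) = litCode a := by
      rw [harr, h1, ← ha, ← inputArr_natCast]
      push_cast
      rfl
    have hb' : s.arr 0 (s.reg 1 + 1) = litCode b := by
      rw [harr, h1, ← hb, ← inputArr_natCast]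
      push_cast
      rfl
    have hC := h2 _ (h.toFinset_mem (List.getElem_mem ht'))
    have hset : cs[t].toFinset = {a, b} := by simp [hcab]
    have hab : a ≠ b := by
      rintro rfl
      simp [hset] at hC
    have hab' : litCode a ≠ litCode b := fun e => hab (litCode_inj.1 e)
    have hGs' := hGs t ht'
    have hGn' := hGn t ht'
    rw [hset] at hGs' hGn'
    refine ⟨by simp only [Expr.eval, h0, h1]; omega, ?_⟩
    simp only [wp_seq, wp_assign, wp_store, Expr.eval, Expr.cost, State.reg_setReg,
      State.arr_setReg, State.reg_setArr, State.arr_setArr, ha', hb', Nat.reduceEqDiff, reduceIte,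
      OfNat.zero_ne_ofNat, OfNat.one_ne_ofNat, zero_ne_one]
    refine ⟨by norm_num, h0, by rw [h1]; push_cast; ring, harr, ?_, fun a ha => ?_⟩
    · rw [hGs']
      have hd2 : ∀ x, litDegree (insert {a, b} (G t)) x ≤ 2 := fun x => by
        rw [← hGs']
        exact (litDegree_mono (hGF _) x).trans (hdeg x)
      refine hadj.insert_clause hab hGn' hd2 (fun v => ?_) (fun v => ?_)
      · simp only [Function.update_apply]
        split_ifs <;> simp_all
      · have e1 := hd2 a
        have e2 := hd2 b
        rw [litDegree_insert hGn'] at e1 e2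
        simp only [Finset.mem_insert, Finset.mem_singleton, true_or, or_true, if_true] at e1 e2
        have e3 := hadj.deg a
        have e4 := hadj.deg b
        simp only [Function.update_apply]
        split_ifs <;> first | rfl | omega
    · have h3 : a ≠ 3 := by omega
      have h4 : a ≠ 4 := by omega
      simpa [h3, h4] using hz a ha
  · rintro s ⟨h0, h1, -⟩
    simp only [Expr.eval, h0, h1]
    omega
  · rintro t s ⟨h0, h1, h2, h3, h4⟩ ht
    have hGall : G F.card = F := by
      simp only [G]
      rw [← hcard, List.take_length, h.2.2]
    rw [hGall] at h3
    simp only [Expr.cost] at ht ⊢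
    exact ⟨by omega, h0, h2, h3, h4⟩

end Input


/-! ### Computing the cycle -/

section Walk

variable {F : Finset (Finset (Lit ℕ+))} {L : ℕ} {c : ℤ → Lit ℕ+}

/-- `nx u i` is the `i`-th successor of `u`, as recorded in the neighbour array `n`. -/
structure IsSucc (F : Finset (Finset (Lit ℕ+))) (n : ℤ → ℤ) (nx : Lit ℕ+ → ℕ → Lit ℕ+) : Prop where
  val : ∀ u, ∀ i < litDegree F u.compl, n (-litCode u - litCode u + i) = litCode (nx u i)
  arc : ∀ u, ∀ i < litDegree F u.compl, Arc F u (nx u i)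
  ne : ∀ u, litDegree F u.compl = 2 → nx u 0 ≠ nx u 1

/-- The successors of u are the partners of ū in its clauses, hence the cells starting at −2 ·
`litCode u`. -/
lemma IsAdjacency.exists_isSucc {d n : ℤ → ℤ} (h : IsAdjacency F d n) : ∃ nx, IsSucc F n nx := by
  have key : ∀ u i, ∃ y, i < litDegree F u.compl →
      n (-litCode u - litCode u + i) = litCode y ∧ Arc F u y := by
    intro u i
    by_cases hi : i < litDegree F u.compl
    · obtain ⟨y, h1, h2⟩ := h.nb u.compl i hi
      refine ⟨y, fun _ => ⟨?_, h2⟩⟩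
      rw [← h1, litCode_compl, sub_eq_add_neg]
    · exact ⟨u, fun h => absurd h hi⟩
  choose nx hnx using key
  refine ⟨nx, fun u i hi => (hnx u i hi).1, fun u i hi => (hnx u i hi).2, fun u hu e => ?_⟩
  refine h.nb_ne u.compl 1 (by omega) 0 (by omega) ?_
  have h0 := (hnx u 0 (by omega)).1
  have h1 := (hnx u 1 (by omega)).1
  rw [litCode_compl, ← sub_eq_add_neg, h0, h1, e]

/-- Finds a branching literal. -/
def startProg : Prog := .block [
  .assign 1 (.const 0),
  .loop (.load 3 (.load 0 (.reg 1))) (.const 1) (.assign 1 (.add (.reg 1) (.const 1))),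
  .assign 4 (.load 0 (.reg 1))]

/-- The separators 0 have degree 0 by `hd0`, so the search passes over them. -/
lemma wp_startProg {w : List ℤ} {s : State} (h0 : s.arr 0 = inputArr w)
    (hd : ∀ x, s.arr 3 (litCode x) = litDegree F x) (hd0 : s.arr 3 0 = 0)
    (hw : ∀ v ∈ w, v = 0 ∨ ∃ x, v = litCode x)
    (hex : ∃ x, Branching F x ∧ litCode x ∈ w) :
    wp startProg s fun t s' => t ≤ 9 * w.length + 20 ∧ s'.reg 0 = s.reg 0 ∧ s'.arr = s.arr ∧
      ∃ z, s'.reg 4 = litCode z ∧ Branching F z := by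
  classical
  have hex' : ∃ p : ℕ, p < w.length ∧ 2 ≤ s.arr 3 (s.arr 0 p) := by
    obtain ⟨x, hx, hxw⟩ := hex
    obtain ⟨p, hp, he⟩ := List.getElem_of_mem hxw
    refine ⟨p, hp, ?_⟩
    rw [h0, inputArr_natCast, List.getD_eq_getElem _ _ hp, he, hd]
    exact_mod_cast branching_iff_one_lt.1 hx
  obtain ⟨hlt, h2⟩ := Nat.find_spec hex'
  have hmin := fun i h => Nat.find_min hex' (m := i) h
  generalize Nat.find hex' = n at *
  simp only [startProg, Prog.block, wp_seq, wp_assign]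
  refine wp_loop_const n (fun i s' => s'.reg 0 = s.reg 0 ∧ s'.arr = s.arr ∧ s'.reg 1 = i) 4
    ?_ ?_ ?_ ?_
  · simp
  · rintro i s' hi ⟨h1, h2, h3⟩
    simp only [wp_assign, Expr.eval, Expr.cost, State.reg_setReg, State.arr_setReg, h1, h2, h3]
    refine ⟨?_, by norm_num, by simp, trivial, by simp⟩
    by_contra h
    exact hmin i hi ⟨by omega, by omega⟩
  · rintro s' ⟨h1, h2, h3⟩
    simp only [Expr.eval, h2, h3]
    omega
  · rintro t s' ⟨h1, h2', h3⟩ ht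
    simp only [Expr.eval, Expr.cost, State.reg_setReg, State.arr_setReg, h1, h2', h3] at ht ⊢
    refine ⟨by omega, by simp, trivial, ?_⟩
    have hmem : s.arr 0 n ∈ w := by
      rw [h0, inputArr_natCast, List.getD_eq_getElem _ _ hlt]
      exact List.getElem_mem hlt
    rcases hw _ hmem with h | ⟨x, hx⟩
    · rw [h, hd0] at h2
      omega
    · refine ⟨x, by simpa using hx, ?_⟩
      rw [hx, hd] at h2
      exact branching_iff_one_lt.2 (by exact_mod_cast h2)

namespace IsCycle

lemma litDegree_compl_eq_two (hc : IsCycle F L c) (hF : IsTwoMU F) {x : Lit ℕ+}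
    (h : Branching F x) : litDegree F x = 2 :=
  le_antisymm (hc.litDegree_le_two hF x) (branching_iff_one_lt.1 h)

lemma succ_zero (hc : IsCycle F L c) (hF : IsTwoMU F) {n : ℤ → ℤ} {nx : Lit ℕ+ → ℕ → Lit ℕ+}
    (hnx : IsSucc F n nx) {u v : Lit ℕ+} (h : Arc F u v) (hb : ¬ Branching F u.compl) :
    nx u 0 = v :=
  Arc.eq_of_not_branching hb
    (hnx.arc u 0 (hc.litDegree_pos hF (compl_mem_lits (mem_lits_of_arc h)))) h

/-- The cycle can be chosen so that it starts at a given branching literal and follows a given arc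
at the first branching point. -/
lemma exists_start (hc : IsCycle F L c) (hF : IsTwoMU F) (hk : 2 ≤ deficiency F) {n : ℤ → ℤ}
    {nx : Lit ℕ+ → ℕ → Lit ℕ+} (hnx : IsSucc F n nx) {z : Lit ℕ+} (hz : Branching F z) :
    ∃ c, IsCycle F L c ∧ c 0 = z ∧ ∀ h, 0 ≤ h → Branching F (c h).compl →
      (∀ t, 0 < t → t ≤ h → ¬ Branching F (c t)) → c (h + 1) = nx (c h) 0 := by
  obtain ⟨i, hi⟩ := hc.exists_of_branching hF hz
  replace hc := hc.shift i
  replace hi : (fun j => c (j + i)) 0 = z := by simpa using hi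
  generalize (fun j => c (j + i)) = c' at hc hi
  obtain ⟨o, ho, hob, hrun⟩ := hc.exists_run_right hF hk
    ((hc.branching_iff hF).1 (hi ▸ hz : Branching F (c' 0))).1
  -- the first branching point of a cycle that starts like `c'`
  have huniq : ∀ c, IsCycle F L c → (∀ t, 0 ≤ t → t ≤ o → c t = c' t) →
      ∀ h, 0 ≤ h → Branching F (c h).compl →
      (∀ t, 0 < t → t ≤ h → ¬ Branching F (c t)) → h = o := by
    intro c hc'' hcc h h1 h2 h3
    rcases lt_trichotomy h o with h4 | h4 | h4
    · rw [hcc h h1 h4.le] at h2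
      exact absurd (hrun h h1 h4) ((hc.branching_compl_iff hF).1 h2).2
    · exact h4
    · obtain ⟨b, h5, h6, h7⟩ := hc''.exists_branching_between hF hk
        ((hcc o ho le_rfl).symm ▸ hob) h4 ((hc''.branching_compl_iff hF).1 h2).1
      exact absurd h7 (h3 b (by omega) h6)
  have harc : Arc F (c' o) (nx (c' o) 0) := hnx.arc _ 0 (by
    rw [hc.litDegree_compl_eq_two hF hob]
    norm_num)
  -- The prescribed arc stays either on the given cycle or on a mirror image of it, which traverses
  -- the same initial run.
  rcases hc.arc_right hF harc with h | ⟨m, hm, h⟩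
  · refine ⟨c', hc, hi, fun h' h1 h2 h3 => ?_⟩
    rw [huniq c' hc (fun _ _ _ => rfl) h' h1 h2 h3, h]
  · have hcc : ∀ t, 0 ≤ t → t ≤ o → (c' (m + o - t)).compl = c' t := by
      intro t h1 h2
      obtain ⟨d, hd⟩ := Int.eq_ofNat_of_zero_le (show 0 ≤ o - t by omega)
      have := hc.hub_run hm d fun x h3 h4 => hrun x (by omega) h4
      rw [← hd, ← add_sub_assoc, sub_sub_cancel] at this
      rw [this, Lit.compl_compl]
    have hm' := hc.mirror (m + o)
    refine ⟨_, hm', (hcc 0 le_rfl ho).trans hi, fun h' h1 h2 h3 => ?_⟩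
    obtain rfl := huniq _ hm' hcc h' h1 h2 h3
    simp only [hcc h' h1 le_rfl, h]
    congr 2
    ring

/-- The literals that are visited in order to find out where the first arc at a branching point
leads: either on along the cycle or back. -/
lemma exists_peek (hc : IsCycle F L c) (hF : IsTwoMU F) (hk : 2 ≤ deficiency F) {n : ℤ → ℤ}
    {nx : Lit ℕ+ → ℕ → Lit ℕ+} (hnx : IsSucc F n nx) {b e : ℤ} (hbe : b ≤ e)
    (hb : Branching F (c b)) (hb' : ∀ t, b < t → t ≤ e → ¬ Branching F (c t))
    (he : Branching F (c e).compl) :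
    ∃ (K : ℕ) (y : ℕ → Lit ℕ+), K ≤ L ∧ y 0 = nx (c e) 0 ∧
      (∀ i < K, ¬ Branching F (y i) ∧ y i ∈ lits F ∧ nx (y i) 0 = y (i + 1)) ∧ Branching F (y K) ∧
      ((nx (c e) 0 = c (e + 1) ∧ ∃ b', e < b' ∧ y K = c b' ∧
          ∀ t, e < t → t < b' → ¬ Branching F (c t)) ∨
        nx (c e) 1 = c (e + 1) ∧ ∀ a, a < b → Branching F (c a) →
          (∀ t, a < t → t < b → ¬ Branching F (c t)) → y K = c a) := by
  have hdeg := hc.litDegree_compl_eq_two hF he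
  -- If arc 0 stays on the cycle, following it reaches the next branching literal; otherwise
  -- `back_arm` brings it to the one preceding b.
  rcases hc.arc_right hF (hnx.arc (c e) 0 (by omega)) with h | ⟨m, hm, h⟩
  · obtain ⟨b', h1, h2, h3, h4⟩ := hc.exists_branching_lt hF hk e
    refine ⟨(b' - e - 1).toNat, fun i => c (e + 1 + i), by omega, by simp [h], fun i hi => ?_, ?_,
      .inl ⟨h, b', h1, ?_, h4⟩⟩
    · refine ⟨h4 _ (by omega) (by omega), mem_lits_of_arc (hc.arc _), ?_⟩
      push_cast
      rw [← add_assoc]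
      refine hc.succ_zero hF hnx (hc.arc _) fun hbr => ?_
      obtain ⟨t, h5, h6, h7⟩ := hc.exists_branching_between hF hk he (by omega : e < e + 1 + i)
        ((hc.branching_compl_iff hF).1 hbr).1
      exact h4 t h5 (by omega) h7
    · beta_reduce
      rwa [show e + 1 + ((b' - e - 1).toNat : ℤ) = b' by omega]
    · beta_reduce
      rw [show e + 1 + ((b' - e - 1).toNat : ℤ) = b' by omega]
  · obtain ⟨a, h1, h2, h3⟩ := hc.exists_branching_le hF hk (b - 1)
    have hab : ∀ t, a < t → t < b → ¬ Branching F (c t) := fun t h4 h5 => h3 t h4 (by omega)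
    obtain ⟨r, hrm, hr, hnc⟩ := hc.back_arm hF hk (by omega) hbe h2 hb hab hb' he hm
    have hend : (c (m - 1 - ((m - 1 - r).toNat : ℤ))).compl = c a := by
      rw [show m - 1 - ((m - 1 - r).toNat : ℤ) = r by omega, hr, Lit.compl_compl]
    refine ⟨(m - 1 - r).toNat, fun i => (c (m - 1 - i)).compl, ?_, by simp [h], fun i hi => ?_, ?_,
      .inr ⟨?_, fun a' h4 h5 h6 => ?_⟩⟩
    -- A longer back arm would contain position r + L, which has a chord because c r = c̄ a.
    · have hmr : m ≤ r + L := by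
        by_contra hlt
        refine hnc (r + L) (by have := hc.L_pos; omega) (by omega) ⟨a, ?_⟩
        rw [hc.add_L, hr, Lit.compl_compl]
      omega
    · have hnc' := hnc (m - 1 - i) (by omega) (by omega)
      refine ⟨fun hbr => hnc' ((hc.branching_compl_iff hF).1 hbr).1,
        compl_mem_lits (mem_lits_of_arc (hc.arc _)), ?_⟩
      have harc := (hc.arc (m - 1 - i - 1)).mirror
      rw [sub_add_cancel] at harc
      push_cast
      rw [← sub_sub]
      refine hc.succ_zero hF hnx harc fun hbr => ?_
      rw [Lit.compl_compl] at hbr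
      exact hnc' ((hc.branching_iff hF).1 hbr).1
    · beta_reduce
      rwa [hend]
    · rcases hc.arc_right hF (hnx.arc (c e) 1 (by omega)) with h' | ⟨m', hm', h'⟩
      · exact h'
      · refine absurd ?_ (hnx.ne (c e) hdeg)
        rw [h, h', sub_eq_add_neg, sub_eq_add_neg, hc.shift_eq (hm.trans hm'.symm)]
    · beta_reduce
      rw [hend]
      congr 1
      rcases lt_trichotomy a a' with h | h | h
      · exact absurd h5 (hab a' h h4)
      · exact h
      · exact absurd h2 (h6 a h (by omega))

end IsCycle

/-- The registers that hold the latest branching literal of the walk and the one before. -/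
def IsTrail (F : Finset (Finset (Lit ℕ+))) (c : ℤ → Lit ℕ+) (e : ℕ) (cur prev : ℤ) : Prop :=
  (e = 0 ∧ cur = 0 ∧ prev = 0) ∨ ∃ b : ℤ, 0 ≤ b ∧ b < e ∧ Branching F (c b) ∧
    (∀ t, b < t → t < e → ¬ Branching F (c t)) ∧ cur = litCode (c b) ∧
    ((b = 0 ∧ prev = 0) ∨ ∃ a, 0 ≤ a ∧ a < b ∧ Branching F (c a) ∧
      (∀ t, a < t → t < b → ¬ Branching F (c t)) ∧ prev = litCode (c a))

/-- The configuration after `e` steps of the walk, at position `j` of the cycle. The parameters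
`n`, `I`, `D`, `N` are the contents of register `0` and of the arrays `0`, `3`, `4`. -/
structure WalkInv (F : Finset (Finset (Lit ℕ+))) (c : ℤ → Lit ℕ+) (n : ℤ) (I D N : ℤ → ℤ)
    (e j : ℕ) (s : State) : Prop where
  len : s.reg 0 = n
  pos : s.reg 2 = litCode (c j)
  start : s.reg 4 = litCode (c 0)
  index : s.reg 5 = 2 * e
  input : s.arr 0 = I
  deg : s.arr 3 = D
  nb : s.arr 4 = N
  seq : ∀ x : ℤ, 0 ≤ x → x < 2 * e → s.arr 7 x = litCode (interleave c x)
  halt : ∀ x, s.arr 6 x = if e ≠ 0 ∧ x = litCode (c 0) then 1 else 0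
  mark : ∀ x, x ≠ 0 → s.arr 5 x = if x = s.reg 7 then 1 else 0
  zero : ∀ a, 8 ≤ a → s.arr a = fun _ => 0
  trail : IsTrail F c e (s.reg 6) (s.reg 7)

/-- Records the current literal of the walk. -/
def recordProg : Prog := .block [
  .store 7 (.reg 5) (.reg 2),
  .store 7 (.add (.reg 5) (.const 1)) (.sub (.const 0) (.reg 2)),
  .store 6 (.reg 4) (.const 1),
  .assign 5 (.add (.reg 5) (.const 2)),
  .ite (.const 2) (.load 3 (.reg 2))
    (.block [
      .store 5 (.reg 7) (.const 0),
      .assign 7 (.reg 6),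
      .store 5 (.reg 7) (.const 1),
      .assign 6 (.reg 2)])
    .skip]

/-- Goes to the next literal of the walk. -/
def stepProg : Prog :=
  .ite (.load 3 (.sub (.const 0) (.reg 2))) (.const 1)
    (.assign 2 (.load 4 (.sub (.sub (.const 0) (.reg 2)) (.reg 2))))
    (.block [
      .assign 3 (.load 4 (.sub (.sub (.const 0) (.reg 2)) (.reg 2))),
      .loop (.load 3 (.reg 3)) (.const 1)
        (.assign 3 (.load 4 (.sub (.sub (.const 0) (.reg 3)) (.reg 3)))),
      .assign 2 (.load 4 (.add (.sub (.sub (.const 0) (.reg 2)) (.reg 2)) (.load 5 (.reg 3))))])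

/-- Computes the cycle. -/
def walkProg : Prog := .block [
  .assign 2 (.reg 4),
  .assign 5 (.const 0),
  .assign 6 (.const 0),
  .assign 7 (.const 0),
  .loop (.load 6 (.reg 2)) (.const 0) (.seq recordProg stepProg)]

variable {n : ℤ} {I D N : ℤ → ℤ}

lemma wp_recordProg (hD : ∀ x, D (litCode x) = litDegree F x) {e : ℕ} {s : State}
    (h : WalkInv F c n I D N e e s) (h0 : Branching F (c 0)) :
    wp recordProg s fun t s' => t ≤ 40 ∧ WalkInv F c n I D N (e + 1) e s' := by
  have hdeg := hD (c e)
  have hbr : Branching F (c e) ↔ 2 ≤ D (litCode (c e)) := by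
    rw [hD, branching_iff_one_lt]
    norm_cast
  have hseq : ∀ x : ℤ, 0 ≤ x → x < 2 * (e + 1 : ℕ) →
      Function.update (Function.update (s.arr 7) (2 * e) (litCode (c e))) (2 * e + 1)
        (-litCode (c e)) x = litCode (interleave c x) := by
    intro x h1 h2
    push_cast at h2
    simp only [Function.update_apply]
    split_ifs with h3 h4
    · rw [h3, interleave_two_mul_add_one, litCode_compl]
    · rw [h4, interleave_two_mul]
    · exact h.seq x h1 (by omega)
  have h_halt : ∀ x, Function.update (s.arr 6) (litCode (c 0)) 1 x =
      if e + 1 ≠ 0 ∧ x = litCode (c 0) then 1 else 0 := by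
    intro x
    simp only [Function.update_apply, ne_eq, Nat.add_eq_zero_iff, one_ne_zero, and_false,
      not_false_eq_true, true_and]
    split_ifs with h1
    · rfl
    · rw [h.halt, if_neg (fun h => h1 h.2)]
  simp only [recordProg, Prog.block, wp_seq, wp_assign, wp_store, wp_ite, wp_skip, Expr.eval,
    Expr.cost, State.reg_setReg, State.arr_setReg, State.reg_setArr, State.arr_setArr,
    Nat.reduceEqDiff, reduceIte, h.pos, h.start, h.index, h.deg, zero_sub]
  refine ⟨fun h2 => ⟨by norm_num, ?_⟩, fun h2 => ⟨by norm_num, ?_⟩⟩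
  · refine ⟨?_, ?_, ?_, ?_, ?_, ?_, ?_, ?_, ?_, ?_, fun a ha => ?_, ?_⟩ <;>
      simp only [State.reg_setReg, State.arr_setReg, State.reg_setArr, State.arr_setArr,
        Nat.reduceEqDiff, reduceIte, OfNat.zero_ne_ofNat, h.pos, h.start, h.index, h.deg, h.len,
        h.input, h.nb]
    · push_cast
      ring
    · exact hseq
    · exact h_halt
    · intro x hx
      simp only [Function.update_apply]
      split_ifs with h3 h4
      · rfl
      · rfl
      · rw [h.mark x hx, if_neg h4]
    · have h3 : a ≠ 7 := by omega
      have h4 : a ≠ 6 := by omega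
      have h5 : a ≠ 5 := by omega
      simp only [h3, h4, h5, if_false, h.zero a ha]
    · refine .inr ⟨e, by omega, by push_cast; omega, hbr.2 h2, fun t h3 h4 => ?_, rfl, ?_⟩
      · push_cast at h4
        omega
      -- The current branching literal becomes the previous one; at the start both registers hold 0.
      · rcases h.trail with ⟨rfl, h4, -⟩ | ⟨b, h3, h4, h5, h6, h7, -⟩
        · exact .inl ⟨rfl, h4⟩
        · exact .inr ⟨b, h3, h4, h5, h6, h7⟩
  · have hnb : ¬ Branching F (c e) := fun h' => h2 (hbr.1 h')
    refine ⟨?_, ?_, ?_, ?_, ?_, ?_, ?_, ?_, ?_, ?_, fun a ha => ?_, ?_⟩ <;>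
      simp only [State.reg_setReg, State.arr_setReg, State.reg_setArr, State.arr_setArr,
        Nat.reduceEqDiff, reduceIte, OfNat.zero_ne_ofNat, h.pos, h.start, h.index, h.deg, h.len,
        h.input, h.nb]
    · push_cast
      ring
    · exact hseq
    · exact h_halt
    · exact h.mark
    · have h3 : a ≠ 7 := by omega
      have h4 : a ≠ 6 := by omega
      simp only [h3, h4, if_false, h.zero a ha]
    · rcases h.trail with ⟨rfl, -, -⟩ | ⟨b, h3, h4, h5, h6, h7⟩
      · exact absurd h0 hnb
      · refine .inr ⟨b, h3, by push_cast; omega, h5, fun t h8 h9 => ?_, h7⟩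
        push_cast at h9
        rcases lt_or_ge t e with h10 | h10
        · exact h6 t h8 h10
        · obtain rfl : t = e := by omega
          exact hnb

-- A step costs O(1), except at a branching point, where the look ahead costs O(L). `hst` covers the
-- first branching point, where no earlier branching literal is available for comparison.
open Classical in
lemma wp_stepProg (hc : IsCycle F L c) (hF : IsTwoMU F) (hk : 2 ≤ deficiency F)
    (hD : ∀ x, D (litCode x) = litDegree F x) {nx : Lit ℕ+ → ℕ → Lit ℕ+} (hnx : IsSucc F N nx)
    (hst : ∀ h, 0 ≤ h → Branching F (c h).compl →
      (∀ t, 0 < t → t ≤ h → ¬ Branching F (c t)) → c (h + 1) = nx (c h) 0)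
    {e : ℕ} {s : State} (h : WalkInv F c n I D N (e + 1) e s) :
    wp stepProg s fun t s' =>
      t ≤ 30 + (if Branching F (c e).compl then 30 * (L + 1) else 0) ∧
      WalkInv F c n I D N (e + 1) (e + 1) s' := by
  have hpos := hc.litDegree_pos hF (compl_mem_lits (mem_lits_of_arc (hc.arc e)))
  have hdc : D (-litCode (c e)) = litDegree F (c e).compl := by rw [← hD, litCode_compl]
  have hfin : ∀ r v, v = litCode (c (e + 1)) →
      WalkInv F c n I D N (e + 1) (e + 1) ((s.setReg 3 r).setReg 2 v) := by
    rintro r v rfl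
    refine ⟨?_, ?_, ?_, ?_, h.input, h.deg, h.nb, h.seq, h.halt, h.mark, h.zero, ?_⟩ <;>
      simp only [State.reg_setReg, Nat.reduceEqDiff, reduceIte, OfNat.zero_ne_ofNat, h.len,
        h.start, h.index]
    · push_cast
      rfl
    · exact h.trail
  have hfin' : ∀ v, v = litCode (c (e + 1)) →
      WalkInv F c n I D N (e + 1) (e + 1) (s.setReg 2 v) := by
    intro v hv
    have := hfin (s.reg 3) v hv
    have hs : s.setReg 3 (s.reg 3) = s := by simp [State.setReg]
    rwa [hs] at this
  simp only [stepProg, Prog.block, wp_seq, wp_assign, wp_ite, Expr.eval, Expr.cost, zero_sub,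
    h.pos, h.deg, h.nb, hdc]
  refine ⟨fun h1 => ⟨by omega, hfin' _ ?_⟩, fun h1 => ?_⟩
  · have h2 := hnx.val (c e) 0 hpos
    rw [Nat.cast_zero, add_zero] at h2
    rw [h2, hc.succ_zero hF hnx (hc.arc e)]
    rw [branching_iff_one_lt]
    omega
  · have hbr : Branching F (c e).compl := by
      rw [branching_iff_one_lt]
      omega
    have hdeg := hc.litDegree_compl_eq_two hF hbr
    rw [if_pos hbr]
    rcases h.trail with ⟨h2, -⟩ | ⟨b, hb1, hb2, hb3, hb4, -, hprev⟩
    · omega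
    push_cast at hb2 hb4
    obtain ⟨K, y, hKL, hy0, hystep, hyK, hcase⟩ := hc.exists_peek hF hk hnx (by omega : b ≤ e) hb3
      (fun t h3 h4 => hb4 t h3 (by omega)) hbr
    have hv0 := hnx.val (c e) 0 (by omega)
    have hv1 := hnx.val (c e) 1 (by omega)
    rw [Nat.cast_zero, add_zero] at hv0
    rw [Nat.cast_one] at hv1
    refine wp_loop_const K (fun i s' => s' = s.setReg 3 (litCode (y i))) 8 ?_ ?_ ?_ ?_
    · rw [hv0, hy0]
    · rintro i s' hi rfl
      obtain ⟨h2, h3, h4⟩ := hystep i hi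
      have h5 := hnx.val (y i) 0 (hc.litDegree_pos hF (compl_mem_lits h3))
      rw [Nat.cast_zero, add_zero] at h5
      rw [branching_iff_one_lt] at h2
      simp only [wp_assign, Expr.eval, Expr.cost, State.reg_setReg, State.arr_setReg, reduceIte,
        h.deg, h.nb, hD, zero_sub, h5, h4]
      refine ⟨by omega, by norm_num, ?_⟩
      simp [State.setReg]
    · rintro s' rfl
      rw [branching_iff_one_lt] at hyK
      simp only [Expr.eval, State.reg_setReg, State.arr_setReg, reduceIte, h.deg, hD]
      omega
    · rintro t s' rfl ht
      simp only [Expr.cost, State.reg_setReg, State.arr_setReg, Nat.reduceEqDiff, reduceIte, h.pos,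
        h.nb] at ht ⊢
      refine ⟨?_, hfin _ _ ?_⟩
      · have : K * 12 ≤ L * 12 := by omega
        omega
      -- Array 5 holds 1 at the previous branching literal and 0 at other literals. Its entry at the
      -- literal found by looking ahead is thus the index of the arc to take.
      · rw [h.mark _ (litCode_ne_zero _)]
        rcases hprev with ⟨rfl, hp⟩ | ⟨a, ha1, ha2, ha3, ha4, hp⟩
        · rw [hp, if_neg (litCode_ne_zero _), add_zero, hv0,
            hst e (by omega) hbr fun t h2 h3 => hb4 t h2 (by omega)]
        · rcases hcase with ⟨h2, b', h3, h4, h5⟩ | ⟨h2, h3⟩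
          · rw [if_neg, add_zero, hv0, h2]
            rw [hp, litCode_inj, h4]
            intro heq
            obtain ⟨t, h6, h7, h8, h9, h10⟩ := hc.exists_third hF hk a b
            -- If the next branching literal were the previous one, a full turn would contain
            -- branching literals only at a and b.
            have hL : b' ≥ a + L := by
              by_contra hlt
              have := hc.eq_of_lt heq (by omega) (by have := hc.L_pos; omega)
              omega
            rcases lt_trichotomy t b with h11 | h11 | h11
            · exact ha4 t (by omega) h11 h8
            · exact h10 h11
            · rcases lt_or_ge (e : ℤ) t with h12 | h12
              · exact h5 t h12 (by omega) h8
              · exact hb4 t h11 (by omega) h8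
          · rw [if_pos, hv1, h2]
            rw [hp, h3 a ha2 ha3 ha4]

-- The bound keeps the branching points separate; there are at most 2k of them, which makes the walk
-- O(kL).
open Classical in
lemma wp_walkProg (hc : IsCycle F L c) (hF : IsTwoMU F) (hk : 2 ≤ deficiency F)
    (h0 : Branching F (c 0)) {nx : Lit ℕ+ → ℕ → Lit ℕ+} {s : State}
    (hD : ∀ x, s.arr 3 (litCode x) = litDegree F x) (hnx : IsSucc F (s.arr 4) nx)
    (hst : ∀ h, 0 ≤ h → Branching F (c h).compl →
      (∀ t, 0 < t → t ≤ h → ¬ Branching F (c t)) → c (h + 1) = nx (c h) 0)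
    (hz : s.reg 4 = litCode (c 0)) (hzero : ∀ a, 5 ≤ a → s.arr a = fun _ => 0) :
    wp walkProg s fun t s' =>
      t ≤ ∑ e ∈ Finset.range L,
        (80 + if Branching F (c e).compl then 30 * (L + 1) else 0) + 20 ∧
      s'.reg 0 = s.reg 0 ∧ s'.reg 5 = 2 * L ∧ s'.arr 0 = s.arr 0 ∧ s'.arr 3 = s.arr 3 ∧
      (∀ x : ℤ, 0 ≤ x → x < 2 * (L : ℤ) → s'.arr 7 x = litCode (interleave c x)) ∧
      ∀ a, 8 ≤ a → s'.arr a = fun _ => 0 := by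
  simp only [walkProg, Prog.block, wp_seq, wp_assign, Expr.eval]
  refine wp_loop L (fun e s' => WalkInv F c (s.reg 0) (s.arr 0) (s.arr 3) (s.arr 4) e e s')
    (fun e => 70 + if Branching F (c e).compl then 30 * (L + 1) else 0) ?_ ?_ ?_ ?_
  · refine ⟨?_, ?_, ?_, ?_, ?_, ?_, ?_, ?_, ?_, ?_, ?_, ?_⟩ <;>
      simp only [State.reg_setReg, State.arr_setReg, Nat.reduceEqDiff, reduceIte,
        OfNat.zero_ne_ofNat, hz, Nat.cast_zero, mul_zero]
    · intro x h1 h2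
      omega
    · simp [hzero 6 (by norm_num)]
    -- Cell 0 is exempt: register 7 starts at 0 although nothing is marked yet.
    · intro x hx
      simp [hzero 5 le_rfl, hx]
    · exact fun a ha => hzero a (by omega)
    · exact .inl ⟨rfl, rfl, rfl⟩
  · intro e s' he h
    refine ⟨?_, ?_⟩
    · simp only [Expr.eval, h.pos, h.halt]
      rw [if_neg]
      rintro ⟨h1, h2⟩
      rw [litCode_inj] at h2
      have := hc.eq_of_lt h2 (by omega) (by omega)
      omega
    · rw [wp_seq]
      refine (wp_recordProg hD h h0).mono fun t s'' h1 => ?_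
      refine (wp_stepProg hc hF hk hD hnx hst h1.2).mono fun t' s''' h2 => ?_
      refine ⟨?_, h2.2⟩
      have := h1.1
      have := h2.1
      omega
  -- After L steps the walk is back at the starting literal, which array 6 has marked since the
  -- first step.
  · intro s' h
    have hL := hc.pos
    have hcL := hc.add_L 0
    rw [zero_add] at hcL
    simp only [Expr.eval, h.pos, h.halt, hcL]
    rw [if_pos ⟨by omega, trivial⟩]
    norm_num
  · intro t s' h ht
    simp only [Expr.cost] at ht ⊢
    refine ⟨?_, h.len, h.index, h.input, h.deg, h.seq, h.zero⟩
    have hsum : ∑ e ∈ Finset.range L, (70 + (if Branching F (c e).compl then 30 * (L + 1) else 0) +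
        (1 + 1 + 1 + 1)) ≤ ∑ e ∈ Finset.range L,
        (80 + if Branching F (c e).compl then 30 * (L + 1) else 0) :=
      Finset.sum_le_sum fun e _ => by omega
    omega

end Walk


/-! ### Codes of automorphisms -/

section IsCode

variable {V : Type*} [DecidableEq V] {F : Finset (Finset (Lit V))} {L : ℕ} {c : ℤ → Lit V}

/-- `z` is the code of an automorphism. -/
def IsCode (F : Finset (Finset (Lit V))) (c : ℤ → Lit V) (z : ℤ) : Prop :=
  ∃ g : autGroup F, ∀ w, litMap (g : Equiv.Perm (lits F)) (interleave c w) = interleave c (act z w)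

namespace IsCycle

lemma dvd_act_sub (z w w' : ℤ) {d : ℤ} (h : d ∣ w - w') : d ∣ act z w - act z w' := by
  unfold act
  split_ifs
  · rwa [add_sub_add_left_eq_sub]
  · rwa [sub_sub_sub_cancel_left, dvd_sub_comm]

lemma dvd_act_sub' {z z' : ℤ} (w : ℤ) {d : ℤ} (h : 2 * d ∣ z - z') :
    2 * d ∣ act z w - act z' w := by
  have hp : z % 2 = z' % 2 := by
    obtain ⟨x, hx⟩ := h
    rw [mul_assoc] at hx
    omega
  have : act z w - act z' w = z - z' := by
    unfold act
    split_ifs <;> omega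
  rwa [this]

/-- The representative of a code. -/
lemma exists_residue (hc : IsCycle F L c) (z : ℤ) :
    ∃ z' : ℤ, 0 ≤ z' ∧ z' < 2 * L ∧ (2 * L : ℤ) ∣ z - z' := by
  have := hc.L_pos
  exact ⟨z % (2 * L), Int.emod_nonneg _ (by omega), Int.emod_lt_of_pos _ (by omega),
    Int.dvd_self_sub_emod⟩

lemma isCode_congr (hc : IsCycle F L c) {z z' : ℤ} (h : IsCode F c z) (hz : (2 * L : ℤ) ∣ z - z') :
    IsCode F c z' :=
  let ⟨g, hg⟩ := h
  ⟨g, fun w => (hg w).trans (hc.interleave_congr (dvd_act_sub' w hz))⟩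

omit [DecidableEq V] in
lemma interleave_compl (w : ℤ) :
    (interleave c w).compl = interleave c (if w % 2 = 0 then w + 1 else w - 1) := by
  obtain ⟨i, rfl | rfl⟩ : ∃ i, w = 2 * i ∨ w = 2 * i + 1 := ⟨w / 2, by omega⟩
  · rw [if_pos (by omega), interleave_two_mul, interleave_two_mul_add_one]
  · rw [if_neg (by omega), add_sub_cancel_right, interleave_two_mul, interleave_two_mul_add_one,
      Lit.compl_compl]

/-- A code that acts compatibly on the positions of every literal is the code of an
automorphism. -/
lemma isCode_of_compatible (hc : IsCycle F L c) (hF : IsTwoMU F) {z : ℤ}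
    (h : ∀ w w', 0 ≤ w → w < 2 * (L : ℤ) → 0 ≤ w' → w' < 2 * (L : ℤ) →
      interleave c w = interleave c w' →
      interleave c (act z w) = interleave c (act z w')) : IsCode F c z := by
  classical
  have hall : ∀ w w', interleave c w = interleave c w' →
      interleave c (act z w) = interleave c (act z w') := by
    intro w w' e
    obtain ⟨v, h1, h2, h3⟩ := hc.exists_residue w
    obtain ⟨v', h1', h2', h3'⟩ := hc.exists_residue w'
    rw [hc.interleave_congr (dvd_act_sub z w v h3), hc.interleave_congr (dvd_act_sub z w' v' h3')]
    refine h v v' h1 h2 h1' h2' ?_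
    rw [← hc.interleave_congr h3, ← hc.interleave_congr h3', e]
  have hpos : ∀ x : lits F, ∃ w, interleave c w = x := fun x =>
    (hc.mem_lits_iff_interleave hF).1 x.2
  have hmem : ∀ w, interleave c w ∈ lits F := fun w => (hc.mem_lits_iff_interleave hF).2 ⟨w, rfl⟩
  choose pos hpos using hpos
  -- The image is computed at an arbitrary position of the literal; compatibility makes the choice
  -- irrelevant.
  let g₀ : lits F → lits F := fun x => ⟨interleave c (act z (pos x)), hmem _⟩
  have hg₀ : ∀ w, g₀ ⟨interleave c w, hmem w⟩ = ⟨interleave c (act z w), hmem _⟩ := fun w =>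
    Subtype.ext (hall _ _ (hpos _))
  have hsurj : Function.Surjective g₀ := by
    rintro ⟨x, hx⟩
    obtain ⟨w, rfl⟩ := (hc.mem_lits_iff_interleave hF).1 hx
    -- Translations are undone by subtraction, while reflections are involutions.
    refine ⟨⟨interleave c (if z % 2 = 0 then w - z else z - w), hmem _⟩, ?_⟩
    rw [hg₀]
    refine Subtype.ext ?_
    simp only
    congr 1
    unfold act
    split_ifs <;> omega
  let g : Equiv.Perm (lits F) := Equiv.ofBijective g₀ ⟨Finite.injective_iff_surjective.2 hsurj, hsurj⟩
  have hg : ∀ w, litMap g (interleave c w) = interleave c (act z w) := fun w => by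
    rw [litMap_of_mem g (hmem w)]
    exact congrArg Subtype.val (hg₀ w)
  -- The clause of the arc at t goes to that at t + z/2, or for odd z to that at z/2 − t − 1, where
  -- the reflection interchanges the two ends of the arc.
  have hcl : ∀ t, (({(c t).compl, c (t + 1)} : Finset (Lit V)).image (litMap g)) =
      if z % 2 = 0 then {(c (t + z / 2)).compl, c (t + z / 2 + 1)}
      else {(c (z / 2 - t - 1)).compl, c (z / 2 - t - 1 + 1)} := by
    intro t
    rw [Finset.image_insert, Finset.image_singleton, ← interleave_two_mul_add_one (c := c) t,
      ← interleave_two_mul (c := c) (t + 1), hg, hg]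
    unfold act
    split_ifs with hz
    · rw [show z + (2 * t + 1) = 2 * (t + z / 2) + 1 by omega,
        show z + 2 * (t + 1) = 2 * (t + z / 2 + 1) by omega, interleave_two_mul,
        interleave_two_mul_add_one]
    · rw [show z - (2 * t + 1) = 2 * (z / 2 - t - 1 + 1) by omega,
        show z - 2 * (t + 1) = 2 * (z / 2 - t - 1) + 1 by omega, interleave_two_mul,
        interleave_two_mul_add_one, Finset.pair_comm]
  have hiso : IsIsomorphism F F g := by
    refine ⟨fun x => ?_, ?_⟩
    · obtain ⟨x, hx⟩ := x
      obtain ⟨w, rfl⟩ := (hc.mem_lits_iff_interleave hF).1 hx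
      refine Subtype.ext ?_
      have h1 := hg (if w % 2 = 0 then w + 1 else w - 1)
      have h2 := hg w
      rw [← interleave_compl, litMap_of_mem g (compl_mem_lits hx)] at h1
      rw [litMap_of_mem g hx] at h2
      refine h1.trans ?_
      change _ = Lit.compl _
      rw [h2, interleave_compl]
      congr 1
      unfold act
      split_ifs <;> omega
    · ext C
      rw [Finset.mem_image]
      constructor
      · rintro ⟨D, hD, rfl⟩
        rw [mapClause_eq_image g hD]
        obtain ⟨t, rfl⟩ := hc.covers hF hD
        rw [hcl]
        split_ifs
        exacts [hc.arc _, hc.arc _]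
      · intro hC
        obtain ⟨t, rfl⟩ := hc.covers hF hC
        refine ⟨_, hc.arc (if z % 2 = 0 then t - z / 2 else z / 2 - t - 1), ?_⟩
        rw [mapClause_eq_image g (hc.arc _), hcl]
        split_ifs
        · rw [sub_add_cancel]
        · rw [show z / 2 - (z / 2 - t - 1) - 1 = t by ring]
  exact ⟨⟨g, hiso⟩, hg⟩

/-- An automorphism with code z moves c 0 to the literal at position z. This is the test that leaves
at most 4k candidates. -/
lemma branching_of_isCode {z : ℤ} (h : IsCode F c z) (h0 : Branching F (c 0)) :
    Branching F (interleave c z) := by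
  obtain ⟨g, hg⟩ := h
  have h1 := hg 0
  have h2 : interleave c 0 = c 0 := by simpa using interleave_two_mul (c := c) 0
  rw [h2, show act z 0 = z by simp [act]] at h1
  rw [← h1]
  exact IsIsomorphism.branching g.2 h0

end IsCycle

end IsCode

/-! ### Enumerating the automorphisms -/

section Candidates

/-- The configurations differ at most in the registers `R` and the arrays `A`. -/
structure Frame (R A : List ℕ) (s s' : State) : Prop where
  reg : ∀ r, r ∉ R → s'.reg r = s.reg r
  arr : ∀ a, a ∉ A → s'.arr a = s.arr a

lemma Frame.refl (R A : List ℕ) (s : State) : Frame R A s s := ⟨fun _ _ => rfl, fun _ _ => rfl⟩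

lemma Frame.trans {R A R' A' : List ℕ} {s s' s'' : State} (h : Frame R A s s')
    (h' : Frame R' A' s' s'') : Frame (R ++ R') (A ++ A') s s'' :=
  ⟨fun r hr => by
    rw [List.mem_append, not_or] at hr
    rw [h'.reg r hr.2, h.reg r hr.1],
  fun a ha => by
    rw [List.mem_append, not_or] at ha
    rw [h'.arr a ha.2, h.arr a ha.1]⟩

lemma Frame.mono {R A R' A' : List ℕ} {s s' : State} (h : Frame R A s s') (hR : R ⊆ R')
    (hA : A ⊆ A') : Frame R' A' s s' :=
  ⟨fun r hr => h.reg r fun h => hr (hR h), fun a ha => h.arr a fun h => ha (hA h)⟩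

lemma Frame.setReg {R A : List ℕ} {s s' : State} (h : Frame R A s s') {r : ℕ} (hr : r ∈ R)
    (v : ℤ) : Frame R A s (s'.setReg r v) :=
  ⟨fun r' hr' => by
    rw [State.reg_setReg, if_neg, h.reg r' hr']
    rintro rfl
    exact hr' hr, h.arr⟩

lemma Frame.setArr {R A : List ℕ} {s s' : State} (h : Frame R A s s') {a : ℕ} (ha : a ∈ A)
    (i v : ℤ) : Frame R A s (s'.setArr a i v) :=
  ⟨h.reg, fun a' ha' => by
    rw [State.arr_setArr, if_neg, h.arr a' ha']
    rintro rfl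
    exact ha' ha⟩

variable {F : Finset (Finset (Lit ℕ+))} {L : ℕ} {c : ℤ → Lit ℕ+}

/-- Extends the sequence of literals periodically in both directions. -/
def copyProg : Prog := .block [
  .assign 10 (.const 0),
  .loop (.add (.reg 10) (.const 1)) (.reg 5) (.block [
    .store 7 (.add (.reg 10) (.reg 5)) (.load 7 (.reg 10)),
    .store 7 (.sub (.reg 10) (.reg 5)) (.load 7 (.reg 10)),
    .assign 10 (.add (.reg 10) (.const 1))])]

/-- For z and w in [0, 2L) the position `act z w` lies in [−2L, 4L). Three stored periods make
reduction modulo 2L unnecessary. -/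
lemma wp_copyProg (hc : IsCycle F L c) {s : State} (h5 : s.reg 5 = 2 * L)
    (h7 : ∀ x : ℤ, 0 ≤ x → x < 2 * (L : ℤ) → s.arr 7 x = litCode (interleave c x)) :
    wp copyProg s fun t s' => t ≤ 50 * L + 10 ∧ Frame [10] [7] s s' ∧
      ∀ x : ℤ, -(2 * (L : ℤ)) ≤ x → x < 4 * (L : ℤ) → s'.arr 7 x = litCode (interleave c x) := by
  simp only [copyProg, Prog.block, wp_seq, wp_assign, Expr.eval]
  refine wp_loop_const (2 * L) (fun j s' => Frame [10] [7] s s' ∧ s'.reg 10 = j ∧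
    ∀ x : ℤ, (-(2 * (L : ℤ)) ≤ x ∧ x < -(2 * (L : ℤ)) + j) ∨ (0 ≤ x ∧ x < 2 * (L : ℤ) + j) →
      s'.arr 7 x = litCode (interleave c x)) 20 ?_ ?_ ?_ ?_
  · refine ⟨(Frame.refl _ _ _).setReg (by simp) _, by simp, fun x hx => ?_⟩
    rw [State.arr_setReg]
    exact h7 x (by omega) (by omega)
  · rintro j s' hj ⟨hf, h10, hx⟩
    have h5' : s'.reg 5 = 2 * L := by rw [hf.reg 5 (by simp), h5]
    have hj' := hx j (.inr ⟨by omega, by omega⟩)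
    simp only [wp_seq, wp_assign, wp_store, Expr.eval, Expr.cost, State.reg_setReg,
      State.arr_setReg, State.reg_setArr, State.arr_setArr, reduceIte, h5', h10]
    refine ⟨by omega, by norm_num, ?_, by push_cast; ring, fun x hx' => ?_⟩
    · exact ((hf.setArr (by simp) _ _).setArr (by simp) _ _).setReg (by simp) _
    · have hne : (j : ℤ) ≠ j + 2 * L := by have := hc.L_pos; omega
      rw [Function.update_of_ne hne, hj']
      simp only [Function.update_apply]
      split_ifs with h1 h2
      · rw [h1]
        exact congrArg litCode (hc.interleave_congr ⟨1, by ring⟩)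
      · rw [h2]
        exact congrArg litCode (hc.interleave_congr ⟨-1, by ring⟩)
      · refine hx x ?_
        push_cast at hx'
        omega
  · rintro s' ⟨hf, h10, -⟩
    simp only [Expr.eval, h10, hf.reg 5 (by simp), h5]
    push_cast
    omega
  · rintro t s' ⟨hf, h10, hx⟩ ht
    simp only [Expr.cost] at ht ⊢
    refine ⟨by omega, hf, fun x h1 h2 => hx x ?_⟩
    push_cast
    omega

/-- The step from `act z w` to `act z (w + 1)`. -/
def codeSign (z : ℤ) : ℤ := if z % 2 = 0 then 1 else -1

/-- Positions can be followed by repeatedly adding the sign, so the machine needs no parity test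
inside its loops. -/
lemma act_succ (z w : ℤ) : act z w + codeSign z = act z (w + 1) := by
  unfold act codeSign
  split_ifs <;> omega

lemma act_zero (z : ℤ) : act z 0 = z := by
  simp [act]

lemma act_bounds {z w B : ℤ} (hz : 0 ≤ z) (hz' : z < 2 * B) (hw : 0 ≤ w) (hw' : w < 2 * B) :
    -(2 * B) ≤ act z w ∧ act z w < 4 * B := by
  unfold act
  split_ifs <;> omega

/-- The configuration before the candidate `z` is examined. -/
structure Examines (c : ℤ → Lit ℕ+) (L : ℕ) (z : ℤ) (s : State) : Prop where
  bound : s.reg 5 = 2 * L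
  seq : ∀ x : ℤ, -(2 * (L : ℤ)) ≤ x → x < 4 * (L : ℤ) → s.arr 7 x = litCode (interleave c x)
  code : s.reg 8 = z
  sign : s.reg 9 = codeSign z
  nonneg : 0 ≤ z
  lt : z < 2 * L

lemma Examines.frame {z : ℤ} {s s' : State} {R A : List ℕ} (h : Examines c L z s)
    (hf : Frame R A s s') (h5 : 5 ∉ R) (h8 : 8 ∉ R) (h9 : 9 ∉ R) (h7 : 7 ∉ A) :
    Examines c L z s' :=
  ⟨by rw [hf.reg 5 h5, h.bound], by rw [hf.arr 7 h7]; exact h.seq, by rw [hf.reg 8 h8, h.code],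
    by rw [hf.reg 9 h9, h.sign], h.nonneg, h.lt⟩

/-- Writes down the image of every literal under the code in register `8`. -/
def imageProg : Prog := .block [
  .assign 11 (.reg 8),
  .assign 10 (.const 0),
  .loop (.add (.reg 10) (.const 1)) (.reg 5) (.block [
    .store 8 (.load 7 (.reg 10)) (.load 7 (.reg 11)),
    .assign 11 (.add (.reg 11) (.reg 9)),
    .assign 10 (.add (.reg 10) (.const 1))])]

/-- A literal may have two positions in [0, 2L) and then is written twice. Only the last write
survives, so the stored image belongs to some position of the literal. -/
lemma wp_imageProg {z : ℤ} {s : State} (h : Examines c L z s) :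
    wp imageProg s fun t s' => t ≤ 50 * L + 10 ∧ Frame [10, 11] [8] s s' ∧
      s'.arr 8 0 = s.arr 8 0 ∧ ∀ w : ℤ, 0 ≤ w → w < 2 * (L : ℤ) →
        ∃ w', 0 ≤ w' ∧ w' < 2 * (L : ℤ) ∧ interleave c w' = interleave c w ∧
          s'.arr 8 (litCode (interleave c w)) = litCode (interleave c (act z w')) := by
  simp only [imageProg, Prog.block, wp_seq, wp_assign, Expr.eval]
  refine wp_loop_const (2 * L) (fun j s' => Frame [10, 11] [8] s s' ∧ s'.reg 10 = j ∧
    s'.reg 11 = act z j ∧ s'.arr 8 0 = s.arr 8 0 ∧ ∀ w : ℤ, 0 ≤ w → w < j →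
        ∃ w', 0 ≤ w' ∧ w' < 2 * (L : ℤ) ∧ interleave c w' = interleave c w ∧
          s'.arr 8 (litCode (interleave c w)) = litCode (interleave c (act z w'))) 20 ?_ ?_ ?_ ?_
  · refine ⟨((Frame.refl _ _ _).setReg (by simp) _).setReg (by simp) _, by simp, ?_, by simp,
      fun w h1 h2 => ?_⟩
    · simp [h.code, act_zero]
    · simp only [Nat.cast_zero] at h2
      omega
  · rintro j s' hj ⟨hf, h10, h11, h80, hx⟩
    have h' := h.frame hf (by simp) (by simp) (by simp) (by simp)
    have hb := act_bounds h.nonneg h.lt (w := j) (by omega) (by omega)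
    have e1 := h'.seq j (by omega) (by omega)
    have e2 := h'.seq (act z j) hb.1 hb.2
    simp only [wp_seq, wp_assign, wp_store, Expr.eval, Expr.cost, State.reg_setReg,
      State.arr_setReg, State.reg_setArr, State.arr_setArr, Nat.reduceEqDiff, reduceIte, h10, h11,
      h'.bound, h'.sign, e1, e2]
    refine ⟨by omega, by norm_num, ?_, by push_cast; ring, ?_, ?_, fun w h1 h2 => ?_⟩
    · exact ((hf.setArr (by simp) _ _).setReg (by simp) _).setReg (by simp) _
    · rw [act_succ]
      push_cast
      rfl
    · rw [Function.update_of_ne (litCode_ne_zero _).symm, h80]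
    · push_cast at h2
      simp only [Function.update_apply, litCode_inj]
      split_ifs with h3
      · exact ⟨j, by omega, by omega, h3.symm, rfl⟩
      · refine hx w h1 ?_
        rcases eq_or_ne w j with rfl | h4
        · exact absurd rfl h3
        · omega
  · rintro s' ⟨hf, h10, -⟩
    simp only [Expr.eval, h10, hf.reg 5 (by simp), h.bound]
    push_cast
    omega
  · rintro t s' ⟨hf, h10, h11, h80, hx⟩ ht
    simp only [Expr.cost] at ht ⊢
    exact ⟨by omega, hf, h80, fun w h1 h2 => hx w h1 (by push_cast; omega)⟩

/-- Checks whether the images written down by `imageProg` are compatible. -/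
def checkProg : Prog := .block [
  .assign 11 (.reg 8),
  .assign 10 (.const 0),
  .assign 12 (.const 1),
  .loop (.add (.reg 10) (.const 1)) (.reg 5) (.block [
    .ite (.load 8 (.load 7 (.reg 10))) (.load 7 (.reg 11))
      (.ite (.load 7 (.reg 11)) (.load 8 (.load 7 (.reg 10))) .skip (.assign 12 (.const 0)))
      (.assign 12 (.const 0)),
    .assign 11 (.add (.reg 11) (.reg 9)),
    .assign 10 (.add (.reg 10) (.const 1))])]

/-- The second pass compares the stored image with the image computed at every position, which
detects literals with conflicting images. -/
lemma wp_checkProg {z : ℤ} {s : State} (h : Examines c L z s) :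
    wp checkProg s fun t s' => t ≤ 60 * L + 15 ∧ Frame [10, 11, 12] [] s s' ∧
      (1 ≤ s'.reg 12 ↔ ∀ w : ℤ, 0 ≤ w → w < 2 * (L : ℤ) →
        s.arr 8 (litCode (interleave c w)) = litCode (interleave c (act z w))) := by
  simp only [checkProg, Prog.block, wp_seq, wp_assign, Expr.eval]
  refine wp_loop_const (2 * L) (fun j s' => Frame [10, 11, 12] [] s s' ∧ s'.reg 10 = j ∧
    s'.reg 11 = act z j ∧ (1 ≤ s'.reg 12 ↔ ∀ w : ℤ, 0 ≤ w → w < j →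
        s.arr 8 (litCode (interleave c w)) = litCode (interleave c (act z w)))) 25 ?_ ?_ ?_ ?_
  · refine ⟨(((Frame.refl _ _ _).setReg (by simp) _).setReg (by simp) _).setReg (by simp) _,
      by simp, ?_, ?_⟩
    · simp [h.code, act_zero]
    · simp only [State.reg_setReg, reduceIte, Nat.cast_zero, le_refl, true_iff]
      intro w h1 h2
      omega
  · rintro j s' hj ⟨hf, h10, h11, hx⟩
    have h' := h.frame hf (by simp) (by simp) (by simp) (by simp)
    have hb := act_bounds h.nonneg h.lt (w := j) (by omega) (by omega)
    have e1 := h'.seq j (by omega) (by omega)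
    have e2 := h'.seq (act z j) hb.1 hb.2
    have e3 := hf.arr 8 (by simp)
    have hstep : (∀ w : ℤ, 0 ≤ w → w < (j + 1 : ℕ) →
        s.arr 8 (litCode (interleave c w)) = litCode (interleave c (act z w))) ↔
        (∀ w : ℤ, 0 ≤ w → w < j →
          s.arr 8 (litCode (interleave c w)) = litCode (interleave c (act z w))) ∧
        s.arr 8 (litCode (interleave c j)) = litCode (interleave c (act z j)) := by
      constructor
      · exact fun h => ⟨fun w h1 h2 => h w h1 (by push_cast; omega),
          h j (by omega) (by push_cast; omega)⟩
      · rintro ⟨h1, h2⟩ w h3 h4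
        push_cast at h4
        rcases eq_or_ne w j with rfl | h5
        · exact h2
        · exact h1 w h3 (by omega)
    have hact : act z j + codeSign z = act z (j + 1 : ℕ) := by
      rw [act_succ]
      push_cast
      rfl
    simp only [wp_seq, wp_assign, wp_ite, wp_skip, Expr.eval, Expr.cost, State.reg_setReg,
      Nat.reduceEqDiff, reduceIte, h10, h11, h'.bound, h'.sign, e1, e2, e3,
      hstep, hact]
    refine ⟨by omega, fun h1 => ⟨fun h2 => ⟨by norm_num, ?_, by push_cast; ring, trivial, ?_⟩,
      fun h2 => ⟨by norm_num, ?_, by push_cast; ring, trivial, ?_⟩⟩,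
      fun h1 => ⟨by norm_num, ?_, by push_cast; ring, trivial, ?_⟩⟩
    · exact (hf.setReg (by simp) _).setReg (by simp) _
    · rw [hx]
      exact ⟨fun h => ⟨h, le_antisymm h1 h2⟩, fun h => h.1⟩
    · exact ((hf.setReg (by simp) _).setReg (by simp) _).setReg (by simp) _
    · exact ⟨fun h => by omega, fun h => by have := h.2; omega⟩
    · exact ((hf.setReg (by simp) _).setReg (by simp) _).setReg (by simp) _
    · exact ⟨fun h => by omega, fun h => by have := h.2; omega⟩
  · rintro s' ⟨hf, h10, -⟩
    simp only [Expr.eval, h10, hf.reg 5 (by simp), h.bound]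
    push_cast
    omega
  · rintro t s' ⟨hf, h10, h11, hx⟩ ht
    simp only [Expr.cost] at ht ⊢
    refine ⟨by omega, hf, ?_⟩
    rw [hx]
    push_cast
    rfl

/-- Writes down the image of the input. -/
def rowProg : Prog := .block [
  .assign 10 (.const 0),
  .loop (.add (.reg 10) (.const 1)) (.reg 0) (.block [
    .store 1 (.reg 14) (.load 8 (.load 0 (.reg 10))),
    .assign 14 (.add (.reg 14) (.const 1)),
    .assign 10 (.add (.reg 10) (.const 1))])]

lemma wp_rowProg {n : ℕ} {s : State} (h0 : s.reg 0 = n) :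
    wp rowProg s fun t s' => t ≤ 25 * n + 10 ∧ Frame [10, 14] [1] s s' ∧
      s'.reg 14 = s.reg 14 + n ∧ (∀ x < s.reg 14, s'.arr 1 x = s.arr 1 x) ∧
      ∀ p : ℕ, p < n → s'.arr 1 (s.reg 14 + p) = s.arr 8 (s.arr 0 p) := by
  simp only [rowProg, Prog.block, wp_seq, wp_assign, Expr.eval]
  refine wp_loop_const n (fun j s' => Frame [10, 14] [1] s s' ∧ s'.reg 10 = j ∧
    s'.reg 14 = s.reg 14 + j ∧ (∀ x < s.reg 14, s'.arr 1 x = s.arr 1 x) ∧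
      ∀ p : ℕ, p < j → s'.arr 1 (s.reg 14 + p) = s.arr 8 (s.arr 0 p)) 20 ?_ ?_ ?_ ?_
  · exact ⟨(Frame.refl _ _ _).setReg (by simp) _, by simp, by simp, by simp, by simp⟩
  · rintro j s' hj ⟨hf, h10, h14, hx, hp⟩
    simp only [wp_seq, wp_assign, wp_store, Expr.eval, Expr.cost, State.reg_setReg,
      State.arr_setReg, State.reg_setArr, State.arr_setArr, Nat.reduceEqDiff, reduceIte, h10, h14,
      hf.reg 0 (by simp), h0, hf.arr 8 (by simp), hf.arr 0 (by simp)]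
    refine ⟨by omega, by norm_num, ?_, by push_cast; ring, by push_cast; ring, fun x h1 => ?_,
      fun p h1 => ?_⟩
    · exact ((hf.setArr (by simp) _ _).setReg (by simp) _).setReg (by simp) _
    · rw [Function.update_of_ne (by omega), hx x h1]
    · rcases eq_or_ne p j with rfl | h2
      · rw [Function.update_self]
      · rw [Function.update_of_ne (by omega), hp p (by omega)]
  · rintro s' ⟨hf, h10, -⟩
    simp only [Expr.eval, h10, hf.reg 0 (by simp), h0]
    omega
  · rintro t s' ⟨hf, h10, h14, hx, hp⟩ ht
    simp only [Expr.cost] at ht ⊢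
    exact ⟨by omega, hf, h14, hx, hp⟩

end Candidates


/-! ### Testing candidate codes and recording the automorphisms. -/

section Enumeration

variable {F : Finset (Finset (Lit ℕ+))} {L : ℕ} {c : ℤ → Lit ℕ+}

/-- If all positions agree with the stored images, `isCode_of_compatible` applies; conversely, an
automorphism gives the same image at all positions of a literal. -/
lemma IsCycle.isCode_iff (hc : IsCycle F L c) (hF : IsTwoMU F) {z : ℤ} {a : ℤ → ℤ}
    (h : ∀ w : ℤ, 0 ≤ w → w < 2 * (L : ℤ) → ∃ w', 0 ≤ w' ∧ w' < 2 * (L : ℤ) ∧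
      interleave c w' = interleave c w ∧
      a (litCode (interleave c w)) = litCode (interleave c (act z w'))) :
    (∀ w : ℤ, 0 ≤ w → w < 2 * (L : ℤ) →
      a (litCode (interleave c w)) = litCode (interleave c (act z w))) ↔ IsCode F c z := by
  constructor
  · intro h'
    refine hc.isCode_of_compatible hF fun w w' h1 h2 h3 h4 e => ?_
    rw [← litCode_inj, ← h' w h1 h2, ← h' w' h3 h4, e]
  · rintro ⟨g, hg⟩ w h1 h2
    obtain ⟨w', -, -, h3, h4⟩ := h w h1 h2
    rw [h4, ← hg, ← hg, h3]

lemma IsCycle.forall_image (hc : IsCycle F L c) {z : ℤ} {a : ℤ → ℤ}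
    (h : ∀ w : ℤ, 0 ≤ w → w < 2 * (L : ℤ) →
      a (litCode (interleave c w)) = litCode (interleave c (act z w))) (w : ℤ) :
    a (litCode (interleave c w)) = litCode (interleave c (act z w)) := by
  obtain ⟨v, h1, h2, h3⟩ := hc.exists_residue w
  rw [hc.interleave_congr h3, h v h1 h2, hc.interleave_congr (dvd_act_sub z w v h3)]

/-- The `N` automorphisms with codes in `0, …, i - 1` have been written down, for an input
array `I` with `n` entries. -/
structure Enumerated (F : Finset (Finset (Lit ℕ+))) (c : ℤ → Lit ℕ+) (L n : ℕ) (I : ℤ → ℤ) (i : ℤ)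
    (N : ℕ) (s : State) : Prop where
  count : s.reg 13 = N
  pos : s.reg 14 = (N * n : ℕ)
  code : ∀ l < N, 0 ≤ s.arr 10 l ∧ s.arr 10 l < i ∧ IsCode F c (s.arr 10 l)
  sign : ∀ l < N, s.arr 11 l = codeSign (s.arr 10 l)
  index : ∀ l < N, s.arr 9 (s.arr 10 l) = l ∧ s.arr 9 (s.arr 10 l - 2 * L) = l ∧
    s.arr 9 (s.arr 10 l + 2 * L) = l
  complete : ∀ z, 0 ≤ z → z < i → IsCode F c z → ∃ l < N, s.arr 10 l = z
  rows : ∀ l < N, ∀ p < n, (I p = 0 → s.arr 1 (l * n + p : ℕ) = 0) ∧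
    ∀ w, I p = litCode (interleave c w) →
      s.arr 1 (l * n + p : ℕ) = litCode (interleave c (act (s.arr 10 l) w))

lemma Enumerated.frame {n N : ℕ} {I : ℤ → ℤ} {i : ℤ} {s s' : State} {R A : List ℕ}
    (h : Enumerated F c L n I i N s) (hf : Frame R A s s') (h13 : 13 ∉ R) (h14 : 14 ∉ R)
    (h1 : 1 ∉ A) (h9 : 9 ∉ A) (h10 : 10 ∉ A) (h11 : 11 ∉ A) : Enumerated F c L n I i N s' := by
  refine ⟨?_, ?_, ?_, ?_, ?_, ?_, ?_⟩ <;>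
    simp only [hf.reg _ h13, hf.reg _ h14, hf.arr _ h1, hf.arr _ h9, hf.arr _ h10, hf.arr _ h11]
  exacts [h.count, h.pos, h.code, h.sign, h.index, h.complete, h.rows]

lemma Enumerated.skip {n N : ℕ} {I : ℤ → ℤ} {i : ℤ} {s : State}
    (h : Enumerated F c L n I i N s) (hi : ¬ IsCode F c i) : Enumerated F c L n I (i + 1) N s := by
  refine ⟨h.count, h.pos, fun l hl => ?_, h.sign, h.index, fun z h1 h2 h3 => ?_, h.rows⟩
  · obtain ⟨h1, h2, h3⟩ := h.code l hl
    exact ⟨h1, by omega, h3⟩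
  · refine h.complete z h1 ?_ h3
    have : z ≠ i := fun e => hi (e ▸ h3)
    omega

/-- Writes down the automorphism whose code is in register `8`. -/
def recordAutProg : Prog := .block [
  .store 10 (.reg 13) (.reg 8),
  .store 11 (.reg 13) (.reg 9),
  .store 9 (.reg 8) (.reg 13),
  .store 9 (.sub (.reg 8) (.reg 5)) (.reg 13),
  .store 9 (.add (.reg 8) (.reg 5)) (.reg 13),
  .assign 13 (.add (.reg 13) (.const 1)),
  rowProg]

lemma wp_recordAutProg {n N : ℕ} {I : ℤ → ℤ} {i : ℤ} {s : State} (h : Examines c L i s)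
    (hE : Enumerated F c L n I i N s) (h0 : s.reg 0 = n) (hI : s.arr 0 = I) (hi : IsCode F c i)
    (h80 : s.arr 8 0 = 0)
    (h8 : ∀ w, s.arr 8 (litCode (interleave c w)) = litCode (interleave c (act i w))) :
    wp recordAutProg s fun t s' => t ≤ 25 * n + 50 ∧ Frame [10, 13, 14] [1, 9, 10, 11] s s' ∧
      Enumerated F c L n I (i + 1) (N + 1) s' := by
  have hn := h.nonneg
  have hlt := h.lt
  simp only [recordAutProg, Prog.block, wp_seq, wp_assign, wp_store, Expr.eval, Expr.cost,
    State.reg_setArr, h.bound, h.code, h.sign, hE.count]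
  refine (wp_rowProg (n := n) (by simp [h0])).mono ?_
  rintro t s' ⟨ht, hf, h14, hold, hnew⟩
  simp only [State.reg_setArr, State.arr_setArr, State.reg_setReg, State.arr_setReg, reduceIte,
    Nat.reduceEqDiff, OfNat.zero_ne_ofNat, OfNat.one_ne_ofNat, hE.pos, hI] at h14 hold hnew
  have hf' : Frame [10, 13, 14] [1, 9, 10, 11] s s' :=
    ⟨fun r hr => by
      simp only [List.mem_cons, List.not_mem_nil, or_false, not_or] at hr
      rw [hf.reg r (by simp [hr])]
      simp [hr],
    fun a ha => by
      simp only [List.mem_cons, List.not_mem_nil, or_false, not_or] at ha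
      rw [hf.arr a (by simp [ha])]
      simp [ha]⟩
  have a10 : s'.arr 10 = Function.update (s.arr 10) N i := by
    rw [hf.arr 10 (by simp)]
    simp
  have a11 : s'.arr 11 = Function.update (s.arr 11) N (codeSign i) := by
    rw [hf.arr 11 (by simp)]
    simp
  have a9 : s'.arr 9 = Function.update (Function.update (Function.update (s.arr 9) i N)
      (i - 2 * L) N) (i + 2 * L) N := by
    rw [hf.arr 9 (by simp)]
    simp
  have r13 : s'.reg 13 = N + 1 := by
    rw [hf.reg 13 (by simp)]
    simp
  have hcell : ∀ l < N, Function.update (s.arr 10) N i l = s.arr 10 l := fun l hl =>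
    Function.update_of_ne (by omega) _ _
  have hlast : ∀ l < N + 1, l < N ∨ l = N := fun l hl => by omega
  refine ⟨by omega, hf', ?_⟩
  refine ⟨by rw [r13]; push_cast; rfl, by rw [h14]; push_cast; ring, ?_, ?_, ?_, ?_, ?_⟩
  · intro l hl
    rw [a10]
    rcases hlast l hl with hl | rfl
    · rw [hcell l hl]
      obtain ⟨h1, h2, h3⟩ := hE.code l hl
      exact ⟨h1, by omega, h3⟩
    · rw [Function.update_self]
      exact ⟨hn, by omega, hi⟩
  · intro l hl
    rw [a10, a11]
    rcases hlast l hl with hl | rfl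
    · rw [hcell l hl, Function.update_of_ne (by omega), hE.sign l hl]
    · rw [Function.update_self, Function.update_self]
  · intro l hl
    rw [a10, a9]
    rcases hlast l hl with hl | rfl
    · rw [hcell l hl]
      obtain ⟨h1, h2, -⟩ := hE.code l hl
      obtain ⟨h3, h4, h5⟩ := hE.index l hl
      -- Recorded codes lie in [0, i) and i < 2L, so the cells i and i ± 2L overwrite none of the
      -- earlier entries.
      refine ⟨?_, ?_, ?_⟩ <;>
        rw [Function.update_of_ne (by omega), Function.update_of_ne (by omega),
          Function.update_of_ne (by omega)] <;>
        assumption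
    · rw [Function.update_self]
      refine ⟨?_, ?_, Function.update_self ..⟩
      · rw [Function.update_of_ne (by omega), Function.update_of_ne (by omega),
          Function.update_self]
      · rw [Function.update_of_ne (by omega), Function.update_self]
  · intro z h1 h2 h3
    rw [a10]
    rcases eq_or_ne z i with rfl | h4
    · exact ⟨N, by omega, Function.update_self ..⟩
    · obtain ⟨l, hl, h5⟩ := hE.complete z h1 (by omega) h3
      exact ⟨l, by omega, by rw [hcell l hl, h5]⟩
  · intro l hl p hp
    rw [a10]
    rcases hlast l hl with hl | rfl
    · have : l * n + p < N * n := by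
        have := Nat.mul_le_mul_right n (Nat.succ_le_of_lt hl)
        rw [Nat.succ_mul] at this
        omega
      rw [hcell l hl, hold _ (by exact_mod_cast this)]
      exact hE.rows l hl p hp
    · rw [Function.update_self, Nat.cast_add, hnew p hp]
      exact ⟨fun h => by rw [h, h80], fun w h => by rw [h, h8]⟩

/-- Examines the code in register `8`. -/
def candidateProg : Prog :=
  .ite (.const 2) (.load 3 (.load 7 (.reg 8)))
    (.seq imageProg (.seq checkProg (.ite (.const 1) (.reg 12) recordAutProg .skip))) .skip

-- A candidate failing the branching test costs O(1); the linear cost is paid only by the others.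
open Classical in
lemma wp_candidateProg (hc : IsCycle F L c) (hF : IsTwoMU F) (h0 : Branching F (c 0)) {n N : ℕ}
    {I : ℤ → ℤ} {i : ℤ} {s : State} (h : Examines c L i s) (hE : Enumerated F c L n I i N s)
    (hn : s.reg 0 = n) (hI : s.arr 0 = I) (hD : ∀ x, s.arr 3 (litCode x) = litDegree F x)
    (h80 : s.arr 8 0 = 0) :
    wp candidateProg s fun t s' =>
      t ≤ 10 + (if Branching F (interleave c i) then 110 * L + 25 * n + 80 else 0) ∧
      Frame [10, 11, 12, 13, 14] [1, 8, 9, 10, 11] s s' ∧ s'.arr 8 0 = 0 ∧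
      ∃ N', Enumerated F c L n I (i + 1) N' s' := by
  have hlt := h.lt
  have hnn := h.nonneg
  have hbr : Branching F (interleave c i) ↔ (2 : ℤ) ≤ s.arr 3 (s.arr 7 i) := by
    rw [h.seq i (by omega) (by omega), hD, branching_iff_one_lt]
    norm_cast
  simp only [candidateProg, wp_ite, wp_seq, wp_skip, Expr.eval, Expr.cost, h.code]
  refine ⟨fun h2 => ?_, fun h2 => ?_⟩
  · refine (wp_imageProg h).mono ?_
    rintro t s1 ⟨ht, hf1, h81, him⟩
    have h1 := h.frame hf1 (by simp) (by simp) (by simp) (by simp)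
    have hE1 := hE.frame hf1 (by simp) (by simp) (by simp) (by simp) (by simp) (by simp)
    refine (wp_checkProg h1).mono ?_
    rintro t' s2 ⟨ht', hf2, hok⟩
    have hs2 := h1.frame hf2 (by simp) (by simp) (by simp) (by simp)
    have hE2 := hE1.frame hf2 (by simp) (by simp) (by simp) (by simp) (by simp) (by simp)
    have hf12 := hf1.trans hf2
    rw [if_pos (hbr.2 h2)]
    refine ⟨fun h3 => ?_, fun h3 => ⟨by omega, hf12.mono (by simp) (by simp), ?_, N, hE2.skip ?_⟩⟩
    · have h4 := hok.1 h3
      refine (wp_recordAutProg hs2 hE2 (n := n) ?_ ?_ ?_ ?_ ?_).mono ?_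
      · rw [hf12.reg 0 (by simp), hn]
      · rw [hf12.arr 0 (by simp), hI]
      · exact (hc.isCode_iff hF him).1 h4
      · rw [hf2.arr 8 (by simp), h81, h80]
      · rw [hf2.arr 8 (by simp)]
        exact hc.forall_image h4
      · rintro t'' s3 ⟨ht'', hf3, hE3⟩
        refine ⟨by omega, (hf12.trans hf3).mono (by simp) (by simp), ?_, N + 1, hE3⟩
        rw [hf3.arr 8 (by simp), hf2.arr 8 (by simp), h81, h80]
    · rw [hf2.arr 8 (by simp), h81, h80]
    · rwa [hok, hc.isCode_iff hF him] at h3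
  · refine ⟨by omega, Frame.refl _ _ _, h80, N, hE.skip fun h3 => h2 (hbr.1 ?_)⟩
    exact IsCycle.branching_of_isCode h3 h0

/-- Writes down all automorphisms. -/
def enumerateProg : Prog := .block [
  .assign 8 (.const 0),
  .assign 9 (.const 1),
  .assign 13 (.const 0),
  .assign 14 (.const 0),
  .loop (.add (.reg 8) (.const 1)) (.reg 5) (.block [
    candidateProg,
    .assign 8 (.add (.reg 8) (.const 1)),
    .assign 9 (.sub (.const 0) (.reg 9))])]

lemma codeSign_succ (z : ℤ) : codeSign (z + 1) = -codeSign z := by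
  unfold codeSign
  split_ifs <;> omega

open Classical in
lemma wp_enumerateProg (hc : IsCycle F L c) (hF : IsTwoMU F) (h0 : Branching F (c 0)) {n : ℕ}
    {I : ℤ → ℤ} {s : State} (hn : s.reg 0 = n) (hI : s.arr 0 = I)
    (hD : ∀ x, s.arr 3 (litCode x) = litDegree F x) (h80 : s.arr 8 0 = 0)
    (h5 : s.reg 5 = 2 * L)
    (h7 : ∀ x : ℤ, -(2 * (L : ℤ)) ≤ x → x < 4 * (L : ℤ) → s.arr 7 x = litCode (interleave c x)) :
    wp enumerateProg s fun t s' =>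
      t ≤ ∑ i ∈ Finset.range (2 * L),
        (30 + if Branching F (interleave c i) then 110 * L + 25 * n + 80 else 0) + 20 ∧
      ∃ N, Enumerated F c L n I (2 * L) N s' := by
  simp only [enumerateProg, Prog.block, wp_seq, wp_assign, Expr.eval]
  refine wp_loop (2 * L) (fun i s' => Frame [8, 9, 10, 11, 12, 13, 14] [1, 8, 9, 10, 11] s s' ∧
    s'.reg 8 = i ∧ s'.reg 9 = codeSign i ∧ s'.arr 8 0 = 0 ∧ ∃ N, Enumerated F c L n I i N s')
    (fun i => 20 + if Branching F (interleave c i) then 110 * L + 25 * n + 80 else 0) ?_ ?_ ?_ ?_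
  · refine ⟨?_, by simp, by simp [codeSign], by simp [h80], 0, ?_⟩
    · exact ((((Frame.refl _ _ _).setReg (by simp) _).setReg (by simp) _).setReg
        (by simp) _).setReg (by simp) _
    · refine ⟨by simp, by simp, by simp, by simp, by simp, fun z h1 h2 => ?_, by simp⟩
      simp only [Nat.cast_zero] at h2
      omega
  · rintro i s' hi ⟨hf, h8, h9, h80', N, hE⟩
    have hx : Examines c L i s' :=
      ⟨by rw [hf.reg 5 (by simp), h5], by rw [hf.arr 7 (by simp)]; exact h7, h8, h9, by omega,
        by omega⟩
    simp only [Expr.eval, h8, hx.bound, wp_seq]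
    refine ⟨by omega, (wp_candidateProg hc hF h0 hx hE ?_ ?_ ?_ h80').mono ?_⟩
    · rw [hf.reg 0 (by simp), hn]
    · rw [hf.arr 0 (by simp), hI]
    · rw [hf.arr 3 (by simp)]
      exact hD
    · rintro t s'' ⟨ht, hf', h80'', N', hE'⟩
      have hf2 : Frame [8, 9, 10, 11, 12, 13, 14] [1, 8, 9, 10, 11] s s'' :=
        (hf.trans hf').mono (by simp) (by simp)
      simp only [wp_assign, Expr.eval, Expr.cost, State.reg_setReg, State.arr_setReg,
        Nat.reduceEqDiff, reduceIte, hf'.reg 8 (by simp), h8, hf'.reg 9 (by simp), h9, zero_sub]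
      refine ⟨by omega, (hf2.setReg (by simp) _).setReg (by simp) _, by push_cast; rfl, ?_, h80'',
        N', ?_⟩
      · push_cast
        rw [codeSign_succ]
      · have hf3 : Frame [8, 9] [] s'' ((s''.setReg 8 (i + 1)).setReg 9 (-codeSign i)) :=
          ((Frame.refl _ _ _).setReg (by simp) _).setReg (by simp) _
        push_cast
        exact hE'.frame hf3 (by simp) (by simp) (by simp) (by simp) (by simp) (by simp)
  · rintro s' ⟨hf, h8, -⟩
    simp only [Expr.eval, h8, hf.reg 5 (by simp), h5]
    push_cast
    omega
  · rintro t s' ⟨hf, h8, -, -, N, hE⟩ ht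
    simp only [Expr.cost] at ht ⊢
    refine ⟨?_, N, by exact_mod_cast hE⟩
    have : ∀ i : ℕ, 20 + (if Branching F (interleave c i) then 110 * L + 25 * n + 80 else 0) +
        (1 + 1 + 1 + 1 + 1) ≤
        30 + if Branching F (interleave c i) then 110 * L + 25 * n + 80 else 0 := fun i => by omega
    have := Finset.sum_le_sum fun i (_ : i ∈ Finset.range (2 * L)) => this i
    omega

end Enumeration

/-! ### The multiplication table -/

section Table

/-- Writes down the multiplication table. -/
def tableProg : Prog := .block [
  .assign 15 (.const 0),
  .assign 17 (.const 0),
  .loop (.add (.reg 15) (.const 1)) (.reg 13) (.block [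
    .assign 16 (.const 0),
    .loop (.add (.reg 16) (.const 1)) (.reg 13) (.block [
      .ite (.const 0) (.load 11 (.reg 15))
        (.store 2 (.reg 17) (.load 9 (.add (.load 10 (.reg 15)) (.load 10 (.reg 16)))))
        (.store 2 (.reg 17) (.load 9 (.sub (.load 10 (.reg 15)) (.load 10 (.reg 16))))),
      .assign 17 (.add (.reg 17) (.const 1)),
      .assign 16 (.add (.reg 16) (.const 1))]),
    .assign 15 (.add (.reg 15) (.const 1))]),
  .assign 0 (.reg 13)]

/-- The entries of the multiplication table. -/
def tableEntry (s : State) (a b : ℕ) : ℤ :=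
  if 0 ≤ s.arr 11 a then s.arr 9 (s.arr 10 a + s.arr 10 b) else s.arr 9 (s.arr 10 a - s.arr 10 b)

lemma wp_tableProg {N : ℕ} {s : State} (h13 : s.reg 13 = N) :
    wp tableProg s fun t s' => t ≤ N * (35 * N + 25) + 20 ∧ Frame [0, 15, 16, 17] [2] s s' ∧
      s'.reg 0 = N ∧ ∀ a < N, ∀ b < N, s'.arr 2 (a * N + b : ℕ) = tableEntry s a b := by
  simp only [tableProg, Prog.block, wp_seq, wp_assign, Expr.eval]
  refine wp_loop_const N (fun i s' => Frame [0, 15, 16, 17] [2] s s' ∧ s'.reg 15 = i ∧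
    s'.reg 17 = (i * N : ℕ) ∧ ∀ a < i, ∀ b < N, s'.arr 2 (a * N + b : ℕ) = tableEntry s a b)
    (35 * N + 20) ?_ ?_ ?_ ?_
  · exact ⟨((Frame.refl _ _ _).setReg (by simp) _).setReg (by simp) _, by simp, by simp, by simp⟩
  · rintro i s1 hi ⟨hf1, h15, h17, htab⟩
    simp only [wp_seq, wp_assign, Expr.eval, h15, hf1.reg 13 (by simp), h13]
    refine ⟨by omega, wp_loop_const N (fun j s' => Frame [0, 15, 16, 17] [2] s s' ∧
      s'.reg 15 = i ∧ s'.reg 16 = j ∧ s'.reg 17 = (i * N + j : ℕ) ∧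
      ∀ a, ∀ b < N, a < i ∨ a = i ∧ b < j → s'.arr 2 (a * N + b : ℕ) = tableEntry s a b)
      25 ?_ ?_ ?_ ?_⟩
    · refine ⟨hf1.setReg (by simp) _, by simp [h15], by simp, by simp [h17], ?_⟩
      rintro a b hb (h | ⟨-, h⟩)
      · exact htab a h b hb
      · omega
    · rintro j s' hj ⟨hf, h15, h16, h17, htab⟩
      have hnew : ∀ v, v = tableEntry s i j → ∀ a, ∀ b < N, a < i ∨ a = i ∧ b < j + 1 →
          Function.update (s'.arr 2) ((i * N + j : ℕ) : ℤ) v (a * N + b : ℕ) =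
            tableEntry s a b := by
        rintro v rfl a b hb h
        by_cases h' : a = i ∧ b = j
        · obtain ⟨rfl, rfl⟩ := h'
          rw [Function.update_self]
        · have h'' : a < i ∨ a = i ∧ b < j := by omega
          rw [Function.update_of_ne, htab a b hb h'']
          have : a * N + b < i * N + j := by
            rcases h'' with h | ⟨rfl, h⟩
            · have := Nat.mul_le_mul_right N (Nat.succ_le_of_lt h)
              rw [Nat.succ_mul] at this
              omega
            · omega
          exact_mod_cast this.ne
      have e9 := hf.arr 9 (by simp)
      have e10 := hf.arr 10 (by simp)
      have e11 := hf.arr 11 (by simp)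
      simp only [wp_seq, wp_assign, wp_store, wp_ite, Expr.eval, Expr.cost, State.reg_setReg,
        State.arr_setReg, State.reg_setArr, State.arr_setArr, Nat.reduceEqDiff, reduceIte, h15, h16,
        h17, hf.reg 13 (by simp), h13, e9, e10, e11]
      refine ⟨by omega, fun h => ⟨by norm_num, ?_, trivial, by push_cast; ring, by push_cast; ring,
        hnew _ ?_⟩, fun h => ⟨by norm_num, ?_, trivial, by push_cast; ring, by push_cast; ring,
        hnew _ ?_⟩⟩
      · exact ((hf.setArr (by simp) _ _).setReg (by simp) _).setReg (by simp) _
      · rw [tableEntry, if_pos h]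
      · exact ((hf.setArr (by simp) _ _).setReg (by simp) _).setReg (by simp) _
      · rw [tableEntry, if_neg h]
    · rintro s' ⟨hf, -, h16, -⟩
      simp only [Expr.eval, h16, hf.reg 13 (by simp), h13]
      omega
    · rintro t s' ⟨hf, h15, h16, h17, htab⟩ ht
      simp only [Expr.cost, State.reg_setReg, State.arr_setReg, Nat.reduceEqDiff, reduceIte, h15,
        h17] at ht ⊢
      refine ⟨by omega, hf.setReg (by simp) _, by push_cast; ring, by push_cast; ring,
        fun a ha b hb => htab a b hb (by omega)⟩
  · rintro s' ⟨hf, h15, -⟩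
    simp only [Expr.eval, h15, hf.reg 13 (by simp), h13]
    omega
  · rintro t s' ⟨hf, h15, h17, htab⟩ ht
    simp only [Expr.cost, State.reg_setReg, State.arr_setReg, reduceIte, hf.reg 13 (by simp),
      h13] at ht ⊢
    rw [show 35 * N + 20 + (1 + 1 + 1 + 1 + 1) = 35 * N + 25 by omega] at ht
    exact ⟨by omega, hf.setReg (by simp) _, trivial, htab⟩

end Table


/-! ### Correctness of the enumeration and of the multiplication table. -/

section GroupTable

variable {F : Finset (Finset (Lit ℕ+))} {L : ℕ} {c : ℤ → Lit ℕ+} {cs : List (List (Lit ℕ+))}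

/-- The numbering of the automorphisms that have been written down. -/
lemma Enumerated.exists_equiv (hc : IsCycle F L c) (hF : IsTwoMU F) (hk : 2 ≤ deficiency F)
    {n N : ℕ} {I : ℤ → ℤ} {s : State} (h : Enumerated F c L n I (2 * L) N s) :
    ∃ e : Fin N ≃ autGroup F, ∀ (l : Fin N) (w : ℤ),
      litMap (e l : Equiv.Perm (lits F)) (interleave c w) =
        interleave c (act (s.arr 10 (l : ℕ)) w) := by
  choose g hg using fun l : Fin N => (h.code l l.2).2.2
  have hinj : Function.Injective g := by
    intro l l' e
    obtain ⟨h1, h2, -⟩ := h.code l l.2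
    obtain ⟨h3, h4, -⟩ := h.code l' l'.2
    have hd : (2 * L : ℤ) ∣ s.arr 10 (l : ℕ) - s.arr 10 (l' : ℕ) :=
      hc.code_unique hF hk fun w => by rw [← hg, ← hg, e]
    have h5 := Int.eq_zero_of_abs_lt_dvd hd (abs_lt.2 ⟨by omega, by omega⟩)
    have h6 := (h.index l l.2).1
    have h7 := (h.index l' l'.2).1
    rw [sub_eq_zero.1 h5, h7] at h6
    exact Fin.ext (by exact_mod_cast h6.symm)
  have hsurj : Function.Surjective g := by
    intro f
    obtain ⟨z, hz⟩ := hc.exists_aut_code hF hk f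
    obtain ⟨z', h1, h2, h3⟩ := hc.exists_residue z
    obtain ⟨l, hl, h4⟩ := h.complete z' h1 h2 (hc.isCode_congr ⟨f, hz⟩ h3)
    refine ⟨⟨l, hl⟩, Subtype.ext (hc.eq_of_code hF fun w => ?_)⟩
    rw [hg, hz, h4]
    exact (hc.interleave_congr (IsCycle.dvd_act_sub' w h3)).symm
  exact ⟨Equiv.ofBijective g ⟨hinj, hsurj⟩, hg⟩

/-- The product of automorphisms with codes z and z' has code `act z z'` modulo 2L. Array 9 stores
each index also at the code shifted by ±2L, so a sum or difference of two codes can be looked up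
directly. -/
lemma Enumerated.holdsGroupTable (hc : IsCycle F L c) (hF : IsTwoMU F) (hk : 2 ≤ deficiency F)
    (hcs : ListsClauses cs F) {N : ℕ} {s s' : State}
    (h : Enumerated F c L (dimacs cs).length (inputArr (dimacs cs)) (2 * L) N s)
    (h0 : s'.reg 0 = N) (h1 : s'.arr 1 = s.arr 1)
    (htab : ∀ a < N, ∀ b < N, s'.arr 2 (a * N + b : ℕ) = tableEntry s a b) :
    HoldsGroupTable cs F s' := by
  obtain ⟨e, he⟩ := h.exists_equiv hc hF hk
  refine ⟨N, e, h0, fun i p hp => ?_, fun i j => ?_⟩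
  · have hrow := h.rows i i.2 p hp
    rw [inputArr_natCast] at hrow
    have hmem : ∀ c ∈ cs, ∀ x ∈ c, x ∈ lits F := fun C hC x hx =>
      mem_lits (hcs.toFinset_mem hC) (List.mem_toFinset.2 hx)
    classical
    -- A decoding of integers, needed only to express the image row as an entrywise map of the
    -- input.
    have hdec : ∃ dec : ℤ → Lit ℕ+, ∀ x, dec (litCode x) = x :=
      ⟨Function.invFun litCode, Function.leftInverse_invFun fun x y h => litCode_inj.1 h⟩
    obtain ⟨dec, hdec⟩ := hdec
    rw [h1, dimacs_map (extend (e i : Equiv.Perm (lits F)))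
      (fun v => if v = 0 then 0 else litCode (extend (e i : Equiv.Perm (lits F)) (dec v)))
      (if_pos rfl) fun C _ x _ => by rw [if_neg (litCode_ne_zero x), hdec]]
    have hget : ∀ (f : ℤ → ℤ), ((dimacs cs).map f).getD p 0 = f ((dimacs cs).getD p 0) := by
      intro f
      rw [List.getD_eq_getElem _ _ (by simpa using hp), List.getD_eq_getElem _ _ hp,
        List.getElem_map]
    rw [hget]
    have hmemp : (dimacs cs).getD p 0 ∈ dimacs cs := by
      rw [List.getD_eq_getElem _ _ hp]
      exact List.getElem_mem hp
    rcases mem_dimacs hmemp with h2 | ⟨C, hC, x, hx, h2⟩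
    · rw [if_pos h2, hrow.1 h2]
    · obtain ⟨w, hw⟩ := (hc.mem_lits_iff_interleave hF).1 (hmem C hC x hx)
      rw [hrow.2 w (by rw [h2, hw]), h2, if_neg (litCode_ne_zero x), hdec, ← he, hw]
      rfl
  · obtain ⟨l, hl⟩ : ∃ l, e l = e i * e j := e.surjective _
    rw [htab i i.2 j j.2, ← hl, Equiv.symm_apply_apply]
    have hd : (2 * L : ℤ) ∣
        act (s.arr 10 (i : ℕ)) (s.arr 10 (j : ℕ)) - s.arr 10 (l : ℕ) := by
      refine hc.code_unique hF hk fun w => ?_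
      rw [← he, hl, ← hc.code_mul hF (he i) (he j)]
      rfl
    obtain ⟨hi1, hi2, -⟩ := h.code i i.2
    obtain ⟨hj1, hj2, -⟩ := h.code j j.2
    obtain ⟨hl1, hl2, -⟩ := h.code l l.2
    obtain ⟨x0, x1, x2⟩ := h.index l l.2
    have hL : (0 : ℤ) < L := hc.L_pos
    obtain ⟨x, hx⟩ := hd
    rw [tableEntry, h.sign i i.2, codeSign]
    unfold act at hx
    split_ifs at hx ⊢ with h2 h3 h3
    -- A sum of two codes lies in [0, 4L) and needs at most one subtraction of 2L.
    · have h4 : x < 2 := by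
        by_contra hge
        nlinarith
      have h5 : -1 < x := by
        by_contra hge
        nlinarith
      obtain rfl | rfl : x = 0 ∨ x = 1 := by omega
      · rw [← x0]
        congr 1
        omega
      · rw [← x2]
        congr 1
        omega
    · omega
    · omega
    -- A difference of two codes lies in (−2L, 2L) and needs at most one addition of 2L.
    · have h4 : x < 1 := by
        by_contra hge
        nlinarith
      have h5 : -2 < x := by
        by_contra hge
        nlinarith
      obtain rfl | rfl : x = 0 ∨ x = -1 := by omega
      · rw [← x0]
        congr 1
        omega
      · rw [← x1]
        congr 1
        omega

end GroupTable

/-! ### Counting positions for the running time. -/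

section Counting

variable {V : Type*} [DecidableEq V] {F : Finset (Finset (Lit V))} {L : ℕ} {c : ℤ → Lit V}

namespace IsCycle

lemma le_card_lits (hc : IsCycle F L c) : L ≤ (lits F).card := by
  rw [← Finset.card_range L]
  refine Finset.card_le_card_of_injOn (fun i : ℕ => c i)
    (fun i _ => mem_lits_of_arc (hc.arc i)) fun i hi j hj e => ?_
  simp only [Finset.coe_range, Set.mem_Iio] at hi hj
  exact_mod_cast hc.eq_of_lt e (by omega) (by omega)

-- Bounds the number of costly steps of the walk: complements at distinct positions of a turn are
-- distinct branching literals.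
open Classical in
lemma card_branching_compl_le (hc : IsCycle F L c) (hF : IsTwoMU F) {k : ℕ} (hk : 2 ≤ k)
    (hd : deficiency F = k) :
    ((Finset.range L).filter fun i : ℕ => Branching F (c i).compl).card ≤ 2 * k := by
  rw [← hc.card_branching hF hk hd]
  refine Finset.card_le_card_of_injOn (fun i : ℕ => (c i).compl) (fun i hi => ?_)
    fun i hi j hj e => ?_
  · simp only [Finset.coe_filter, Set.mem_ofPred_eq] at hi ⊢
    exact ⟨compl_mem_lits (mem_lits_of_arc (hc.arc i)), hi.2⟩
  · simp only [Finset.coe_filter, Finset.mem_range, Set.mem_ofPred_eq] at hi hj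
    exact_mod_cast hc.eq_of_lt (Lit.compl_inj.1 e) (by omega) (by omega)

-- Bounds the number of candidates examined in full: within [0, 2L) a literal has at most one
-- position of each parity.
open Classical in
lemma card_branching_interleave_le (hc : IsCycle F L c) (hF : IsTwoMU F) {k : ℕ} (hk : 2 ≤ k)
    (hd : deficiency F = k) :
    ((Finset.range (2 * L)).filter fun i : ℕ => Branching F (interleave c i)).card ≤ 4 * k := by
  have hcard : ((Finset.univ : Finset Bool) ×ˢ (lits F).filter (Branching F)).card = 4 * k := by
    rw [Finset.card_product, hc.card_branching hF hk hd, Finset.card_univ, Fintype.card_bool]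
    ring
  rw [← hcard]
  refine Finset.card_le_card_of_injOn
    (fun i : ℕ => (decide ((i : ℤ) % 2 = 0), interleave c i)) (fun i hi => ?_) fun i hi j hj e => ?_
  · simp only [Finset.coe_filter, Set.mem_ofPred_eq] at hi
    simp only [Finset.coe_product, Set.mem_prod, Finset.coe_univ, Set.mem_univ, true_and,
      Finset.mem_coe, Finset.mem_filter]
    exact ⟨(hc.mem_lits_iff_interleave hF).2 ⟨_, rfl⟩, hi.2⟩
  · simp only [Finset.coe_filter, Finset.mem_range, Set.mem_ofPred_eq] at hi hj
    simp only [Prod.mk.injEq, decide_eq_decide] at e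
    have h2 := (hc.interleave_eq_iff (by omega)).1 e.2
    have := Int.eq_zero_of_abs_lt_dvd h2 (abs_lt.2 ⟨by omega, by omega⟩)
    omega

end IsCycle

end Counting

/-! ### The complete program and its running time. -/

section Main

/-- Computes the group table of the automorphism group. -/
def groupTableProg : Prog := .block [
  adjacencyProg, startProg, walkProg, copyProg, enumerateProg, tableProg]

theorem wp_groupTableProg {F : Finset (Finset (Lit ℕ+))} {k : ℕ} (hk : 2 ≤ k) (hF : IsTwoMU F)
    (hd : deficiency F = k) {cs : List (List (Lit ℕ+))} (hcs : ListsClauses cs F) :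
    wp groupTableProg (initState (dimacs cs)) fun t s =>
      t ≤ 10000 * (k * length F) ∧ HoldsGroupTable cs F s := by
  classical
  have hk' : 2 ≤ deficiency F := by omega
  obtain ⟨L', c', hc'⟩ := hF.exists_isCycle hk'
  have h2 : ∀ C ∈ F, C.card = 2 := fun C hC => hc'.card_eq_two hF hk' hC
  have hn := length_dimacs (hcs.length_eq_two h2)
  rw [hcs.length_eq_card] at hn
  simp only [groupTableProg, Prog.block, wp_seq]
  refine (wp_adjacencyProg hcs h2 (hc'.litDegree_le_two hF)).mono ?_
  rintro t1 s1 ⟨ht1, h1n, h1I, hadj, h1z⟩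
  obtain ⟨nx, hnx⟩ := hadj.exists_isSucc
  have hex : ∃ x, Branching F x ∧ litCode x ∈ dimacs cs := by
    obtain ⟨b, -, -, hb, -⟩ := hc'.exists_third hF hk' 0 0
    obtain ⟨C, hC, -, -, -, hx, -⟩ := id hb
    obtain ⟨d, hd, rfl⟩ := hcs.exists_mem hC
    refine ⟨_, hb, ?_⟩
    simp only [dimacs, List.mem_flatMap, List.mem_append, List.mem_map]
    exact ⟨d, hd, .inl ⟨_, List.mem_toFinset.1 hx, rfl⟩⟩
  refine (wp_startProg h1I hadj.deg hadj.zero (fun v hv => ?_) hex).mono ?_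
  · rcases mem_dimacs hv with h | ⟨-, -, x, -, h⟩
    exacts [.inl h, .inr ⟨x, h⟩]
  rintro t2 s2 ⟨ht2, h2n, h2a, z, h2z, hz⟩
  -- The cycle is re-chosen to start at the literal the machine found and to follow arc 0 at the
  -- first branching point, as the machine does.
  obtain ⟨L, c, hc, hst⟩ : ∃ L c, IsCycle F L c ∧ c 0 = z ∧
      ∀ h, 0 ≤ h → Branching F (c h).compl →
        (∀ t, 0 < t → t ≤ h → ¬ Branching F (c t)) → c (h + 1) = nx (c h) 0 :=
    ⟨L', hc'.exists_start hF hk' hnx hz⟩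
  obtain ⟨rfl, hst⟩ := hst
  refine (wp_walkProg hc hF hk' hz (nx := nx) ?_ ?_ hst h2z ?_).mono ?_
  · rw [h2a]
    exact hadj.deg
  · rwa [h2a]
  · rwa [h2a]
  rintro t3 s3 ⟨ht3, h3n, h35, h3I, h3D, h37, h3z⟩
  refine (wp_copyProg hc h35 h37).mono ?_
  rintro t4 s4 ⟨ht4, hf4, h47⟩
  have h4n : s4.reg 0 = (dimacs cs).length := by rw [hf4.reg 0 (by simp), h3n, h2n, h1n]
  have h4I : s4.arr 0 = inputArr (dimacs cs) := by rw [hf4.arr 0 (by simp), h3I, h2a, h1I]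
  have h4D : ∀ x, s4.arr 3 (litCode x) = litDegree F x := by
    rw [hf4.arr 3 (by simp), h3D, h2a]
    exact hadj.deg
  have h48 : s4.arr 8 0 = 0 := by rw [hf4.arr 8 (by simp), h3z 8 le_rfl]
  have h45 : s4.reg 5 = 2 * L := by rw [hf4.reg 5 (by simp), h35]
  refine (wp_enumerateProg hc hF hz h4n h4I h4D h48 h45 h47).mono ?_
  rintro t5 s5 ⟨ht5, N, hE⟩
  refine (wp_tableProg hE.count).mono ?_
  rintro t6 s6 ⟨ht6, hf6, h60, htab⟩
  refine ⟨?_, hE.holdsGroupTable hc hF hk' hcs h60 (hf6.arr 1 (by simp)) htab⟩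
  have hN : N ≤ 4 * k := by
    obtain ⟨e, -⟩ := hE.exists_equiv hc hF hk'
    refine le_trans (le_of_eq ?_) (ncard_isomorphisms_le hk hF hd hF hd)
    rw [← Nat.card_fin N, Nat.card_congr e]
    rfl
  -- This absorbs the quadratic cost of the table, since k · k ≤ k · |F|.
  have hkF : k ≤ F.card := by
    rw [deficiency] at hd
    omega
  have hvF : (lits F).card ≤ 2 * F.card := by
    rw [card_lits]
    rw [deficiency] at hd
    omega
  have hL := hc.le_card_lits.trans hvF
  have hw := hc.card_branching_compl_le hF hk hd
  have hi := hc.card_branching_interleave_le hF hk hd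
  -- The sums split into a constant cost per position and a linear cost per branching position.
  rw [Finset.sum_add_distrib, Finset.sum_const, Finset.card_range, smul_eq_mul, ← Finset.sum_filter,
    Finset.sum_const, smul_eq_mul] at ht3 ht5
  rw [hc.length_eq hF hk']
  rw [hn] at ht2 ht5
  generalize F.card = m at *
  have e1 := Nat.mul_le_mul hw (show 30 * (L + 1) ≤ 60 * m + 30 by omega)
  have e2 := Nat.mul_le_mul hi (show 110 * L + 25 * (3 * m) + 80 ≤ 295 * m + 80 by omega)
  have e3 := Nat.mul_le_mul hN (show 35 * N + 25 ≤ 140 * m + 25 by omega)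
  have e4 : 2 * k * (60 * m + 30) = 120 * (k * m) + 60 * k := by ring
  have e5 : 4 * k * (295 * m + 80) = 1180 * (k * m) + 320 * k := by ring
  have e6 : 4 * k * (140 * m + 25) = 560 * (k * m) + 100 * k := by ring
  have e7 : m ≤ k * m := Nat.le_mul_of_pos_left _ (by omega)
  have e8 : k * (2 * m) = 2 * (k * m) := by ring
  rw [e8]
  omega

end Main

end TwoCNF

theorem mainTheorem6 :
    (∀ (V : Type*) [DecidableEq V] (k : ℕ), 2 ≤ k →
      (∀ F F' : Finset (Finset (TwoCNF.Lit V)),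
        TwoCNF.IsTwoMU F → TwoCNF.deficiency F = (k : ℤ) →
        TwoCNF.IsTwoMU F' → TwoCNF.deficiency F' = (k : ℤ) →
          {f : TwoCNF.lits F ≃ TwoCNF.lits F' | TwoCNF.IsIsomorphism F F' f}.Finite ∧
          {f : TwoCNF.lits F ≃ TwoCNF.lits F' | TwoCNF.IsIsomorphism F F' f}.ncard ≤ 4 * k) ∧
      (∀ F : Finset (Finset (TwoCNF.Lit V)),
        TwoCNF.IsTwoMU F → TwoCNF.deficiency F = (k : ℤ) →
          ∃ φ : TwoCNF.autGroup F →* DihedralGroup (2 * k), Function.Injective φ)) ∧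
    (∃ (P : TwoCNF.Prog) (c : ℕ), ∀ k : ℕ, 2 ≤ k →
      ∀ F : Finset (Finset (TwoCNF.Lit ℕ+)),
        TwoCNF.IsTwoMU F → TwoCNF.deficiency F = (k : ℤ) →
        ∀ cs : List (List (TwoCNF.Lit ℕ+)), TwoCNF.ListsClauses cs F →
          ∃ (t : ℕ) (s : TwoCNF.State),
            TwoCNF.Exec P (TwoCNF.initState (TwoCNF.dimacs cs)) t s ∧
            t ≤ c * (k * TwoCNF.length F) ∧
            TwoCNF.HoldsGroupTable cs F s) := by
  refine ⟨fun V _ k hk => ⟨fun F F' hF hd hF' hd' => ⟨Set.toFinite _,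
    TwoCNF.ncard_isomorphisms_le hk hF hd hF' hd'⟩, fun F hF hd =>
    TwoCNF.exists_autGroup_hom hk hF hd⟩, TwoCNF.groupTableProg, 10000, fun k hk F hF hd cs hcs => ?_⟩
  obtain ⟨t, s, h1, h2, h3⟩ := TwoCNF.wp_groupTableProg hk hF hd hcs
  exact ⟨t, s, h1, h2, h3⟩
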